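/- Let $n\ge 1$, let $U\subseteq\mathbb R^n$ be a connected open coordinate domain carrying a smooth nondegenerate symmetric metric $g_{ij}(x)$ (of any signature), and let $I,J\subseteq\mathbb R$ be nonempty open intervals, for the time $t$ and the dependent variable $u$. Put $\Gamma^i=g^{jk}\Gamma^i_{jk}$, with $\Gamma^i_{jk}$ the Christoffel symbols, let $q(t,x,u)$ be smooth on $I\times U\times J$, and let $H(b)=g^{ij}b_{ij}-\Gamma^ib_i-b_t$. Consider the heat equation with flux $$G:=g^{ij}u_{ij}-\Gamma^iu_i-u_t-q(t,x,u)=0 .$$ A Lie point symmetry is a smooth vector field $X=\xi^t\partial_t+\xi^i\partial_i+\eta\,\partial_u$, with coefficients depending on $(t,x,u)\in I\times U\times J$, such that its second prolongation satisfies $X^{[2]}G=\lambda G$ identically in the derivatives of $u$, for some function $\lambda$ of $t,x,u$ and the first derivatives of $u$. An HV/KV with factor $\psi$ is a smooth vector field $Y^i(x)$ on $U$ with $\mathcal L_Yg_{ij}=2\psi g_{ij}$, $\psi$ constant (Killing if $\psi=0$, homothetic if $\psi\neq0$). It is gradient if $Y^i=S^{,i}:=g^{ij}S_{,j}$ for some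 smooth $S$ on $U$. For a function $T(t)$, $\int T\,dt$ denotes the primitive vanishing at a fixed $t_0\in I$. All functions below are smooth. The Lie point symmetries are constructed from the homothetic algebra of $g$, as follows. **General form.** Every Lie point symmetry has the form $$X=\Big(2\psi_0t+2\sum_A\psi_A\!\int\! T_A\,dt+c_1\Big)\partial_t+\Big(Y^i+\sum_AT_AS_A^{,i}\Big)\partial_i+\Big(\big(-\tfrac12\sum_AT_{A,t}S_A+F(t)\big)u+b(t,x)\Big)\partial_u ,$$ where $Y$ is an HV/KV with factor $\psi_0$, the sums are finite, each $S_A^{,i}$ is a gradient HV/KV with factor $\psi_A$, and $c_1$ is a constant. Conversely, a vector field of this form is a Lie point symmetry if and only if, on $I\times U\times J$, $$0=\Big(\sum_A\big(-\tfrac12 n\psi_AT_{A,t}+\tfrac12T_{A,tt}S_A\big)-F_{,t}\Big)u+H(b)-(au+b)q_{,u}+aq-(\xi^tq)_{,t}-\Big(Y^i+\sum_AT_AS_A^{,i}\Big)q_{,i},$$ where $a=-\tfrac12\sum_AT_{A,t}S_A+F$ and $\xi^t=2\psi_0t+2\sum_A\psi_A\int T_A\,dt+c_1$. **a.** Let $Y$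 be a nongradient HV/KV with factor $\psi$. Every Lie point symmetry whose spatial part is $\xi^i=T(t)Y^i(x)$ for some function $T$ has the form $$X=(2c_2\psi t+c_1)\partial_t+c_2Y^i\partial_i+\big(a(t)u+b(t,x)\big)\partial_u$$ with constants $c_1,c_2$. A vector field of this form is a Lie point symmetry if and only if, on $I\times U\times J$, $$-a_tu+H(b)-(au+b)q_{,u}+aq-(2\psi c_2qt+c_1q)_t-c_2q_{,i}Y^i=0 .$$ **b.** Let $S^{,i}$ be a gradient HV/KV with factor $\psi$. Every Lie point symmetry whose spatial part is $\xi^i=T(t)S^{,i}(x)$ with $T$ smooth has the form $$X=\Big(2\psi\!\int\! T\,dt+c_1\Big)\partial_t+TS^{,i}\partial_i+\Big(\big(-\tfrac12T_{,t}S+F(t)\big)u+b(t,x)\Big)\partial_u$$ with a constant $c_1$. A vector field of this form is a Lie point symmetry if and only if, on $I\times U\times J$, $$0=\big(-\tfrac12n\psi T_{,t}+\tfrac12T_{,tt}S-F_{,t}\big)u+H(b)-\big((-\tfrac12T_{,t}S+F)u+b\big)q_{,u}+\big(-\tfrac12T_{,t}S+F\big)q-\Big(2\psi q\!\int\! T\,dt+c_1q\Big)_t-Tq_{,i}S^{,i}.$$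 -/

import Mathlib

open scoped ContDiff

namespace HeatFlux

/-! ### Jets, prolongations and Lie point symmetries

Independent variables are `z : ι → ℝ`, the dependent variable is `u : ℝ`; `p a` stands for `u_a` and
`r a b` for `u_{ab}`. -/

section Jets

variable {ι : Type*} [Fintype ι] [DecidableEq ι]

/-- The partial derivative `∂f/∂x^i` at `x`. -/
noncomputable def pd (i : ι) (f : (ι → ℝ) → ℝ) (x : ι → ℝ) : ℝ :=
  fderiv ℝ f x (Pi.single i 1)

/-- A vector field `X = ξ^a(z,u) ∂_a + η(z,u) ∂_u` on the space of variables `(z, u)`. -/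
structure PointField (ι : Type*) where
  ξ : ι → (ι → ℝ) → ℝ → ℝ
  η : (ι → ℝ) → ℝ → ℝ

/-- The total derivative `D_a f = f_{,a} + u_a f_{,u}` of a function `f(z,u)`. -/
noncomputable def totalD (a : ι) (f : (ι → ℝ) → ℝ → ℝ) (z : ι → ℝ) (u : ℝ) (p : ι → ℝ) : ℝ :=
  pd a (fun z' => f z' u) z + p a * deriv (f z) u

/-- The total derivative `D_b f = f_{,b} + u_b f_{,u} + u_{cb} ∂f/∂u_c` of a function
`f(z,u,u_a)`. -/
noncomputable def totalD₁ (b : ι) (f : (ι → ℝ) → ℝ → (ι → ℝ) → ℝ)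
    (z : ι → ℝ) (u : ℝ) (p : ι → ℝ) (r : ι → ι → ℝ) : ℝ :=
  pd b (fun z' => f z' u p) z + p b * deriv (fun v => f z v p) u
    + ∑ c, r c b * pd c (fun p' => f z u p') p

/-- The coefficient `η^{(1)}_a = D_a η - u_b D_a ξ^b` of the first prolongation. -/
noncomputable def PointField.η₁ (X : PointField ι) (a : ι)
    (z : ι → ℝ) (u : ℝ) (p : ι → ℝ) : ℝ :=
  totalD a X.η z u p - ∑ b, p b * totalD a (X.ξ b) z u p

/-- The coefficient `η^{(2)}_{ab} = D_b η^{(1)}_a - u_{ac} D_b ξ^c` of the second prolongation. -/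
noncomputable def PointField.η₂ (X : PointField ι) (a b : ι)
    (z : ι → ℝ) (u : ℝ) (p : ι → ℝ) (r : ι → ι → ℝ) : ℝ :=
  totalD₁ b (X.η₁ a) z u p r - ∑ c, r a c * totalD b (X.ξ c) z u p

/-- The second prolongation
`X^{[2]} = ξ^a ∂_a + η ∂_u + η^{(1)}_a ∂/∂u_a + η^{(2)}_{ab} ∂/∂u_{ab}`
applied to a function `G(z,u,u_a,u_{ab})`. -/
noncomputable def PointField.prolong₂ (X : PointField ι)
    (G : (ι → ℝ) → ℝ → (ι → ℝ) → (ι → ι → ℝ) → ℝ)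
    (z : ι → ℝ) (u : ℝ) (p : ι → ℝ) (r : ι → ι → ℝ) : ℝ :=
  fderiv ℝ (fun z' => G z' u p r) z (fun a => X.ξ a z u)
    + X.η z u * deriv (fun v => G z v p r) u
    + fderiv ℝ (fun p' => G z u p' r) p (fun a => X.η₁ a z u p)
    + fderiv ℝ (fun r' => G z u p r') r (fun a b => X.η₂ a b z u p r)

/-- `X` is a Lie point symmetry of the second order equation `G(z,u,u_a,u_{ab}) = 0` over `D × J`:
it is a smooth vector field there, and `X^{[2]} G = λ G` for some function `λ(z,u,u_a)`, identically
in the jet variables `u_a`, `u_{ab} = u_{ba}`. -/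
def IsLieSymmetry (D : Set (ι → ℝ)) (J : Set ℝ)
    (G : (ι → ℝ) → ℝ → (ι → ℝ) → (ι → ι → ℝ) → ℝ) (X : PointField ι) : Prop :=
  (∀ a, ContDiffOn ℝ ∞ (fun w : (ι → ℝ) × ℝ => X.ξ a w.1 w.2) (D ×ˢ J)) ∧
  ContDiffOn ℝ ∞ (fun w : (ι → ℝ) × ℝ => X.η w.1 w.2) (D ×ˢ J) ∧
  ∃ lam : (ι → ℝ) → ℝ → (ι → ℝ) → ℝ,
    ∀ z ∈ D, ∀ u ∈ J, ∀ (p : ι → ℝ) (r : ι → ι → ℝ), (∀ a b, r a b = r b a) →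
      X.prolong₂ G z u p r = lam z u p * G z u p r

end Jets

/-! ### Riemannian geometry in coordinates -/

section Geometry

variable {n : ℕ}

/-- `g` is a smooth (symmetric, nondegenerate) metric on the coordinate domain `U`; no signature is
imposed. -/
structure IsMetricOn (g : (Fin n → ℝ) → Matrix (Fin n) (Fin n) ℝ) (U : Set (Fin n → ℝ)) : Prop where
  smooth : ∀ i j, ContDiffOn ℝ ∞ (fun x => g x i j) U
  symm : ∀ x ∈ U, (g x).IsSymm
  nondegenerate : ∀ x ∈ U, (g x).det ≠ 0

/-- The Christoffel symbols `Γ^i_{jk}` of `g`. -/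
noncomputable def christoffel (g : (Fin n → ℝ) → Matrix (Fin n) (Fin n) ℝ)
    (i j k : Fin n) (x : Fin n → ℝ) : ℝ :=
  (1 / 2) * ∑ l, (g x)⁻¹ i l *
    (pd j (fun y => g y l k) x + pd k (fun y => g y l j) x - pd l (fun y => g y j k) x)

/-- `Γ^i = g^{jk} Γ^i_{jk}`. -/
noncomputable def contractedGamma (g : (Fin n → ℝ) → Matrix (Fin n) (Fin n) ℝ)
    (i : Fin n) (x : Fin n → ℝ) : ℝ :=
  ∑ j, ∑ k, (g x)⁻¹ j k * christoffel g i j k x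

/-- The components `(L_Y g)_{ij}` of the Lie derivative of the metric. -/
noncomputable def lieMetric (g : (Fin n → ℝ) → Matrix (Fin n) (Fin n) ℝ)
    (Y : (Fin n → ℝ) → Fin n → ℝ) (i j : Fin n) (x : Fin n → ℝ) : ℝ :=
  ∑ k, (Y x k * pd k (fun y => g y i j) x + g x k j * pd i (fun y => Y y k) x
    + g x i k * pd j (fun y => Y y k) x)

/-- `Y` is a smooth vector field on `U` with `L_Y g = 2 ψ g`, `ψ` constant: a homothetic vector
(`ψ ≠ 0`) or a Killing vector (`ψ = 0`). -/
def IsHomothetic (g : (Fin n → ℝ) → Matrix (Fin n) (Fin n) ℝ) (U : Set (Fin n → ℝ))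
    (Y : (Fin n → ℝ) → Fin n → ℝ) (ψ : ℝ) : Prop :=
  ContDiffOn ℝ ∞ Y U ∧ ∀ x ∈ U, ∀ i j, lieMetric g Y i j x = 2 * ψ * g x i j

/-- The gradient `S^{,i} = g^{ij} S_{,j}`. -/
noncomputable def grad (g : (Fin n → ℝ) → Matrix (Fin n) (Fin n) ℝ)
    (S : (Fin n → ℝ) → ℝ) (x : Fin n → ℝ) (i : Fin n) : ℝ :=
  ∑ j, (g x)⁻¹ i j * pd j S x

/-- `Y` is a gradient vector field on `U`. -/
def IsGradient (g : (Fin n → ℝ) → Matrix (Fin n) (Fin n) ℝ) (U : Set (Fin n → ℝ))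
    (Y : (Fin n → ℝ) → Fin n → ℝ) : Prop :=
  ∃ S : (Fin n → ℝ) → ℝ, ContDiffOn ℝ ∞ S U ∧ ∀ x ∈ U, ∀ i, Y x i = grad g S x i

end Geometry

/-! ### The heat equation with flux

The independent variables are `(t, x^1, …, x^n)`, indexed by `Fin (n + 1)` with `t` at index `0`. -/

section Heat

variable {n : ℕ}

/-- The domain `I × U` of the independent variables `(t, x)`. -/
def spaceTime (I : Set ℝ) (U : Set (Fin n → ℝ)) : Set (Fin (n + 1) → ℝ) :=
  {z | z 0 ∈ I ∧ Matrix.vecTail z ∈ U}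

/-- The function `g^{ij} u_{ij} - Γ^i u_i - u_t - q(t,x,u)` on the second jet space. -/
noncomputable def heatEq (g : (Fin n → ℝ) → Matrix (Fin n) (Fin n) ℝ)
    (q : ℝ → (Fin n → ℝ) → ℝ → ℝ)
    (z : Fin (n + 1) → ℝ) (u : ℝ) (p : Fin (n + 1) → ℝ) (r : Fin (n + 1) → Fin (n + 1) → ℝ) : ℝ :=
  ∑ i : Fin n, ∑ j : Fin n, (g (Matrix.vecTail z))⁻¹ i j * r i.succ j.succ
    - ∑ i : Fin n, contractedGamma g i (Matrix.vecTail z) * p i.succ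
    - p 0 - q (z 0) (Matrix.vecTail z) u

/-- `H(b) = g^{ij} b_{ij} - Γ^i b_i - b_t`. -/
noncomputable def heatOp (g : (Fin n → ℝ) → Matrix (Fin n) (Fin n) ℝ)
    (b : ℝ → (Fin n → ℝ) → ℝ) (t : ℝ) (x : Fin n → ℝ) : ℝ :=
  ∑ i, ∑ j, (g x)⁻¹ i j * pd j (pd i (b t)) x
    - ∑ i, contractedGamma g i x * pd i (b t) x - deriv (fun s => b s x) t

/-- `X = ξ^t ∂_t + ξ^i ∂_i + (a u + b) ∂_u` on `I × U × J`, with the displayed coefficients. -/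
def HasComponents (I : Set ℝ) (U : Set (Fin n → ℝ)) (J : Set ℝ) (X : PointField (Fin (n + 1)))
    (τ : ℝ → ℝ) (ξ : ℝ → (Fin n → ℝ) → Fin n → ℝ) (a b : ℝ → (Fin n → ℝ) → ℝ) : Prop :=
  ∀ t ∈ I, ∀ x ∈ U, ∀ u ∈ J,
    X.ξ 0 (Matrix.vecCons t x) u = τ t ∧
    (∀ i : Fin n, X.ξ i.succ (Matrix.vecCons t x) u = ξ t x i) ∧
    X.η (Matrix.vecCons t x) u = a t x * u + b t x

/-- `X = (2 c₂ ψ t + c₁) ∂_t + c₂ Y^i ∂_i + (a(t) u + b(t,x)) ∂_u`. -/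
def FormA (I : Set ℝ) (U : Set (Fin n → ℝ)) (J : Set ℝ) (X : PointField (Fin (n + 1)))
    (Y : (Fin n → ℝ) → Fin n → ℝ) (ψ c₁ c₂ : ℝ) (a : ℝ → ℝ) (b : ℝ → (Fin n → ℝ) → ℝ) : Prop :=
  HasComponents I U J X (fun t => 2 * c₂ * ψ * t + c₁) (fun _ x i => c₂ * Y x i)
    (fun t _ => a t) b

/-- The constraint equation on `a`, `b`, `q` for a nongradient vector `Y`. -/
def ConstraintA (I : Set ℝ) (U : Set (Fin n → ℝ)) (J : Set ℝ)
    (g : (Fin n → ℝ) → Matrix (Fin n) (Fin n) ℝ) (q : ℝ → (Fin n → ℝ) → ℝ → ℝ)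
    (Y : (Fin n → ℝ) → Fin n → ℝ) (ψ c₁ c₂ : ℝ) (a : ℝ → ℝ) (b : ℝ → (Fin n → ℝ) → ℝ) : Prop :=
  ∀ t ∈ I, ∀ x ∈ U, ∀ u ∈ J,
    -(deriv a t) * u + heatOp g b t x - (a t * u + b t x) * deriv (q t x) u + a t * q t x u
      - deriv (fun s => 2 * ψ * c₂ * q s x u * s + c₁ * q s x u) t
      - c₂ * ∑ i, pd i (fun y => q t y u) x * Y x i = 0

/-- `X = (2 ψ ∫ T dt + c₁) ∂_t + T S^{,i} ∂_i + ((-½ T_{,t} S + F(t)) u + b(t,x)) ∂_u`;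
`∫ T dt` is the primitive that vanishes at `t₀`. -/
def FormB (I : Set ℝ) (U : Set (Fin n → ℝ)) (J : Set ℝ) (X : PointField (Fin (n + 1)))
    (g : (Fin n → ℝ) → Matrix (Fin n) (Fin n) ℝ) (t₀ : ℝ)
    (S : (Fin n → ℝ) → ℝ) (ψ c₁ : ℝ) (T F : ℝ → ℝ) (b : ℝ → (Fin n → ℝ) → ℝ) : Prop :=
  HasComponents I U J X (fun t => 2 * ψ * (∫ s in t₀..t, T s) + c₁)
    (fun t x i => T t * grad g S x i)
    (fun t x => -(1 / 2) * deriv T t * S x + F t) b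

/-- The constraint equation on `T`, `F`, `b`, `q` for a gradient vector `S^{,i}`. -/
def ConstraintB (I : Set ℝ) (U : Set (Fin n → ℝ)) (J : Set ℝ)
    (g : (Fin n → ℝ) → Matrix (Fin n) (Fin n) ℝ) (q : ℝ → (Fin n → ℝ) → ℝ → ℝ) (t₀ : ℝ)
    (S : (Fin n → ℝ) → ℝ) (ψ c₁ : ℝ) (T F : ℝ → ℝ) (b : ℝ → (Fin n → ℝ) → ℝ) : Prop :=
  ∀ t ∈ I, ∀ x ∈ U, ∀ u ∈ J,
    (-(1 / 2) * n * ψ * deriv T t + (1 / 2) * deriv (deriv T) t * S x - deriv F t) * u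
      + heatOp g b t x
      - ((-(1 / 2) * deriv T t * S x + F t) * u + b t x) * deriv (q t x) u
      + (-(1 / 2) * deriv T t * S x + F t) * q t x u
      - deriv (fun s => 2 * ψ * q s x u * (∫ s' in t₀..s, T s') + c₁ * q s x u) t
      - T t * ∑ i, pd i (fun y => q t y u) x * grad g S x i = 0

/-- The superposition
`X = (2 ψ₀ t + 2 ∑_A ψ_A ∫ T_A dt + c₁) ∂_t + (Y^i + ∑_A T_A S_A^{,i}) ∂_i
  + ((-½ ∑_A T_{A,t} S_A + F(t)) u + b(t,x)) ∂_u`. -/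
def FormSum (I : Set ℝ) (U : Set (Fin n → ℝ)) (J : Set ℝ) (X : PointField (Fin (n + 1)))
    (g : (Fin n → ℝ) → Matrix (Fin n) (Fin n) ℝ) (t₀ : ℝ)
    (Y : (Fin n → ℝ) → Fin n → ℝ) (ψ₀ c₁ : ℝ) {N : ℕ} (S : Fin N → (Fin n → ℝ) → ℝ)
    (ψ : Fin N → ℝ) (T : Fin N → ℝ → ℝ) (F : ℝ → ℝ) (b : ℝ → (Fin n → ℝ) → ℝ) : Prop :=
  HasComponents I U J X
    (fun t => 2 * ψ₀ * t + 2 * ∑ A, ψ A * (∫ s in t₀..t, T A s) + c₁)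
    (fun t x i => Y x i + ∑ A, T A t * grad g (S A) x i)
    (fun t x => -(1 / 2) * ∑ A, deriv (T A) t * S A x + F t) b

/-- The constraint equation for a superposition. -/
def ConstraintSum (I : Set ℝ) (U : Set (Fin n → ℝ)) (J : Set ℝ)
    (g : (Fin n → ℝ) → Matrix (Fin n) (Fin n) ℝ) (q : ℝ → (Fin n → ℝ) → ℝ → ℝ) (t₀ : ℝ)
    (Y : (Fin n → ℝ) → Fin n → ℝ) (ψ₀ c₁ : ℝ) {N : ℕ} (S : Fin N → (Fin n → ℝ) → ℝ)
    (ψ : Fin N → ℝ) (T : Fin N → ℝ → ℝ) (F : ℝ → ℝ) (b : ℝ → (Fin n → ℝ) → ℝ) : Prop :=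
  ∀ t ∈ I, ∀ x ∈ U, ∀ u ∈ J,
    (∑ A, (-(1 / 2) * n * ψ A * deriv (T A) t + (1 / 2) * deriv (deriv (T A)) t * S A x)
        - deriv F t) * u
      + heatOp g b t x
      - ((-(1 / 2) * ∑ A, deriv (T A) t * S A x + F t) * u + b t x) * deriv (q t x) u
      + (-(1 / 2) * ∑ A, deriv (T A) t * S A x + F t) * q t x u
      - deriv (fun s =>
          (2 * ψ₀ * s + 2 * ∑ A, ψ A * (∫ s' in t₀..s, T A s') + c₁) * q s x u) t
      - ∑ i, pd i (fun y => q t y u) x * (Y x i + ∑ A, T A t * grad g (S A) x i) = 0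

end Heat

end HeatFlux

/-! The condition `X^{[2]} G = λ G` is polynomial in the jet variables, and its coefficients are
compared from the top order down. The mixed derivatives `u_{ti}` force `ξ^t` to depend on `t` alone.
The spatial second derivatives, once `λ` is known, say that `ξ^i` is free of `u` and that each
`ξ(t,·)` is homothetic with factor `ξ^t_{,t}/2`; `λ` itself is found from the coefficient of `u_t`,
which gives `λ = η_u - ξ^t_{,t}` (`IsLieSymmetry.coefficients`, `IsLieSymmetry.first_determining`).

A homothetic field also rescales the contracted Christoffel symbols
(`IsHomothetic.lie_contractedGamma`), so all terms containing `Γ^i` and second derivatives of `ξ`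
cancel. What is left is quadratic in `u_i` (`IsProjectable.prolong_sub`). Its quadratic part gives
`η = a u + b`, its linear part gives `ξ^k_{,t} = -2 a^{,k}`, and its constant part is the constraint
(`IsLieSymmetry.exists_components`). Conversely, these conditions make `X` a symmetry with `λ = a -
ξ^t_{,t}` (`HasComponents.isLieSymmetry_iff`).

Differentiating the homothetic equation in `t` shows that every `a(t,·)` is the potential of a
gradient homothetic field, with factor `-ξ^t_{,tt}/4`. Such potentials form a finite-dimensional
space: one with factor zero has vanishing covariant Hessian, so on a connected domain it is
determined by its 1-jet at a point (`IsHomothetic.eq_zero_of_grad`). Hence `a(t,·)` is a combination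
of finitely many of its own values, with smooth coefficients in `t` (`exists_finite_potentials`),
and integrating `ξ_{,t} = -2 ∇a` and `ξ^t_{,tt}` from `t₀` yields the general form. Since a
potential with factor `ψ` has Laplacian `nψ` (`IsHomothetic.laplacian_eq`), the constant part
becomes the stated constraint.

In case a, `T_{,t} Y = -2 ∇a` would make a nongradient `Y` a gradient wherever `T_{,t} ≠ 0`, so `T`
is constant. In case b the same equation determines `a` up to a function of `t`. The two constraint
equations are the superposition with no gradient term and with one. -/

set_option linter.unusedSectionVars false

namespace HeatFlux

open Filter Topology

/-! ### Partial derivatives -/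

section PartialDerivatives

variable {ι : Type*} [Fintype ι] [DecidableEq ι] {f h : (ι → ℝ) → ℝ} {x : ι → ℝ}
  {U : Set (ι → ℝ)}

theorem pd_congr_on (hU : IsOpen U) (hfh : ∀ y ∈ U, f y = h y) (hx : x ∈ U) (i : ι) :
    pd i f x = pd i h x := by
  have : f =ᶠ[𝓝 x] h := by
    filter_upwards [hU.mem_nhds hx] with y hy using hfh y hy
  unfold pd
  rw [this.fderiv_eq]

theorem pd_add (hf : DifferentiableAt ℝ f x) (hh : DifferentiableAt ℝ h x) (i : ι) :
    pd i (fun y => f y + h y) x = pd i f x + pd i h x := by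
  unfold pd
  rw [fderiv_fun_add hf hh]; rfl

theorem pd_sub (hf : DifferentiableAt ℝ f x) (hh : DifferentiableAt ℝ h x) (i : ι) :
    pd i (fun y => f y - h y) x = pd i f x - pd i h x := by
  unfold pd
  rw [fderiv_fun_sub hf hh]; rfl

theorem pd_mul (hf : DifferentiableAt ℝ f x) (hh : DifferentiableAt ℝ h x) (i : ι) :
    pd i (fun y => f y * h y) x = pd i f x * h x + f x * pd i h x := by
  unfold pd
  rw [fderiv_fun_mul hf hh]
  simp; ring

theorem pd_const_mul (hf : DifferentiableAt ℝ f x) (c : ℝ) (i : ι) :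
    pd i (fun y => c * f y) x = c * pd i f x := by
  unfold pd
  rw [fderiv_const_mul hf]; rfl

theorem pd_mul_const (hf : DifferentiableAt ℝ f x) (c : ℝ) (i : ι) :
    pd i (fun y => f y * c) x = pd i f x * c := by
  unfold pd
  rw [fderiv_mul_const hf]; simp [mul_comm]

theorem pd_const (c : ℝ) (i : ι) : pd i (fun _ : ι → ℝ => c) x = 0 := by
  unfold pd
  simp

theorem pd_sum {κ : Type*} {s : Finset κ} {F : κ → (ι → ℝ) → ℝ}
    (hF : ∀ k ∈ s, DifferentiableAt ℝ (F k) x) (i : ι) :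
    pd i (fun y => ∑ k ∈ s, F k y) x = ∑ k ∈ s, pd i (F k) x := by
  unfold pd
  rw [fderiv_fun_sum hF]; simp

theorem fderiv_eq_sum_pd (v : ι → ℝ) : fderiv ℝ f x v = ∑ k, v k * pd k f x := by
  have := (fderiv ℝ f x).toLinearMap.pi_apply_eq_sum_univ v
  simpa [pd, ← Pi.single_apply, Pi.single_comm] using this

theorem pd_apply (i c : ι) : pd i (fun y => y c) x = if c = i then 1 else 0 := by
  unfold pd
  have : HasFDerivAt (fun y : ι → ℝ => y c)
      (ContinuousLinearMap.proj (R := ℝ) (φ := fun _ : ι => ℝ) c) x := hasFDerivAt_apply c x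
  rw [this.fderiv]
  simp [Pi.single_apply]

end PartialDerivatives

/-! ### Smooth functions of two variables -/

section TwoVariables

variable {E F : Type*} [NormedAddCommGroup E] [NormedSpace ℝ E] [NormedAddCommGroup F]
  [NormedSpace ℝ F]

theorem _root_.ContDiffOn.diffAt {f : E → F} {U : Set E} (hf : ContDiffOn ℝ ∞ f U)
    (hU : IsOpen U) {x : E} (hx : x ∈ U) : DifferentiableAt ℝ f x :=
  (hf.contDiffAt (hU.mem_nhds hx)).differentiableAt (by simp)

theorem contDiffOn_fderiv_apply {f : E → F} {U : Set E} (hf : ContDiffOn ℝ ∞ f U)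
    (hU : IsOpen U) (v : E) : ContDiffOn ℝ ∞ (fun x => fderiv ℝ f x v) U :=
  (hf.fderiv_of_isOpen hU (by simp)).clm_apply contDiffOn_const

theorem fderiv_fderiv_comm {f : E → ℝ} {U : Set E} (hf : ContDiffOn ℝ ∞ f U)
    (hU : IsOpen U) {x : E} (hx : x ∈ U) (v w : E) :
    fderiv ℝ (fun y => fderiv ℝ f y v) x w = fderiv ℝ (fun y => fderiv ℝ f y w) x v := by
  have h1 : DifferentiableAt ℝ (fderiv ℝ f) x :=
    (hf.fderiv_of_isOpen (m := ∞) hU (by simp)).diffAt hU hx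
  have h2 := (hf.contDiffAt (hU.mem_nhds hx)).isSymmSndFDerivAt
    (by simpa using (WithTop.coe_le_coe.2 le_top : ((2 : ℕ∞) : WithTop ℕ∞) ≤ ∞))
  rw [fderiv_clm_apply h1 (by fun_prop), fderiv_clm_apply h1 (by fun_prop)]
  simpa using h2 w v

variable {f : E → F → ℝ} {U : Set E} {V : Set F}

theorem contDiffOn_slice_left (hf : ContDiffOn ℝ ∞ (fun w : E × F => f w.1 w.2) (U ×ˢ V))
    {y : F} (hy : y ∈ V) : ContDiffOn ℝ ∞ (fun x => f x y) U :=
  hf.comp (f := fun x : E => (x, y)) (by fun_prop) fun _ hx => ⟨hx, hy⟩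

theorem contDiffOn_slice_right (hf : ContDiffOn ℝ ∞ (fun w : E × F => f w.1 w.2) (U ×ˢ V))
    {x : E} (hx : x ∈ U) : ContDiffOn ℝ ∞ (f x) V :=
  hf.comp (f := fun y : F => (x, y)) (by fun_prop) fun _ hy => ⟨hx, hy⟩

theorem fderiv_slice_left (hf : ContDiffOn ℝ ∞ (fun w : E × F => f w.1 w.2) (U ×ˢ V))
    (hU : IsOpen U) (hV : IsOpen V) {x : E} (hx : x ∈ U) {y : F} (hy : y ∈ V) (v : E) :
    fderiv ℝ (fun x' => f x' y) x v = fderiv ℝ (fun w : E × F => f w.1 w.2) (x, y) (v, 0) := by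
  have h : HasFDerivAt (fun w : E × F => f w.1 w.2) _ (x, y) :=
    (hf.diffAt (hU.prod hV) (x := (x, y)) ⟨hx, hy⟩).hasFDerivAt
  have h2 := HasFDerivAt.comp (f := fun x' => (x', y)) x h (hasFDerivAt_prodMk_left x y)
  have h3 := h2.fderiv
  simp only [Function.comp_def] at h3
  rw [h3]; simp

theorem fderiv_slice_right (hf : ContDiffOn ℝ ∞ (fun w : E × F => f w.1 w.2) (U ×ˢ V))
    (hU : IsOpen U) (hV : IsOpen V) {x : E} (hx : x ∈ U) {y : F} (hy : y ∈ V) (v : F) :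
    fderiv ℝ (f x) y v = fderiv ℝ (fun w : E × F => f w.1 w.2) (x, y) (0, v) := by
  have h : HasFDerivAt (fun w : E × F => f w.1 w.2) _ (x, y) :=
    (hf.diffAt (hU.prod hV) (x := (x, y)) ⟨hx, hy⟩).hasFDerivAt
  have h2 := HasFDerivAt.comp (f := fun y' => (x, y')) y h (hasFDerivAt_prodMk_right x y)
  have h3 := h2.fderiv
  simp only [Function.comp_def] at h3
  rw [show f x = fun y => f x y from rfl, h3]; simp

theorem contDiffOn_fderiv_left (hf : ContDiffOn ℝ ∞ (fun w : E × F => f w.1 w.2) (U ×ˢ V))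
    (hU : IsOpen U) (hV : IsOpen V) (v : E) :
    ContDiffOn ℝ ∞ (fun w : E × F => fderiv ℝ (fun x' => f x' w.2) w.1 v) (U ×ˢ V) :=
  (contDiffOn_fderiv_apply hf (hU.prod hV) (v, 0)).congr fun _ hw =>
    fderiv_slice_left hf hU hV hw.1 hw.2 v

theorem contDiffOn_fderiv_right (hf : ContDiffOn ℝ ∞ (fun w : E × F => f w.1 w.2) (U ×ˢ V))
    (hU : IsOpen U) (hV : IsOpen V) (v : F) :
    ContDiffOn ℝ ∞ (fun w : E × F => fderiv ℝ (f w.1) w.2 v) (U ×ˢ V) :=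
  (contDiffOn_fderiv_apply hf (hU.prod hV) (0, v)).congr fun _ hw =>
    fderiv_slice_right hf hU hV hw.1 hw.2 v

/-- Both iterated partial derivatives are values of the second derivative of the uncurried function,
which is symmetric. -/
theorem fderiv_slice_comm (hf : ContDiffOn ℝ ∞ (fun w : E × F => f w.1 w.2) (U ×ˢ V))
    (hU : IsOpen U) (hV : IsOpen V) {x : E} (hx : x ∈ U) {y : F} (hy : y ∈ V) (v : E) (w : F) :
    fderiv ℝ (fun x' => fderiv ℝ (f x') y w) x v
      = fderiv ℝ (fun y' => fderiv ℝ (fun x' => f x' y') x v) y w := by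
  rw [fderiv_slice_left (f := fun x' y' => fderiv ℝ (f x') y' w)
      (contDiffOn_fderiv_right hf hU hV w) hU hV hx hy,
    fderiv_slice_right (f := fun x' y' => fderiv ℝ (fun x'' => f x'' y') x' v)
      (contDiffOn_fderiv_left hf hU hV v) hU hV hx hy]
  have hW := (hU.prod hV).mem_nhds (show (x, y) ∈ U ×ˢ V from ⟨hx, hy⟩)
  have e1 : (fun p : E × F => fderiv ℝ (f p.1) p.2 w) =ᶠ[𝓝 (x, y)]
      fun p => fderiv ℝ (fun w : E × F => f w.1 w.2) p (0, w) := by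
    filter_upwards [hW] with p hp using fderiv_slice_right hf hU hV hp.1 hp.2 w
  have e2 : (fun p : E × F => fderiv ℝ (fun x'' => f x'' p.2) p.1 v) =ᶠ[𝓝 (x, y)]
      fun p => fderiv ℝ (fun w : E × F => f w.1 w.2) p (v, 0) := by
    filter_upwards [hW] with p hp using fderiv_slice_left hf hU hV hp.1 hp.2 v
  rw [e1.fderiv_eq, e2.fderiv_eq]
  exact fderiv_fderiv_comm hf (hU.prod hV) ⟨hx, hy⟩ _ _

end TwoVariables

/-! ### Smoothness and commutation of partial derivatives -/

section Smoothness

variable {ι : Type*} [Fintype ι] [DecidableEq ι] {U : Set (ι → ℝ)} {I : Set ℝ}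

theorem contDiffOn_pd {f : (ι → ℝ) → ℝ} (hf : ContDiffOn ℝ ∞ f U) (hU : IsOpen U) (i : ι) :
    ContDiffOn ℝ ∞ (pd i f) U :=
  contDiffOn_fderiv_apply hf hU _

theorem pd_comm {f : (ι → ℝ) → ℝ} (hf : ContDiffOn ℝ ∞ f U) (hU : IsOpen U) {x : ι → ℝ}
    (hx : x ∈ U) (i j : ι) : pd i (pd j f) x = pd j (pd i f) x :=
  fderiv_fderiv_comm hf hU hx _ _

theorem contDiffOn_deriv {f : ℝ → ℝ} (hf : ContDiffOn ℝ ∞ f I) (hI : IsOpen I) :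
    ContDiffOn ℝ ∞ (deriv f) I :=
  hf.deriv_of_isOpen hI (by simp)

section TimeFirst

variable {f : ℝ → (ι → ℝ) → ℝ}

theorem contDiffOn_dt (hf : ContDiffOn ℝ ∞ (fun w : ℝ × (ι → ℝ) => f w.1 w.2) (I ×ˢ U))
    (hI : IsOpen I) (hU : IsOpen U) :
    ContDiffOn ℝ ∞ (fun w : ℝ × (ι → ℝ) => deriv (fun s => f s w.2) w.1) (I ×ˢ U) :=
  contDiffOn_fderiv_left hf hI hU 1

theorem contDiffOn_dx (hf : ContDiffOn ℝ ∞ (fun w : ℝ × (ι → ℝ) => f w.1 w.2) (I ×ˢ U))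
    (hI : IsOpen I) (hU : IsOpen U) (i : ι) :
    ContDiffOn ℝ ∞ (fun w : ℝ × (ι → ℝ) => pd i (f w.1) w.2) (I ×ˢ U) :=
  contDiffOn_fderiv_right hf hI hU _

theorem deriv_pd_comm (hf : ContDiffOn ℝ ∞ (fun w : ℝ × (ι → ℝ) => f w.1 w.2) (I ×ˢ U))
    (hI : IsOpen I) (hU : IsOpen U) {t : ℝ} (ht : t ∈ I) {x : ι → ℝ} (hx : x ∈ U) (i : ι) :
    deriv (fun s => pd i (f s) x) t = pd i (fun y => deriv (fun s => f s y) t) x :=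
  fderiv_slice_comm hf hI hU ht hx 1 _

end TimeFirst

section FieldFirst

variable {f : (ι → ℝ) → ℝ → ℝ} {J : Set ℝ}

theorem contDiffOn_pd_left (hf : ContDiffOn ℝ ∞ (fun w : (ι → ℝ) × ℝ => f w.1 w.2) (U ×ˢ J))
    (hU : IsOpen U) (hJ : IsOpen J) (i : ι) :
    ContDiffOn ℝ ∞ (fun w : (ι → ℝ) × ℝ => pd i (fun z => f z w.2) w.1) (U ×ˢ J) :=
  contDiffOn_fderiv_left hf hU hJ _

theorem contDiffOn_du (hf : ContDiffOn ℝ ∞ (fun w : (ι → ℝ) × ℝ => f w.1 w.2) (U ×ˢ J))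
    (hU : IsOpen U) (hJ : IsOpen J) :
    ContDiffOn ℝ ∞ (fun w : (ι → ℝ) × ℝ => deriv (f w.1) w.2) (U ×ˢ J) :=
  contDiffOn_fderiv_right hf hU hJ 1

end FieldFirst

end Smoothness

/-! ### Splitting space-time -/

section SpaceTime

variable {n : ℕ} {I : Set ℝ} {U : Set (Fin n → ℝ)}

/-- The splitting `z ↦ (t, x)` of space-time. -/
noncomputable def splitL (n : ℕ) : (Fin (n + 1) → ℝ) →L[ℝ] ℝ × (Fin n → ℝ) :=
  (ContinuousLinearMap.proj 0).prod
    (ContinuousLinearMap.pi fun i => ContinuousLinearMap.proj i.succ)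

theorem splitL_apply (z : Fin (n + 1) → ℝ) : splitL n z = (z 0, Matrix.vecTail z) := rfl

/-- The inclusion `(t, x) ↦ z`. -/
noncomputable def joinL (n : ℕ) : ℝ × (Fin n → ℝ) →L[ℝ] (Fin (n + 1) → ℝ) :=
  ContinuousLinearMap.pi fun a => Fin.cases (ContinuousLinearMap.fst ℝ ℝ (Fin n → ℝ))
    (fun i => (ContinuousLinearMap.proj i).comp (ContinuousLinearMap.snd ℝ ℝ (Fin n → ℝ))) a

theorem joinL_apply (w : ℝ × (Fin n → ℝ)) : joinL n w = Matrix.vecCons w.1 w.2 := by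
  funext a
  refine Fin.cases ?_ (fun i => ?_) a <;> simp [joinL]

theorem vecCons_split (z : Fin (n + 1) → ℝ) : Matrix.vecCons (z 0) (Matrix.vecTail z) = z :=
  Matrix.cons_head_tail z

theorem tail_vecCons (t : ℝ) (x : Fin n → ℝ) : Matrix.vecTail (Matrix.vecCons t x) = x := rfl

theorem isOpen_spaceTime (hI : IsOpen I) (hU : IsOpen U) : IsOpen (spaceTime I U) :=
  (hI.prod hU).preimage (splitL n).continuous

theorem vecCons_mem {t : ℝ} {x : Fin n → ℝ} (ht : t ∈ I) (hx : x ∈ U) :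
    Matrix.vecCons t x ∈ spaceTime I U := ⟨ht, hx⟩

theorem fderiv_split {f : ℝ → (Fin n → ℝ) → ℝ}
    (hf : ContDiffOn ℝ ∞ (fun w : ℝ × (Fin n → ℝ) => f w.1 w.2) (I ×ˢ U))
    (hI : IsOpen I) (hU : IsOpen U) {t : ℝ} (ht : t ∈ I) {x : Fin n → ℝ} (hx : x ∈ U)
    (w : Fin (n + 1) → ℝ) :
    fderiv ℝ (fun z => f (z 0) (Matrix.vecTail z)) (Matrix.vecCons t x) w
      = w 0 * deriv (fun s => f s x) t + ∑ k : Fin n, w k.succ * pd k (f t) x := by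
  have h : HasFDerivAt (fun w : ℝ × (Fin n → ℝ) => f w.1 w.2) _
      (splitL n (Matrix.vecCons t x)) :=
    (hf.diffAt (hI.prod hU) (x := (t, x)) ⟨ht, hx⟩).hasFDerivAt
  have h2 := (h.comp (Matrix.vecCons t x) (splitL n).hasFDerivAt).fderiv
  have h3 : ((fun w : ℝ × (Fin n → ℝ) => f w.1 w.2) ∘ (splitL n))
    = fun z => f (z 0) (Matrix.vecTail z) := rfl
  rw [h3] at h2
  rw [h2]
  have e : splitL n w = w 0 • ((1 : ℝ), (0 : Fin n → ℝ)) + ((0 : ℝ), Matrix.vecTail w) := by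
    simp [splitL_apply]
  rw [ContinuousLinearMap.comp_apply, e, map_add, map_smul]
  congr 1
  · rw [smul_eq_mul]
    congr 1
    exact (fderiv_slice_left hf hI hU ht hx 1).symm
  · rw [← fderiv_slice_right hf hI hU ht hx, fderiv_eq_sum_pd]
    rfl

theorem pd_zero_split {f : ℝ → (Fin n → ℝ) → ℝ}
    (hf : ContDiffOn ℝ ∞ (fun w : ℝ × (Fin n → ℝ) => f w.1 w.2) (I ×ˢ U))
    (hI : IsOpen I) (hU : IsOpen U) {t : ℝ} (ht : t ∈ I) {x : Fin n → ℝ} (hx : x ∈ U) :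
    pd 0 (fun z => f (z 0) (Matrix.vecTail z)) (Matrix.vecCons t x)
      = deriv (fun s => f s x) t := by
  unfold pd
  rw [fderiv_split hf hI hU ht hx]
  simp

theorem pd_succ_split {f : ℝ → (Fin n → ℝ) → ℝ}
    (hf : ContDiffOn ℝ ∞ (fun w : ℝ × (Fin n → ℝ) => f w.1 w.2) (I ×ˢ U))
    (hI : IsOpen I) (hU : IsOpen U) {t : ℝ} (ht : t ∈ I) {x : Fin n → ℝ} (hx : x ∈ U)
    (i : Fin n) :
    pd i.succ (fun z => f (z 0) (Matrix.vecTail z)) (Matrix.vecCons t x) = pd i (f t) x := by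
  conv_lhs => unfold pd
  rw [fderiv_split hf hI hU ht hx]
  simp [Pi.single_apply, Fin.succ_ne_zero]

theorem contDiffOn_split {f : ℝ → (Fin n → ℝ) → ℝ}
    (hf : ContDiffOn ℝ ∞ (fun w : ℝ × (Fin n → ℝ) => f w.1 w.2) (I ×ˢ U)) :
    ContDiffOn ℝ ∞ (fun z => f (z 0) (Matrix.vecTail z)) (spaceTime I U) :=
  hf.comp (f := splitL n) (splitL n).contDiff.contDiffOn fun _ hz => hz

theorem contDiffOn_join {f : (Fin (n + 1) → ℝ) → ℝ} (hf : ContDiffOn ℝ ∞ f (spaceTime I U)) :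
    ContDiffOn ℝ ∞ (fun w : ℝ × (Fin n → ℝ) => f (Matrix.vecCons w.1 w.2)) (I ×ˢ U) := by
  have := hf.comp (f := joinL n) (s := I ×ˢ U) (joinL n).contDiff.contDiffOn
    fun w hw => by rw [joinL_apply]; exact hw
  simpa only [Function.comp_def, joinL_apply] using this

end SpaceTime

end HeatFlux

namespace HeatFlux

open Filter Topology

/-! ### The inverse metric -/

section Metric

variable {n : ℕ} {g : (Fin n → ℝ) → Matrix (Fin n) (Fin n) ℝ} {U : Set (Fin n → ℝ)}
  {x : Fin n → ℝ}

theorem contDiffOn_det {E : Type*} [NormedAddCommGroup E] [NormedSpace ℝ E] {V : Set E}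
    {M : E → Matrix (Fin n) (Fin n) ℝ} (hM : ∀ i j, ContDiffOn ℝ ∞ (fun x => M x i j) V) :
    ContDiffOn ℝ ∞ (fun x => (M x).det) V := by
  simp only [Matrix.det_apply']
  exact ContDiffOn.sum fun σ _ => contDiffOn_const.mul
    (contDiffOn_prod fun i _ => hM (σ i) i)

theorem IsMetricOn.smooth_inv (hg : IsMetricOn g U) (i j : Fin n) :
    ContDiffOn ℝ ∞ (fun x => (g x)⁻¹ i j) U := by
  -- By Cramer's rule an entry of the inverse is a quotient of two determinants, each polynomial in
  -- smooth entries.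
  have h : ∀ x, (g x)⁻¹ i j = (g x).det⁻¹ * ((g x).updateRow j (Pi.single i 1)).det := by
    intro x
    rw [Matrix.inv_def, Matrix.smul_apply, Ring.inverse_eq_inv', Matrix.adjugate_apply,
      smul_eq_mul]
  simp only [h]
  refine ((contDiffOn_det hg.smooth).inv hg.nondegenerate).mul (contDiffOn_det fun a b => ?_)
  by_cases hab : a = j
  · subst hab
    simpa only [Matrix.updateRow_self] using contDiffOn_const
  · simpa only [Matrix.updateRow_ne hab] using hg.smooth a b

theorem IsMetricOn.mul_inv (hg : IsMetricOn g U) (hx : x ∈ U) : g x * (g x)⁻¹ = 1 :=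
  Matrix.mul_nonsing_inv _ (isUnit_iff_ne_zero.2 (hg.nondegenerate x hx))

theorem IsMetricOn.inv_mul (hg : IsMetricOn g U) (hx : x ∈ U) : (g x)⁻¹ * g x = 1 :=
  Matrix.nonsing_inv_mul _ (isUnit_iff_ne_zero.2 (hg.nondegenerate x hx))

theorem IsMetricOn.symm_apply (hg : IsMetricOn g U) (hx : x ∈ U) (i j : Fin n) :
    g x i j = g x j i := (hg.symm x hx).apply j i

theorem IsMetricOn.inv_symm_apply (hg : IsMetricOn g U) (hx : x ∈ U) (i j : Fin n) :
    (g x)⁻¹ i j = (g x)⁻¹ j i := by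
  have h : ((g x)⁻¹).transpose = (g x)⁻¹ := by
    rw [Matrix.transpose_nonsing_inv, hg.symm x hx]
  exact (congrFun (congrFun h i) j).symm

theorem IsMetricOn.sum_mul_inv (hg : IsMetricOn g U) (hx : x ∈ U) (i j : Fin n) :
    ∑ k, g x i k * (g x)⁻¹ k j = if i = j then 1 else 0 := by
  rw [← Matrix.mul_apply, hg.mul_inv hx, Matrix.one_apply]

theorem IsMetricOn.sum_inv_mul (hg : IsMetricOn g U) (hx : x ∈ U) (i j : Fin n) :
    ∑ k, (g x)⁻¹ i k * g x k j = if i = j then 1 else 0 := by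
  rw [← Matrix.mul_apply, hg.inv_mul hx, Matrix.one_apply]

theorem IsMetricOn.pd_symm (hg : IsMetricOn g U) (hU : IsOpen U) (hx : x ∈ U) (i j m : Fin n) :
    pd m (fun y => g y i j) x = pd m (fun y => g y j i) x :=
  pd_congr_on hU (fun _ hy => hg.symm_apply hy i j) hx m

/-- The components `(L_Y g)^{kl}` of the Lie derivative of the inverse metric. -/
noncomputable def lieInverse (g : (Fin n → ℝ) → Matrix (Fin n) (Fin n) ℝ)
    (Y : (Fin n → ℝ) → Fin n → ℝ) (k l : Fin n) (x : Fin n → ℝ) : ℝ :=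
  ∑ m, (Y x m * pd m (fun y => (g y)⁻¹ k l) x - (g x)⁻¹ m l * pd m (fun y => Y y k) x
    - (g x)⁻¹ k m * pd m (fun y => Y y l) x)

/-- Differentiate `g g⁻¹ = 1` and multiply by `g⁻¹` on the left. -/
theorem IsMetricOn.pd_inv (hg : IsMetricOn g U) (hU : IsOpen U) (hx : x ∈ U) (m : Fin n) :
    (Matrix.of fun k l => pd m (fun y => (g y)⁻¹ k l) x)
      = -((g x)⁻¹ * (Matrix.of fun i j => pd m (fun y => g y i j) x) * (g x)⁻¹) := by
  have h : (Matrix.of fun i j => pd m (fun y => g y i j) x) * (g x)⁻¹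
      + g x * (Matrix.of fun k l => pd m (fun y => (g y)⁻¹ k l) x) = 0 := by
    ext i j
    have h1 : pd m (fun y => ∑ k, g y i k * (g y)⁻¹ k j) x = 0 := by
      rw [pd_congr_on hU (fun y hy => hg.sum_mul_inv hy i j) hx, pd_const]
    rw [pd_sum (fun k _ => ((hg.smooth i k).diffAt hU hx).fun_mul
      ((hg.smooth_inv k j).diffAt hU hx))] at h1
    rw [Matrix.add_apply, Matrix.mul_apply, Matrix.mul_apply, Matrix.zero_apply,
      ← Finset.sum_add_distrib, ← h1]
    refine Finset.sum_congr rfl fun k _ => ?_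
    rw [pd_mul ((hg.smooth i k).diffAt hU hx) ((hg.smooth_inv k j).diffAt hU hx)]
    rfl
  have h2 := congrArg (fun M => (g x)⁻¹ * M) h
  simp only [mul_add, mul_zero, ← mul_assoc, hg.inv_mul hx, one_mul] at h2
  exact (neg_eq_of_add_eq_zero_right h2).symm

/-- With `W` the matrix of derivatives of `Y`, the two Lie derivatives are `Y^m g_{,m} + W g + g Wᵀ`
and `Y^m (g⁻¹)_{,m} - Wᵀ g⁻¹ - g⁻¹ W`. Conjugating the first by `g⁻¹` and using the derivative of
the inverse gives minus the second. -/
theorem IsMetricOn.lieInverse_eq (hg : IsMetricOn g U) (hU : IsOpen U) (hx : x ∈ U)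
    (Y : (Fin n → ℝ) → Fin n → ℝ) :
    (Matrix.of fun k l => lieInverse g Y k l x)
      = -((g x)⁻¹ * (Matrix.of fun i j => lieMetric g Y i j x) * (g x)⁻¹) := by
  set A := (g x)⁻¹ with hA
  set W : Matrix (Fin n) (Fin n) ℝ := Matrix.of fun i m => pd i (fun y => Y y m) x with hW
  have e1 : (Matrix.of fun i j => lieMetric g Y i j x)
      = ∑ m, Y x m • (Matrix.of fun i j => pd m (fun y => g y i j) x) + W * g x
        + g x * W.transpose := by
    ext i j
    simp only [Matrix.of_apply, lieMetric, Matrix.add_apply, Matrix.sum_apply, Matrix.mul_apply,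
      Matrix.smul_apply, Matrix.transpose_apply, hW, smul_eq_mul, Finset.sum_add_distrib, mul_comm]
  have e2 : (Matrix.of fun k l => lieInverse g Y k l x)
      = ∑ m, Y x m • (Matrix.of fun k l => pd m (fun y => (g y)⁻¹ k l) x) - W.transpose * A
        - A * W := by
    ext i j
    simp only [Matrix.of_apply, lieInverse, Matrix.sub_apply, Matrix.sum_apply, Matrix.mul_apply,
      Matrix.smul_apply, Matrix.transpose_apply, hW, smul_eq_mul, Finset.sum_sub_distrib, mul_comm]
    simp only [hA]
  rw [e1, e2]
  simp only [hg.pd_inv hU hx, ← hA]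
  have h1 : A * g x = 1 := hg.inv_mul hx
  have h2 : g x * A = 1 := hg.mul_inv hx
  simp only [mul_add, add_mul, Finset.mul_sum, Finset.sum_mul, neg_add, smul_neg,
    Finset.sum_neg_distrib, Matrix.mul_smul, Matrix.smul_mul]
  rw [← mul_assoc A (g x), h1, one_mul, mul_assoc A (W * g x), mul_assoc W, h2, mul_one]
  abel

/-- The determining equations appear with raised indices, whereas homothety is defined with lowered
ones; this translates between them. -/
theorem IsMetricOn.lieMetric_eq_iff (hg : IsMetricOn g U) (hU : IsOpen U) (hx : x ∈ U)
    (Y : (Fin n → ℝ) → Fin n → ℝ) (c : ℝ) :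
    (∀ i j, lieMetric g Y i j x = c * g x i j)
      ↔ ∀ k l, lieInverse g Y k l x = -c * (g x)⁻¹ k l := by
  have h := hg.lieInverse_eq hU hx Y
  have h1 := hg.inv_mul hx
  have h2 := hg.mul_inv hx
  constructor
  · intro hL k l
    have e : (Matrix.of fun i j => lieMetric g Y i j x) = c • g x := by
      ext i j; simp [hL]
    rw [e, Matrix.mul_smul, h1, Matrix.smul_mul, one_mul] at h
    simpa using congrFun (congrFun h k) l
  · intro hL i j
    have e : (Matrix.of fun i j => lieInverse g Y i j x) = -c • (g x)⁻¹ := by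
      ext i j; simp [hL]
    rw [e] at h
    have h3 := congrArg (fun M => g x * M * g x) h
    simp only [mul_neg, neg_mul, Matrix.mul_smul, Matrix.smul_mul, h2, one_mul, neg_smul,
      neg_inj] at h3
    rw [mul_assoc, mul_assoc, mul_assoc, h1, mul_one, ← mul_assoc, h2, one_mul] at h3
    simpa using (congrFun (congrFun h3 i) j).symm

/-! ### Christoffel symbols -/

/-- The bracket `g_{lj,i} + g_{li,j} - g_{ij,l} = 2 Γ_{l,ij}`. -/
noncomputable def bracket (g : (Fin n → ℝ) → Matrix (Fin n) (Fin n) ℝ)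
    (l i j : Fin n) (x : Fin n → ℝ) : ℝ :=
  pd i (fun y => g y l j) x + pd j (fun y => g y l i) x - pd l (fun y => g y i j) x

/-- Taking `g^{kl}` outside leaves the covector `g^{ij} Γ_{l,ij}`, up to the factor `1/2`; its Lie
derivative can be found before the index is raised. -/
theorem contractedGamma_eq (k : Fin n) (x : Fin n → ℝ) :
    contractedGamma g k x
      = ∑ l, (1 / 2) * ((g x)⁻¹ k l * ∑ i, ∑ j, (g x)⁻¹ i j * bracket g l i j x) := by
  unfold contractedGamma christoffel
  simp only [Finset.mul_sum]
  conv_rhs =>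
    rw [Finset.sum_comm]
    enter [2, i]
    rw [Finset.sum_comm]
  refine Finset.sum_congr rfl fun i _ => Finset.sum_congr rfl fun j _ =>
    Finset.sum_congr rfl fun l _ => ?_
  unfold bracket
  ring

theorem IsMetricOn.smooth_bracket (hg : IsMetricOn g U) (hU : IsOpen U) (l i j : Fin n) :
    ContDiffOn ℝ ∞ (bracket g l i j) U :=
  ((contDiffOn_pd (hg.smooth l j) hU i).add (contDiffOn_pd (hg.smooth l i) hU j)).sub
    (contDiffOn_pd (hg.smooth i j) hU l)

theorem IsMetricOn.smooth_lower (hg : IsMetricOn g U) (hU : IsOpen U) (l : Fin n) :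
    ContDiffOn ℝ ∞ (fun x => ∑ i, ∑ j, (g x)⁻¹ i j * bracket g l i j x) U :=
  ContDiffOn.sum fun i _ => ContDiffOn.sum fun j _ =>
    (hg.smooth_inv i j).mul (hg.smooth_bracket hU l i j)

theorem IsMetricOn.smooth_contractedGamma (hg : IsMetricOn g U) (hU : IsOpen U) (k : Fin n) :
    ContDiffOn ℝ ∞ (contractedGamma g k) U := by
  have : contractedGamma g k = fun x => ∑ l, (1 / 2) * ((g x)⁻¹ k l *
      ∑ i, ∑ j, (g x)⁻¹ i j * bracket g l i j x) := by
    funext x; exact contractedGamma_eq k x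
  rw [this]
  exact ContDiffOn.sum fun l _ => contDiffOn_const.mul
    ((hg.smooth_inv k l).mul (hg.smooth_lower hU l))

theorem sum_swap₁₃ {α : Type*} [Fintype α] (f : α → α → α → ℝ) :
    ∑ i, ∑ j, ∑ m, f i j m = ∑ i, ∑ j, ∑ m, f m j i := by
  rw [Finset.sum_comm]
  conv_rhs => rw [Finset.sum_comm]
  exact Finset.sum_congr rfl fun j _ => Finset.sum_comm

theorem sum_swap₂₃ {α : Type*} [Fintype α] (f : α → α → α → ℝ) :
    ∑ i, ∑ j, ∑ m, f i j m = ∑ i, ∑ j, ∑ m, f i m j :=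
  Finset.sum_congr rfl fun _ _ => Finset.sum_comm

/-- Used to discard pairs of terms that agree only after summation, by renaming summed indices. -/
theorem sum_add_cancel {α : Type*} [Fintype α] (P a b c d : α → α → α → ℝ)
    (h₁ : ∑ i, ∑ j, ∑ m, a i j m = ∑ i, ∑ j, ∑ m, b i j m)
    (h₂ : ∑ i, ∑ j, ∑ m, c i j m = ∑ i, ∑ j, ∑ m, d i j m) :
    ∑ i, ∑ j, (∑ m, P i j m + (∑ m, a i j m - ∑ m, b i j m) + (∑ m, c i j m - ∑ m, d i j m))
      = ∑ m, ∑ i, ∑ j, P i j m := by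
  simp only [Finset.sum_add_distrib, Finset.sum_sub_distrib, h₁, h₂, sub_self, add_zero]
  conv_lhs =>
    enter [2, i]
    rw [Finset.sum_comm]
  exact Finset.sum_comm

end Metric

/-! ### Homothetic fields preserve the contracted Christoffel symbols -/

section Homothetic

variable {n : ℕ} {g : (Fin n → ℝ) → Matrix (Fin n) (Fin n) ℝ} {U : Set (Fin n → ℝ)}
  {x : Fin n → ℝ} {Y : (Fin n → ℝ) → Fin n → ℝ} {ψ : ℝ}

theorem IsHomothetic.smooth (hY : IsHomothetic g U Y ψ) (k : Fin n) :
    ContDiffOn ℝ ∞ (fun x => Y x k) U := contDiffOn_pi.1 hY.1 k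

/-- The homothetic equation differentiated along `x^a` and expanded by the product rule. -/
theorem IsHomothetic.pd_lieMetric (hg : IsMetricOn g U) (hU : IsOpen U)
    (hY : IsHomothetic g U Y ψ) (hx : x ∈ U) (a i j : Fin n) :
    ∑ m, (pd a (fun y => Y y m) x * pd m (fun y => g y i j) x
        + Y x m * pd m (pd a (fun y => g y i j)) x
        + pd a (fun y => g y m j) x * pd i (fun y => Y y m) x
        + g x m j * pd a (pd i (fun y => Y y m)) x
        + pd a (fun y => g y i m) x * pd j (fun y => Y y m) x
        + g x i m * pd a (pd j (fun y => Y y m)) x)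
      = 2 * ψ * pd a (fun y => g y i j) x := by
  have hgd := fun i j => (hg.smooth i j).diffAt hU hx
  have hgd' := fun i j k => (contDiffOn_pd (hg.smooth i j) hU k).diffAt hU hx
  have hYd := fun m => (hY.smooth m).diffAt hU hx
  have hYd' := fun m k => (contDiffOn_pd (hY.smooth m) hU k).diffAt hU hx
  have h := pd_congr_on hU (fun y hy => hY.2 y hy i j) hx a
  rw [pd_const_mul (hgd i j)] at h
  rw [← h]
  unfold lieMetric
  rw [pd_sum (fun k _ => (((hYd k).fun_mul (hgd' i j k)).fun_add
    ((hgd k j).fun_mul (hYd' k i))).fun_add ((hgd i k).fun_mul (hYd' k j)))]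
  refine Finset.sum_congr rfl fun m _ => ?_
  rw [pd_add (((hYd m).fun_mul (hgd' i j m)).fun_add ((hgd m j).fun_mul (hYd' m i)))
      ((hgd i m).fun_mul (hYd' m j)),
    pd_add ((hYd m).fun_mul (hgd' i j m)) ((hgd m j).fun_mul (hYd' m i)),
    pd_mul (hYd m) (hgd' i j m), pd_mul (hgd m j) (hYd' m i), pd_mul (hgd i m) (hYd' m j),
    pd_comm (hg.smooth i j) hU hx a m]
  ring

/-- The differentiated homothetic equation is combined over three index placements, just as metric
derivatives are combined in a Christoffel symbol. The last term on the left, with second derivatives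
of `Y`, reflects that Christoffel symbols are not tensors. -/
theorem IsHomothetic.lie_bracket (hg : IsMetricOn g U) (hU : IsOpen U)
    (hY : IsHomothetic g U Y ψ) (hx : x ∈ U) (l i j : Fin n) :
    ∑ m, (Y x m * pd m (bracket g l i j) x + pd l (fun y => Y y m) x * bracket g m i j x
        + pd i (fun y => Y y m) x * bracket g l m j x
        + pd j (fun y => Y y m) x * bracket g l i m x
        + 2 * (g x l m * pd i (pd j (fun y => Y y m)) x))
      = 2 * ψ * bracket g l i j x := by
  have h1 := hY.pd_lieMetric hg hU hx i l j
  have h2 := hY.pd_lieMetric hg hU hx j l i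
  have h3 := hY.pd_lieMetric hg hU hx l i j
  have e : 2 * ψ * bracket g l i j x = 2 * ψ * pd i (fun y => g y l j) x
      + 2 * ψ * pd j (fun y => g y l i) x - 2 * ψ * pd l (fun y => g y i j) x := by
    unfold bracket; ring
  rw [e, ← h1, ← h2, ← h3, ← Finset.sum_add_distrib, ← Finset.sum_sub_distrib]
  refine Finset.sum_congr rfl fun m _ => ?_
  have hgd' := fun i j k => (contDiffOn_pd (hg.smooth i j) hU k).diffAt hU hx
  have eb : pd m (bracket g l i j) x = pd m (pd i (fun y => g y l j)) x
      + pd m (pd j (fun y => g y l i)) x - pd m (pd l (fun y => g y i j)) x := by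
    unfold bracket
    rw [pd_sub ((hgd' l j i).fun_add (hgd' l i j)) (hgd' i j l), pd_add (hgd' l j i) (hgd' l i j)]
  rw [eb, pd_comm (hY.smooth m) hU hx j i, pd_comm (hY.smooth m) hU hx l i,
    pd_comm (hY.smooth m) hU hx l j, hg.symm_apply hx i m, hg.pd_symm hU hx i m]
  unfold bracket
  rw [hg.pd_symm hU hx i m]
  ring

/-- Contracting with `g^{ij}` makes the weights cancel: the bracket scales by `2ψ` and the inverse
metric by `-2ψ`, so only the inhomogeneous term accompanies the Lie derivative. -/
theorem IsHomothetic.lie_lower (hg : IsMetricOn g U) (hU : IsOpen U)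
    (hY : IsHomothetic g U Y ψ) (hx : x ∈ U) (l : Fin n) :
    ∑ m, (Y x m * pd m (fun x => ∑ i, ∑ j, (g x)⁻¹ i j * bracket g l i j x) x
        + pd l (fun y => Y y m) x * ∑ i, ∑ j, (g x)⁻¹ i j * bracket g m i j x
        + 2 * (g x l m * ∑ i, ∑ j, (g x)⁻¹ i j * pd i (pd j (fun y => Y y m)) x)) = 0 := by
  have hA := fun i j => (hg.smooth_inv i j).diffAt hU hx
  have hb := fun i j => (hg.smooth_bracket hU l i j).diffAt hU hx
  have hpd : ∀ m, pd m (fun x => ∑ i, ∑ j, (g x)⁻¹ i j * bracket g l i j x) x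
      = ∑ i, ∑ j, (pd m (fun x => (g x)⁻¹ i j) x * bracket g l i j x
        + (g x)⁻¹ i j * pd m (bracket g l i j) x) := by
    intro m
    rw [pd_sum (fun i _ => DifferentiableAt.fun_sum fun j _ => (hA i j).fun_mul (hb i j))]
    refine Finset.sum_congr rfl fun i _ => ?_
    rw [pd_sum (fun j _ => (hA i j).fun_mul (hb i j))]
    exact Finset.sum_congr rfl fun j _ => pd_mul (hA i j) (hb i j) m
  -- Product rule for the Lie derivative of `g^{ij}` times the bracket: both factors of the summand
  -- are known from earlier identities, and the `2ψ` corrections cancel.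
  have h1 : ∑ i, ∑ j, ((g x)⁻¹ i j * (∑ m, (Y x m * pd m (bracket g l i j) x
        + pd l (fun y => Y y m) x * bracket g m i j x
        + pd i (fun y => Y y m) x * bracket g l m j x
        + pd j (fun y => Y y m) x * bracket g l i m x
        + 2 * (g x l m * pd i (pd j (fun y => Y y m)) x)) - 2 * ψ * bracket g l i j x)
        + bracket g l i j x * (lieInverse g Y i j x + 2 * ψ * (g x)⁻¹ i j)) = 0 := by
    refine Finset.sum_eq_zero fun i _ => Finset.sum_eq_zero fun j _ => ?_
    rw [hY.lie_bracket hg hU hx, ((hg.lieMetric_eq_iff hU hx Y (2 * ψ)).1 (hY.2 x hx)) i j]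
    ring
  have s1 := sum_swap₁₃ fun i j m => bracket g l i j x * (g x)⁻¹ m j * pd m (fun y => Y y i) x
  have s2 := sum_swap₂₃ fun i j m => bracket g l i j x * (g x)⁻¹ i m * pd m (fun y => Y y j) x
  have e : ∀ i j, (g x)⁻¹ i j * (∑ m, (Y x m * pd m (bracket g l i j) x
        + pd l (fun y => Y y m) x * bracket g m i j x
        + pd i (fun y => Y y m) x * bracket g l m j x
        + pd j (fun y => Y y m) x * bracket g l i m x
        + 2 * (g x l m * pd i (pd j (fun y => Y y m)) x)) - 2 * ψ * bracket g l i j x)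
        + bracket g l i j x * (lieInverse g Y i j x + 2 * ψ * (g x)⁻¹ i j)
      = ∑ m, (Y x m * (pd m (fun x => (g x)⁻¹ i j) x * bracket g l i j x
          + (g x)⁻¹ i j * pd m (bracket g l i j) x)
        + pd l (fun y => Y y m) x * ((g x)⁻¹ i j * bracket g m i j x)
        + 2 * (g x l m * ((g x)⁻¹ i j * pd i (pd j (fun y => Y y m)) x)))
        + (∑ m, bracket g l m j x * (g x)⁻¹ i j * pd i (fun y => Y y m) x
          - ∑ m, bracket g l i j x * (g x)⁻¹ m j * pd m (fun y => Y y i) x)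
        + (∑ m, bracket g l i m x * (g x)⁻¹ i j * pd j (fun y => Y y m) x
          - ∑ m, bracket g l i j x * (g x)⁻¹ i m * pd m (fun y => Y y j) x) := by
    intro i j
    unfold lieInverse
    rw [mul_sub, mul_add, Finset.mul_sum, Finset.mul_sum, ← Finset.sum_sub_distrib,
      ← Finset.sum_sub_distrib, ← Finset.sum_add_distrib, ← Finset.sum_add_distrib]
    rw [show ∀ a b c d : ℝ, a - c + (b + d) = a + b + (d - c) by intros; ring,
      ← Finset.sum_add_distrib,
      show bracket g l i j x * (2 * ψ * (g x)⁻¹ i j) - (g x)⁻¹ i j * (2 * ψ * bracket g l i j x)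
        = 0 by ring, add_zero]
    exact Finset.sum_congr rfl fun m _ => by ring
  rw [Finset.sum_congr rfl fun i _ => Finset.sum_congr rfl fun j _ => e i j,
    sum_add_cancel _ _ _ _ _ s1.symm s2.symm] at h1
  rw [← h1]
  refine Finset.sum_congr rfl fun m _ => ?_
  simp only [hpd, Finset.mul_sum, ← Finset.sum_add_distrib]

/-- Raising the index in `lie_lower` costs one Lie derivative of `g^{kl}`, which accounts for the
weight `2ψ`. This expression is the coefficient by which the geometry enters the terms linear in
`u_k` of the prolongation. -/
theorem IsHomothetic.lie_contractedGamma (hg : IsMetricOn g U) (hU : IsOpen U)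
    (hY : IsHomothetic g U Y ψ) (hx : x ∈ U) (k : Fin n) :
    ∑ m, Y x m * pd m (contractedGamma g k) x - ∑ m, contractedGamma g m x * pd m (fun y => Y y k) x
      + ∑ i, ∑ j, (g x)⁻¹ i j * pd i (pd j (fun y => Y y k)) x
      + 2 * ψ * contractedGamma g k x = 0 := by
  set L : Fin n → (Fin n → ℝ) → ℝ := fun l x => ∑ i, ∑ j, (g x)⁻¹ i j * bracket g l i j x with hL
  set D : Fin n → ℝ := fun m => ∑ i, ∑ j, (g x)⁻¹ i j * pd i (pd j (fun y => Y y m)) x with hD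
  have hA := fun i j => (hg.smooth_inv i j).diffAt hU hx
  have hLd : ∀ l, DifferentiableAt ℝ (L l) x := fun l => (hg.smooth_lower hU l).diffAt hU hx
  have hΓ : ∀ k x, contractedGamma g k x = ∑ l, (1 / 2) * ((g x)⁻¹ k l * L l x) :=
    contractedGamma_eq
  have hΓd : ∀ m, pd m (contractedGamma g k) x = ∑ l, (1 / 2) *
      (pd m (fun x => (g x)⁻¹ k l) x * L l x + (g x)⁻¹ k l * pd m (L l) x) := by
    intro m
    rw [show contractedGamma g k = fun x => ∑ l, (1 / 2) * ((g x)⁻¹ k l * L l x) from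
      funext (hΓ k), pd_sum (fun l _ => ((hA k l).fun_mul (hLd l)).const_mul _)]
    refine Finset.sum_congr rfl fun l _ => ?_
    rw [pd_const_mul ((hA k l).fun_mul (hLd l)), pd_mul (hA k l) (hLd l)]
  have h1 : ∀ l, ∑ m, (Y x m * pd m (L l) x + pd l (fun y => Y y m) x * L m x
      + 2 * (g x l m * D m)) = 0 := hY.lie_lower hg hU hx
  have h2 : ∀ l, lieInverse g Y k l x + 2 * ψ * (g x)⁻¹ k l = 0 := fun l => by
    rw [((hg.lieMetric_eq_iff hU hx Y (2 * ψ)).1 (hY.2 x hx)) k l]; ring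
  have h3 : ∑ l, (1 / 2) * ((g x)⁻¹ k l * ∑ m, (Y x m * pd m (L l) x
      + pd l (fun y => Y y m) x * L m x + 2 * (g x l m * D m))
      + L l x * (lieInverse g Y k l x + 2 * ψ * (g x)⁻¹ k l)) = 0 :=
    Finset.sum_eq_zero fun l _ => by rw [h1, h2]; ring
  have hDk : ∑ l, ∑ m, (g x)⁻¹ k l * (g x l m * D m) = D k := by
    rw [Finset.sum_comm]
    simp only [← mul_assoc, ← Finset.sum_mul, hg.sum_inv_mul hx]
    simp
  have s1 : ∑ m, Y x m * pd m (contractedGamma g k) x = ∑ l, ∑ m, (1 / 2) * (Y x m *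
      (pd m (fun x => (g x)⁻¹ k l) x * L l x + (g x)⁻¹ k l * pd m (L l) x)) := by
    rw [Finset.sum_comm]
    refine Finset.sum_congr rfl fun m _ => ?_
    rw [hΓd, Finset.mul_sum]
    exact Finset.sum_congr rfl fun l _ => by ring
  have s2 : ∑ m, contractedGamma g m x * pd m (fun y => Y y k) x
      = ∑ l, ∑ m, (1 / 2) * ((g x)⁻¹ m l * L l x * pd m (fun y => Y y k) x) := by
    rw [Finset.sum_comm]
    refine Finset.sum_congr rfl fun m _ => ?_
    rw [hΓ, Finset.sum_mul]
    exact Finset.sum_congr rfl fun l _ => by ring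
  have s3 : ∑ l, ∑ m, (1 / 2) * ((g x)⁻¹ k l * (pd l (fun y => Y y m) x * L m x))
      = ∑ l, ∑ m, (1 / 2) * ((g x)⁻¹ k m * (pd m (fun y => Y y l) x * L l x)) :=
    Finset.sum_comm
  have s4 : 2 * ψ * contractedGamma g k x
      = ∑ l, (1 / 2) * (L l x * (2 * ψ * (g x)⁻¹ k l)) := by
    rw [hΓ, Finset.mul_sum]
    exact Finset.sum_congr rfl fun l _ => by ring
  change _ - _ + D k + _ = 0
  -- The zero on the right is replaced by `h3`. On the left a double sum is added and subtracted,
  -- one copy with its indices exchanged, so that the two sides agree summand by summand in `l`.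
  rw [s1, s2, s4, ← hDk, ← h3, ← add_zero (Finset.sum Finset.univ _ - _ + _ + _),
    ← sub_self (∑ l, ∑ m, (1 / 2) * ((g x)⁻¹ k l * (pd l (fun y => Y y m) x * L m x)))]
  nth_rewrite 2 [s3]
  simp only [← Finset.sum_add_distrib, ← Finset.sum_sub_distrib]
  refine Finset.sum_congr rfl fun l _ => ?_
  unfold lieInverse
  rw [mul_add (L l x), Finset.mul_sum, Finset.mul_sum, ← add_assoc, ← Finset.sum_add_distrib,
    mul_add, Finset.mul_sum]
  rw [add_right_comm, ← Finset.sum_add_distrib]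
  congr 1
  exact Finset.sum_congr rfl fun m _ => by ring

end Homothetic

end HeatFlux

namespace HeatFlux

open Filter Topology

/-! ### The algebra of homothetic fields -/

section HomotheticAlgebra

variable {n : ℕ} {g : (Fin n → ℝ) → Matrix (Fin n) (Fin n) ℝ} {U : Set (Fin n → ℝ)}
  {x : Fin n → ℝ} {Y Z : (Fin n → ℝ) → Fin n → ℝ} {ψ φ : ℝ}

theorem lieMetric_congr (hU : IsOpen U) (h : ∀ y ∈ U, ∀ i, Y y i = Z y i) (hx : x ∈ U)
    (i j : Fin n) : lieMetric g Y i j x = lieMetric g Z i j x := by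
  unfold lieMetric
  refine Finset.sum_congr rfl fun k _ => ?_
  rw [h x hx k, pd_congr_on hU (fun y hy => h y hy k) hx, pd_congr_on hU (fun y hy => h y hy k) hx]

theorem IsHomothetic.congr (hU : IsOpen U) (hY : IsHomothetic g U Y ψ)
    (h : ∀ y ∈ U, ∀ i, Z y i = Y y i) : IsHomothetic g U Z ψ :=
  ⟨hY.1.congr fun y hy => funext (h y hy), fun x hx i j => by
    rw [lieMetric_congr hU h hx, hY.2 x hx]⟩

theorem IsHomothetic.add (hU : IsOpen U) (hY : IsHomothetic g U Y ψ)
    (hZ : IsHomothetic g U Z φ) : IsHomothetic g U (fun x i => Y x i + Z x i) (ψ + φ) := by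
  refine ⟨contDiffOn_pi.2 fun k => (hY.smooth k).add (hZ.smooth k), fun x hx i j => ?_⟩
  rw [mul_add, add_mul, ← hY.2 x hx, ← hZ.2 x hx]
  unfold lieMetric
  rw [← Finset.sum_add_distrib]
  refine Finset.sum_congr rfl fun k _ => ?_
  rw [pd_add ((hY.smooth k).diffAt hU hx) ((hZ.smooth k).diffAt hU hx),
    pd_add ((hY.smooth k).diffAt hU hx) ((hZ.smooth k).diffAt hU hx)]
  ring

theorem IsHomothetic.const_mul (hU : IsOpen U) (hY : IsHomothetic g U Y ψ) (c : ℝ) :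
    IsHomothetic g U (fun x i => c * Y x i) (c * ψ) := by
  refine ⟨contDiffOn_pi.2 fun k => contDiffOn_const.mul (hY.smooth k), fun x hx i j => ?_⟩
  rw [show 2 * (c * ψ) * g x i j = c * (2 * ψ * g x i j) by ring, ← hY.2 x hx]
  unfold lieMetric
  rw [Finset.mul_sum]
  refine Finset.sum_congr rfl fun k _ => ?_
  rw [pd_const_mul ((hY.smooth k).diffAt hU hx), pd_const_mul ((hY.smooth k).diffAt hU hx)]
  ring

theorem isHomothetic_zero : IsHomothetic g U (fun _ _ => 0) 0 := by
  refine ⟨contDiffOn_pi.2 fun k => contDiffOn_const, fun x _ i j => ?_⟩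
  simp [lieMetric, pd_const]

theorem IsHomothetic.sum (hU : IsOpen U) {N : ℕ} {Z : Fin N → (Fin n → ℝ) → Fin n → ℝ}
    {φ : Fin N → ℝ} (hZ : ∀ A, IsHomothetic g U (Z A) (φ A)) (s : Finset (Fin N)) :
    IsHomothetic g U (fun x i => ∑ A ∈ s, Z A x i) (∑ A ∈ s, φ A) := by
  induction s using Finset.induction_on with
  | empty => simpa using isHomothetic_zero
  | insert a s ha ih =>
    simp only [Finset.sum_insert ha]
    exact (hZ a).add hU ih

theorem IsMetricOn.exists_ne_zero (hg : IsMetricOn g U) (hn : 0 < n) (hx : x ∈ U) :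
    ∃ i j, g x i j ≠ 0 := by
  by_contra! h
  have := hg.sum_mul_inv hx ⟨0, hn⟩ ⟨0, hn⟩
  simp [h] at this

theorem IsMetricOn.exists_inv_ne_zero (hg : IsMetricOn g U) (hn : 0 < n) (hx : x ∈ U) :
    ∃ i j, (g x)⁻¹ i j ≠ 0 := by
  by_contra! h
  have := hg.sum_mul_inv hx ⟨0, hn⟩ ⟨0, hn⟩
  simp [h] at this

/-- The factor is read off from a nonzero entry of `g`, which exists because `n > 0`; in dimension
zero any factor would do. -/
theorem IsHomothetic.factor_unique (hg : IsMetricOn g U) (hn : 0 < n) (hx : x ∈ U)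
    (h₁ : IsHomothetic g U Y ψ) (h₂ : IsHomothetic g U Y φ) : ψ = φ := by
  obtain ⟨i, j, hij⟩ := hg.exists_ne_zero hn hx
  have h := (h₁.2 x hx i j).symm.trans (h₂.2 x hx i j)
  have := mul_right_cancel₀ hij h
  linarith

/-! ### Gradient fields -/

variable {S : (Fin n → ℝ) → ℝ}

theorem grad_congr {S' : (Fin n → ℝ) → ℝ} (hU : IsOpen U) (h : ∀ y ∈ U, S y = S' y) (hx : x ∈ U)
    (i : Fin n) : grad g S x i = grad g S' x i := by
  unfold grad
  exact Finset.sum_congr rfl fun j _ => by rw [pd_congr_on hU h hx]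

theorem grad_const_mul (hS : DifferentiableAt ℝ S x) (c : ℝ) (i : Fin n) :
    grad g (fun y => c * S y) x i = c * grad g S x i := by
  unfold grad
  rw [Finset.mul_sum]
  exact Finset.sum_congr rfl fun j _ => by rw [pd_const_mul hS]; ring

theorem grad_sub {S' : (Fin n → ℝ) → ℝ} (hS : DifferentiableAt ℝ S x)
    (hS' : DifferentiableAt ℝ S' x) (i : Fin n) :
    grad g (fun y => S y - S' y) x i = grad g S x i - grad g S' x i := by
  unfold grad
  rw [← Finset.sum_sub_distrib]
  exact Finset.sum_congr rfl fun j _ => by rw [pd_sub hS hS']; ring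

theorem grad_sum {N : ℕ} {S : Fin N → (Fin n → ℝ) → ℝ} (hS : ∀ A, DifferentiableAt ℝ (S A) x)
    (i : Fin n) : grad g (fun y => ∑ A, S A y) x i = ∑ A, grad g (S A) x i := by
  unfold grad
  rw [Finset.sum_comm]
  refine Finset.sum_congr rfl fun j _ => ?_
  rw [pd_sum fun A _ => hS A, Finset.mul_sum]

theorem IsMetricOn.sum_mul_grad (hg : IsMetricOn g U) (hx : x ∈ U) (j : Fin n) :
    ∑ k, g x j k * grad g S x k = pd j S x := by
  unfold grad
  simp only [Finset.mul_sum]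
  rw [Finset.sum_comm]
  simp only [← mul_assoc, ← Finset.sum_mul, hg.sum_mul_inv hx]
  simp

theorem IsMetricOn.smooth_grad (hg : IsMetricOn g U) (hU : IsOpen U) (hS : ContDiffOn ℝ ∞ S U)
    (k : Fin n) : ContDiffOn ℝ ∞ (fun x => grad g S x k) U :=
  ContDiffOn.sum fun j _ => (hg.smooth_inv k j).mul (contDiffOn_pd hS hU j)

/-- Since `bracket` is twice the Christoffel symbol of the first kind, the right-hand side is twice
the covariant Hessian. Hence `S^{,i}` is homothetic with factor `ψ` exactly when `S_{;ij} = ψ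
g_{ij}`. -/
theorem IsMetricOn.lieMetric_grad (hg : IsMetricOn g U) (hU : IsOpen U)
    (hS : ContDiffOn ℝ ∞ S U) (hx : x ∈ U) (i j : Fin n) :
    lieMetric g (grad g S) i j x
      = 2 * pd i (pd j S) x - ∑ k, grad g S x k * bracket g k i j x := by
  have hgd := fun i j => (hg.smooth i j).diffAt hU hx
  have hGd := fun k => (hg.smooth_grad hU hS k).diffAt hU hx
  have key : ∀ i j, pd i (pd j S) x = ∑ k, (pd i (fun y => g y j k) x * grad g S x k
      + g x j k * pd i (fun y => grad g S y k) x) := by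
    intro i j
    rw [← pd_congr_on hU (fun y hy => hg.sum_mul_grad (S := S) hy j) hx,
      pd_sum fun k _ => (hgd j k).fun_mul (hGd k)]
    exact Finset.sum_congr rfl fun k _ => pd_mul (hgd j k) (hGd k) i
  have e : 2 * pd i (pd j S) x = pd i (pd j S) x + pd j (pd i S) x := by
    rw [pd_comm hS hU hx j i]; ring
  rw [e, key i j, key j i, ← Finset.sum_add_distrib, ← Finset.sum_sub_distrib]
  unfold lieMetric
  refine Finset.sum_congr rfl fun k _ => ?_
  unfold bracket
  rw [hg.symm_apply hx k j, hg.pd_symm hU hx k j, hg.pd_symm hU hx k i]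
  ring

/-- The Laplacian `g^{ij} S_{ij} - Γ^i S_i`. -/
noncomputable def laplacian (g : (Fin n → ℝ) → Matrix (Fin n) (Fin n) ℝ)
    (S : (Fin n → ℝ) → ℝ) (x : Fin n → ℝ) : ℝ :=
  ∑ i, ∑ j, (g x)⁻¹ i j * pd j (pd i S) x - ∑ i, contractedGamma g i x * pd i S x

/-- The trace of `S_{;ij} = ψ g_{ij}`. -/
theorem IsHomothetic.laplacian_eq (hg : IsMetricOn g U) (hU : IsOpen U)
    (hS : ContDiffOn ℝ ∞ S U) (hY : IsHomothetic g U (grad g S) ψ) (hx : x ∈ U) :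
    laplacian g S x = n * ψ := by
  have h : ∀ i j, pd j (pd i S) x = ψ * g x j i
      + (1 / 2) * ∑ k, grad g S x k * bracket g k i j x := by
    intro i j
    have h1 := hg.lieMetric_grad hU hS hx i j
    rw [hY.2 x hx, pd_comm hS hU hx i j] at h1
    rw [hg.symm_apply hx j i]
    linarith
  have h1 : ∑ i, ∑ j, (g x)⁻¹ i j * (ψ * g x j i) = n * ψ := by
    have : ∀ i j, (g x)⁻¹ i j * (ψ * g x j i) = ψ * ((g x)⁻¹ i j * g x j i) := fun i j => by ring
    simp only [this, ← Finset.mul_sum, hg.sum_inv_mul hx]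
    simp [mul_comm]
  have h2 : ∑ i, contractedGamma g i x * pd i S x
      = ∑ i, ∑ j, (g x)⁻¹ i j * ((1 / 2) * ∑ k, grad g S x k * bracket g k i j x) := by
    have e1 : ∑ i, ∑ j, (g x)⁻¹ i j * ((1 / 2) * ∑ k, grad g S x k * bracket g k i j x)
        = ∑ k, grad g S x k * ((1 / 2) * ∑ i, ∑ j, (g x)⁻¹ i j * bracket g k i j x) := by
      simp only [Finset.mul_sum]
      conv_rhs => rw [Finset.sum_comm]
      refine Finset.sum_congr rfl fun i _ => ?_
      conv_rhs => rw [Finset.sum_comm]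
      exact Finset.sum_congr rfl fun j _ => Finset.sum_congr rfl fun k _ => by ring
    rw [e1]
    simp only [contractedGamma_eq, grad, Finset.sum_mul]
    rw [Finset.sum_comm]
    refine Finset.sum_congr rfl fun l _ => Finset.sum_congr rfl fun i _ => ?_
    rw [hg.inv_symm_apply hx i l]
    ring
  unfold laplacian
  rw [h2]
  simp only [h, mul_add, Finset.sum_add_distrib]
  rw [h1]
  ring

/-! ### Unique continuation -/

theorem const_of_pd_eq_zero (hU : IsOpen U) (hU' : IsPreconnected U) {f : (Fin n → ℝ) → ℝ}
    (hf : ContDiffOn ℝ ∞ f U) (h : ∀ y ∈ U, ∀ i, pd i f y = 0) {y : Fin n → ℝ} (hx : x ∈ U)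
    (hy : y ∈ U) : f x = f y := by
  refine hU.is_const_of_fderiv_eq_zero (𝕜 := ℝ) hU' (hf.differentiableOn (by simp))
    (fun z hz => ?_) hx hy
  ext v
  rw [fderiv_eq_sum_pd]
  simp [h z hz]

theorem const_of_deriv_eq_zero {I : Set ℝ} (hI : IsOpen I) (hI' : IsPreconnected I) {f : ℝ → ℝ}
    (hf : ContDiffOn ℝ ∞ f I) (h : ∀ t ∈ I, deriv f t = 0) {s t : ℝ} (hs : s ∈ I)
    (ht : t ∈ I) : f s = f t := by
  obtain ⟨a, ha⟩ := hI.exists_is_const_of_deriv_eq_zero hI' (hf.differentiableOn (by simp)) h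
  rw [ha s hs, ha t ht]

/-- A function whose second derivatives are linear combinations of its first derivatives with
continuous coefficients is locally critical near a critical point. -/
theorem eventually_pd_eq_zero (hU : IsOpen U) (hS : ContDiffOn ℝ ∞ S U)
    {C : Fin n → Fin n → Fin n → (Fin n → ℝ) → ℝ} (hC : ∀ i j k, ContinuousOn (C i j k) U)
    (h : ∀ y ∈ U, ∀ i j, pd i (pd j S) y = ∑ k, C i j k y * pd k S y) (hx : x ∈ U)
    (h0 : ∀ i, pd i S x = 0) : ∀ᶠ y in 𝓝 x, ∀ i, pd i S y = 0 := by
  -- By continuity the sum of all coefficients in absolute value stays below `M x + 1` on a ball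
  -- around `x`.
  set M : (Fin n → ℝ) → ℝ := fun y => ∑ i, ∑ j, ∑ k, |C i j k y| with hM
  have hMc : ContinuousAt M x := by
    refine tendsto_finsetSum _ fun i _ => tendsto_finsetSum _ fun j _ =>
      tendsto_finsetSum _ fun k _ => ?_
    exact ((hC i j k).continuousAt (hU.mem_nhds hx)).abs
  have hMb : ∀ᶠ y in 𝓝 x, M y < M x + 1 := hMc.eventually_lt_const (by linarith)
  obtain ⟨r, hr, hball⟩ := Metric.eventually_nhds_iff_ball.1 (hMb.and (hU.eventually_mem hx))
  filter_upwards [Metric.ball_mem_nhds x hr] with y hy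
  -- `D` is the differential of `S` along the segment from `x` to `y`. It starts at zero and
  -- satisfies `‖D'‖ ≤ K ‖D‖`, so Grönwall's inequality gives `D = 0`.
  set D : ℝ → Fin n → ℝ := fun s j => pd j S (x + s • (y - x)) with hD
  have hseg : ∀ s ∈ Set.Icc (0 : ℝ) 1, x + s • (y - x) ∈ Metric.ball x r := by
    intro s hs
    have := (convex_ball x r).add_smul_sub_mem (Metric.mem_ball_self hr) hy hs
    exact this
  have hDd : ∀ s ∈ Set.Icc (0 : ℝ) 1, HasDerivAt D
      (fun j => ∑ i, (y - x) i * pd i (pd j S) (x + s • (y - x))) s := by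
    intro s hs
    rw [hasDerivAt_pi]
    intro j
    rw [← fderiv_eq_sum_pd]
    have h1 := ((contDiffOn_pd hS hU j).diffAt hU (hball _ (hseg s hs)).2).hasFDerivAt
    have h2 : HasDerivAt (fun s : ℝ => x + s • (y - x)) (y - x) s := by
      simpa using ((hasDerivAt_id s).smul_const (y - x)).const_add x
    exact h1.comp_hasDerivAt s h2
  have hK : ∀ s ∈ Set.Icc (0 : ℝ) 1,
      ‖(fun j => ∑ i, (y - x) i * pd i (pd j S) (x + s • (y - x)) : Fin n → ℝ)‖
        ≤ ‖y - x‖ * (M x + 1) * ‖D s‖ := by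
    intro s hs
    obtain ⟨hlt, hmem⟩ := hball _ (hseg s hs)
    have hM0 : 0 ≤ M x + 1 := by
      have : 0 ≤ M x := by positivity
      linarith
    rw [pi_norm_le_iff_of_nonneg (by positivity)]
    intro j
    have hterm : ∀ i, ‖(y - x) i * pd i (pd j S) (x + s • (y - x))‖
        ≤ ‖y - x‖ * ((∑ k, |C i j k (x + s • (y - x))|) * ‖D s‖) := by
      intro i
      rw [norm_mul, h _ hmem]
      gcongr
      · exact norm_le_pi_norm (y - x) i
      · refine (norm_sum_le _ _).trans ?_
        rw [Finset.sum_mul]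
        gcongr with k
        rw [norm_mul, Real.norm_eq_abs]
        gcongr
        exact norm_le_pi_norm (D s) k
    calc _ ≤ ∑ i, ‖(y - x) i * pd i (pd j S) (x + s • (y - x))‖ := norm_sum_le _ _
      _ ≤ ∑ i, ‖y - x‖ * ((∑ k, |C i j k (x + s • (y - x))|) * ‖D s‖) :=
        Finset.sum_le_sum fun i _ => hterm i
      _ = ‖y - x‖ * (∑ i, ∑ k, |C i j k (x + s • (y - x))|) * ‖D s‖ := by
        rw [← Finset.mul_sum, ← Finset.sum_mul, mul_assoc]
      _ ≤ ‖y - x‖ * (M x + 1) * ‖D s‖ := by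
        gcongr
        refine le_trans ?_ hlt.le
        simp only [hM]
        refine Finset.sum_le_sum fun i _ => ?_
        exact Finset.single_le_sum (f := fun j => ∑ k, |C i j k (x + s • (y - x))|)
          (fun j _ => Finset.sum_nonneg fun k _ => abs_nonneg _) (Finset.mem_univ j)
  have hz := eq_zero_of_abs_deriv_le_mul_abs_self_of_eq_zero_right (f := D) (a := 0) (b := 1)
    (fun s hs => (hDd s hs).continuousAt.continuousWithinAt)
    (fun s hs => (hDd s ⟨hs.1, hs.2.le⟩).hasDerivWithinAt)
    (by funext j; simp [hD, h0]) (fun s hs => hK s ⟨hs.1, hs.2.le⟩) 1 ⟨zero_le_one, le_rfl⟩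
  intro i
  simpa [hD] using congrFun hz i

/-- For factor zero the covariant Hessian vanishes, so the second derivatives of `S` are linear in
the first ones and critical points propagate to neighbourhoods. By connectedness `dS` vanishes on
all of `U`. -/
theorem IsHomothetic.eq_zero_of_grad (hg : IsMetricOn g U) (hU : IsOpen U)
    (hU' : IsPreconnected U) (hS : ContDiffOn ℝ ∞ S U) (hY : IsHomothetic g U (grad g S) 0)
    (hx : x ∈ U) (h0 : S x = 0) (h1 : ∀ i, pd i S x = 0) {y : Fin n → ℝ} (hy : y ∈ U) :
    S y = 0 := by
  have hC : ∀ y ∈ U, ∀ i j, pd i (pd j S) y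
      = ∑ k, (∑ l, (1 / 2) * ((g y)⁻¹ l k * bracket g l i j y)) * pd k S y := by
    intro y hy i j
    have h2 := hg.lieMetric_grad hU hS hy i j
    rw [hY.2 y hy] at h2
    have h3 : ∑ k, (∑ l, (1 / 2) * ((g y)⁻¹ l k * bracket g l i j y)) * pd k S y
        = (1 / 2) * ∑ l, grad g S y l * bracket g l i j y := by
      simp only [grad, Finset.sum_mul, Finset.mul_sum]
      rw [Finset.sum_comm]
      exact Finset.sum_congr rfl fun l _ => Finset.sum_congr rfl fun k _ => by ring
    rw [h3]
    linarith
  have hCc : ∀ i j k : Fin n,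
      ContinuousOn (fun y => ∑ l, (1 / 2) * ((g y)⁻¹ l k * bracket g l i j y)) U :=
    fun i j k => (ContDiffOn.sum fun l _ => contDiffOn_const.mul
      ((hg.smooth_inv l k).mul (hg.smooth_bracket hU l i j))).continuousOn
  -- The set of critical points is closed in `U` by continuity, and each of its points in `U` is
  -- interior by `eventually_pd_eq_zero`.
  have hsub : U ⊆ interior {z | ∀ i, pd i S z = 0} := by
    refine hU'.subset_of_closure_inter_subset isOpen_interior ⟨x, hx, ?_⟩ ?_
    · exact mem_interior_iff_mem_nhds.2 (eventually_pd_eq_zero hU hS hCc hC hx h1)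
    · rintro z ⟨hz, hzU⟩
      refine mem_interior_iff_mem_nhds.2 (eventually_pd_eq_zero hU hS hCc hC hzU fun i => ?_)
      have hc := ((contDiffOn_pd hS hU i).continuousOn.continuousAt (hU.mem_nhds hzU))
      have : z ∈ closure {z | ∀ i, pd i S z = 0} := closure_mono interior_subset hz
      obtain ⟨u, hu, hut⟩ := mem_closure_iff_seq_limit.1 this
      have h2 : Tendsto (fun m => pd i S (u m)) atTop (𝓝 (pd i S z)) := hc.tendsto.comp hut
      have h3 : (fun m => pd i S (u m)) = fun _ => (0 : ℝ) := funext fun m => hu m i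
      rw [h3] at h2
      exact tendsto_nhds_unique h2 tendsto_const_nhds
  rw [← h0]
  exact const_of_pd_eq_zero hU hU' hS (fun z hz => interior_subset (hsub hz)) hy hx

/-- The values of a curve in a finite-dimensional space are combinations of finitely many of them,
with coefficients that are linear functionals of the value. -/
theorem exists_finite_expansion {E : Type*} [NormedAddCommGroup E] [NormedSpace ℝ E]
    [FiniteDimensional ℝ E] (f : ℝ → E) (I : Set ℝ) :
    ∃ (N : ℕ) (τ : Fin N → ℝ) (φ : Fin N → E →L[ℝ] ℝ), (∀ A, τ A ∈ I) ∧
      ∀ t ∈ I, f t = ∑ A, φ A (f t) • f (τ A) := by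
  -- A basis of the span is chosen among the values themselves, so that each basis vector is `f` at
  -- some time.
  obtain ⟨b, hbI, hbspan, hbli⟩ := exists_linearIndependent ℝ (f '' I)
  have hfin : b.Finite := hbli.setFinite
  have : Fintype b := hfin.fintype
  let e := Fintype.equivFin b
  have hli : LinearIndependent ℝ (fun A : Fin (Fintype.card b) => ((e.symm A : b) : E)) :=
    hbli.comp _ e.symm.injective
  have hspan : Submodule.span ℝ (Set.range fun A => ((e.symm A : b) : E))
      = Submodule.span ℝ (f '' I) := by
    rw [← hbspan]
    congr 1
    ext v
    constructor
    · rintro ⟨A, rfl⟩; exact (e.symm A).2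
    · intro hv; exact ⟨e ⟨v, hv⟩, by simp⟩
  have hτ : ∀ A, ∃ t ∈ I, f t = ((e.symm A : b) : E) := fun A => hbI (e.symm A).2
  choose τ hτI hτf using hτ
  set W := Submodule.span ℝ (Set.range fun A => ((e.symm A : b) : E)) with hW
  -- A linear retraction onto the span extends the coordinate functionals to all of `E`;
  -- coefficients of a smooth curve are then smooth.
  obtain ⟨P, hP⟩ := LinearMap.exists_leftInverse_of_injective W.subtype (by simp)
  refine ⟨_, τ, fun A => LinearMap.toContinuousLinearMap
    ((Finsupp.lapply A ∘ₗ hli.repr) ∘ₗ P), hτI, fun t ht => ?_⟩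
  have hmem : f t ∈ W := by
    rw [hspan]
    exact Submodule.subset_span ⟨t, ht, rfl⟩
  have hPf : P (f t) = ⟨f t, hmem⟩ := by
    simpa using LinearMap.congr_fun hP ⟨f t, hmem⟩
  have h1 := hli.linearCombination_repr ⟨f t, hmem⟩
  rw [Finsupp.linearCombination_apply, Finsupp.sum_fintype _ _ (by simp)] at h1
  simp only [hτf]
  conv_lhs => rw [← show _ = f t from h1]
  simp [hPf]

end HomotheticAlgebra

end HeatFlux

namespace HeatFlux

open Filter Topology

/-! ### The second prolongation applied to the heat equation -/

section Prolongation

/-- The heat operator is affine in `u_a` and in `u_{ab}`, so its derivatives there are read off from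
increments. -/
theorem fderiv_eq_of_affine {V : Type*} [NormedAddCommGroup V] [NormedSpace ℝ V] {f : V → ℝ}
    {p w : V} {d : ℝ} (hf : DifferentiableAt ℝ f p) (h : ∀ s : ℝ, f (p + s • w) = f p + s * d) :
    fderiv ℝ f p w = d := by
  rw [← hf.lineDeriv_eq_fderiv]
  unfold lineDeriv
  simp only [h]
  simp

theorem PointField.pd_η₁ {ι : Type*} [Fintype ι] [DecidableEq ι] (X : PointField ι) (a c : ι)
    (z : ι → ℝ) (u : ℝ) (p : ι → ℝ) :
    pd c (fun p' => X.η₁ a z u p') p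
      = (if a = c then deriv (X.η z) u - ∑ b, p b * deriv (X.ξ b z) u else 0)
        - totalD a (X.ξ c) z u p := by
  have hd : ∀ b : ι, DifferentiableAt ℝ (fun p' : ι → ℝ => p' b) p := fun b => by fun_prop
  unfold PointField.η₁ totalD
  rw [pd_sub (by fun_prop) (by fun_prop), pd_add (by fun_prop) (by fun_prop), pd_const,
    pd_mul_const (hd a), pd_apply, pd_sum (fun b _ => by fun_prop)]
  have h : ∀ b, pd c (fun p' : ι → ℝ => p' b * (pd a (fun z' => X.ξ b z' u) z
        + p' a * deriv (X.ξ b z) u)) p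
      = (if b = c then 1 else 0) * (pd a (fun z' => X.ξ b z' u) z + p a * deriv (X.ξ b z) u)
        + (if a = c then 1 else 0) * (p b * deriv (X.ξ b z) u) := by
    intro b
    rw [pd_mul (hd b) (by fun_prop), pd_add (by fun_prop) (by fun_prop), pd_const,
      pd_mul_const (hd a), pd_apply, pd_apply]
    ring
  simp only [h, Finset.sum_add_distrib, ← Finset.mul_sum]
  by_cases hac : a = c <;> simp [hac]
  ring

variable {n : ℕ} {g : (Fin n → ℝ) → Matrix (Fin n) (Fin n) ℝ} {I J : Set ℝ}
  {U : Set (Fin n → ℝ)} {q : ℝ → (Fin n → ℝ) → ℝ → ℝ}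

theorem contDiffOn_flux (hq : ContDiffOn ℝ ∞ (fun w : ℝ × (Fin n → ℝ) × ℝ => q w.1 w.2.1 w.2.2)
      (I ×ˢ (U ×ˢ J))) {u : ℝ} (hu : u ∈ J) :
    ContDiffOn ℝ ∞ (fun w : ℝ × (Fin n → ℝ) => q w.1 w.2 u) (I ×ˢ U) :=
  hq.comp (f := fun w : ℝ × (Fin n → ℝ) => (w.1, w.2, u)) (by fun_prop)
    fun _ hw => ⟨hw.1, hw.2, hu⟩

/-- The base point enters `G` only through `g⁻¹`, `Γ` and `q`, and the jet variables enter affinely;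
the four parts of the prolongation are evaluated accordingly. -/
theorem prolong_heatEq (hI : IsOpen I) (hU : IsOpen U) (hg : IsMetricOn g U)
    (hq : ContDiffOn ℝ ∞ (fun w : ℝ × (Fin n → ℝ) × ℝ => q w.1 w.2.1 w.2.2) (I ×ˢ (U ×ˢ J)))
    (X : PointField (Fin (n + 1))) {t : ℝ} (ht : t ∈ I) {x : Fin n → ℝ} (hx : x ∈ U) {u : ℝ}
    (hu : u ∈ J) (p : Fin (n + 1) → ℝ) (r : Fin (n + 1) → Fin (n + 1) → ℝ) :
    X.prolong₂ (heatEq g q) (Matrix.vecCons t x) u p r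
      = ∑ i : Fin n, ∑ j : Fin n, (∑ k : Fin n, X.ξ k.succ (Matrix.vecCons t x) u *
            pd k (fun y => (g y)⁻¹ i j) x) * r i.succ j.succ
        - ∑ i : Fin n, (∑ k : Fin n, X.ξ k.succ (Matrix.vecCons t x) u *
            pd k (contractedGamma g i) x) * p i.succ
        - X.ξ 0 (Matrix.vecCons t x) u * deriv (fun s => q s x u) t
        - ∑ k : Fin n, X.ξ k.succ (Matrix.vecCons t x) u * pd k (fun y => q t y u) x
        - X.η (Matrix.vecCons t x) u * deriv (q t x) u
        - ∑ i : Fin n, contractedGamma g i x * X.η₁ i.succ (Matrix.vecCons t x) u p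
        - X.η₁ 0 (Matrix.vecCons t x) u p
        + ∑ i : Fin n, ∑ j : Fin n,
            (g x)⁻¹ i j * X.η₂ i.succ j.succ (Matrix.vecCons t x) u p r := by
  have hqs := contDiffOn_flux hq hu
  have hA := fun i j => (hg.smooth_inv i j).diffAt hU hx
  have hΓ := fun i => (hg.smooth_contractedGamma hU i).diffAt hU hx
  have hF : ContDiffOn ℝ ∞ (fun w : ℝ × (Fin n → ℝ) =>
      ∑ i : Fin n, ∑ j : Fin n, (g w.2)⁻¹ i j * r i.succ j.succ
        - ∑ i : Fin n, contractedGamma g i w.2 * p i.succ - p 0 - q w.1 w.2 u) (I ×ˢ U) := by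
    have hsnd : Set.MapsTo (fun w : ℝ × (Fin n → ℝ) => w.2) (I ×ˢ U) U := fun _ hw => hw.2
    refine (((ContDiffOn.sum fun i _ => ContDiffOn.sum fun j _ => ?_).sub
      (ContDiffOn.sum fun i _ => ?_)).sub contDiffOn_const).sub hqs
    · exact ((hg.smooth_inv i j).comp contDiffOn_snd hsnd).mul contDiffOn_const
    · exact ((hg.smooth_contractedGamma hU i).comp contDiffOn_snd hsnd).mul contDiffOn_const
  have e1 : fderiv ℝ (fun z' => heatEq g q z' u p r) (Matrix.vecCons t x)
      (fun a => X.ξ a (Matrix.vecCons t x) u)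
      = X.ξ 0 (Matrix.vecCons t x) u * -deriv (fun s => q s x u) t
        + ∑ k : Fin n, X.ξ k.succ (Matrix.vecCons t x) u *
          (∑ i : Fin n, ∑ j : Fin n, pd k (fun y => (g y)⁻¹ i j) x * r i.succ j.succ
            - ∑ i : Fin n, pd k (contractedGamma g i) x * p i.succ
            - pd k (fun y => q t y u) x) := by
    have h0 := fderiv_split (f := fun t x => ∑ i : Fin n, ∑ j : Fin n,
      (g x)⁻¹ i j * r i.succ j.succ - ∑ i : Fin n, contractedGamma g i x * p i.succ - p 0
        - q t x u) hF hI hU ht hx (fun a => X.ξ a (Matrix.vecCons t x) u)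
    unfold heatEq
    rw [h0]
    congr 1
    · rw [deriv_const_sub]
    · refine Finset.sum_congr rfl fun k _ => ?_
      congr 1
      have hqd := (contDiffOn_slice_right (f := fun t x => q t x u) hqs ht).diffAt hU hx
      have hAr : ∀ i j, DifferentiableAt ℝ (fun y => (g y)⁻¹ i j * r i.succ j.succ) x :=
        fun i j => (hA i j).mul_const _
      have hAr' : ∀ i, DifferentiableAt ℝ (fun y => ∑ j, (g y)⁻¹ i j * r i.succ j.succ) x :=
        fun i => DifferentiableAt.fun_sum fun j _ => hAr i j
      have hΓp : ∀ i : Fin n, DifferentiableAt ℝ (fun y => contractedGamma g i y * p i.succ) x :=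
        fun i => (hΓ i).mul_const _
      have hsA := DifferentiableAt.fun_sum (u := Finset.univ) fun i _ => hAr' i
      have hsΓ := DifferentiableAt.fun_sum (u := Finset.univ) fun i _ => hΓp i
      rw [pd_sub ((hsA.fun_sub hsΓ).fun_sub (differentiableAt_const _)) hqd,
        pd_sub (hsA.fun_sub hsΓ) (differentiableAt_const _),
        pd_sub hsA hsΓ, pd_const, sub_zero, pd_sum (fun i _ => hAr' i),
        pd_sum (fun i _ => hΓp i)]
      congr 2
      · refine Finset.sum_congr rfl fun i _ => ?_
        rw [pd_sum (fun j _ => hAr i j)]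
        exact Finset.sum_congr rfl fun j _ => pd_mul_const (hA i j) _ k
      · exact Finset.sum_congr rfl fun i _ => pd_mul_const (hΓ i) _ k
  have e2 : deriv (fun v => heatEq g q (Matrix.vecCons t x) v p r) u = -deriv (q t x) u := by
    unfold heatEq
    rw [deriv_const_sub]
    rfl
  have e3 : ∀ w : Fin (n + 1) → ℝ,
      fderiv ℝ (fun p' => heatEq g q (Matrix.vecCons t x) u p' r) p w
        = -∑ i : Fin n, contractedGamma g i x * w i.succ - w 0 := by
    intro w
    refine fderiv_eq_of_affine (by unfold heatEq; fun_prop) fun s => ?_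
    simp only [heatEq, tail_vecCons, Pi.add_apply, Pi.smul_apply, smul_eq_mul, mul_add,
      Finset.sum_add_distrib, mul_sub, mul_neg, Finset.mul_sum]
    simp only [mul_left_comm]
    ring
  have e4 : ∀ w : Fin (n + 1) → Fin (n + 1) → ℝ,
      fderiv ℝ (fun r' => heatEq g q (Matrix.vecCons t x) u p r') r w
        = ∑ i : Fin n, ∑ j : Fin n, (g x)⁻¹ i j * w i.succ j.succ := by
    intro w
    refine fderiv_eq_of_affine (by unfold heatEq; fun_prop) fun s => ?_
    simp only [heatEq, tail_vecCons, Pi.add_apply, Pi.smul_apply, smul_eq_mul, mul_add,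
      Finset.sum_add_distrib, Finset.mul_sum]
    simp only [mul_left_comm]
    ring
  unfold PointField.prolong₂
  rw [e1, e2, e3, e4]
  have e5 : ∑ k : Fin n, X.ξ k.succ (Matrix.vecCons t x) u *
          (∑ i : Fin n, ∑ j : Fin n, pd k (fun y => (g y)⁻¹ i j) x * r i.succ j.succ
            - ∑ i : Fin n, pd k (contractedGamma g i) x * p i.succ
            - pd k (fun y => q t y u) x)
      = ∑ i : Fin n, ∑ j : Fin n, (∑ k : Fin n, X.ξ k.succ (Matrix.vecCons t x) u *
            pd k (fun y => (g y)⁻¹ i j) x) * r i.succ j.succ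
        - ∑ i : Fin n, (∑ k : Fin n, X.ξ k.succ (Matrix.vecCons t x) u *
            pd k (contractedGamma g i) x) * p i.succ
        - ∑ k : Fin n, X.ξ k.succ (Matrix.vecCons t x) u * pd k (fun y => q t y u) x := by
    simp only [mul_sub, Finset.sum_sub_distrib, Finset.mul_sum, Finset.sum_mul]
    congr 2
    · rw [Finset.sum_comm]
      refine Finset.sum_congr rfl fun i _ => ?_
      rw [Finset.sum_comm]
      exact Finset.sum_congr rfl fun j _ => Finset.sum_congr rfl fun k _ => by ring
    · rw [Finset.sum_comm]
      exact Finset.sum_congr rfl fun i _ => Finset.sum_congr rfl fun k _ => by ring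
  rw [e5]
  ring

/-- The part of `η^{(2)}_{ab}` that is free of the second derivatives of `u`. -/
noncomputable def PointField.η₂free (X : PointField (Fin (n + 1))) (a b : Fin (n + 1))
    (z : Fin (n + 1) → ℝ) (u : ℝ) (p : Fin (n + 1) → ℝ) : ℝ :=
  pd b (fun z' => X.η₁ a z' u p) z + p b * deriv (fun v => X.η₁ a z v p) u

/-- Isolates the second derivatives of `u`, in which `η^{(2)}` is affine. -/
theorem PointField.η₂_eq (X : PointField (Fin (n + 1))) (a b : Fin (n + 1))
    (z : Fin (n + 1) → ℝ) (u : ℝ) (p : Fin (n + 1) → ℝ) (r : Fin (n + 1) → Fin (n + 1) → ℝ) :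
    X.η₂ a b z u p r = X.η₂free a b z u p
      + ((deriv (X.η z) u - ∑ c, p c * deriv (X.ξ c z) u) * r a b
        - ∑ c, (r c b * totalD a (X.ξ c) z u p + r a c * totalD b (X.ξ c) z u p)) := by
  unfold PointField.η₂ totalD₁ PointField.η₂free
  simp only [X.pd_η₁, mul_sub, Finset.sum_sub_distrib, Finset.sum_add_distrib, mul_ite, mul_zero,
    Finset.sum_ite_eq, Finset.mem_univ, if_true]
  ring

/-- Comparison of the coefficients of the second derivatives of `u`. -/
theorem second_order_coefficients {A B : Fin n → Fin n → ℝ} {N : Fin n → Fin (n + 1) → ℝ}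
    {μ lam : ℝ} (hA : ∀ i j, A i j = A j i) (hB : ∀ i j, B i j = B j i)
    (h : ∀ r : Fin (n + 1) → Fin (n + 1) → ℝ, (∀ a b, r a b = r b a) →
      ∑ i : Fin n, ∑ j : Fin n, B i j * r i.succ j.succ
        + ∑ i : Fin n, ∑ j : Fin n, A i j * (μ * r i.succ j.succ
          - ∑ c, (r c j.succ * N i c + r i.succ c * N j c))
      = lam * ∑ i : Fin n, ∑ j : Fin n, A i j * r i.succ j.succ) :
    (∀ l, ∑ i, A i l * N i 0 = 0) ∧
    ∀ k l : Fin n, B k l + μ * A k l - ∑ m, A m l * N m k.succ - ∑ m, A k m * N m l.succ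
      = lam * A k l := by
  -- The two sums containing `N` coincide because `A` and `r` are symmetric.
  have h' : ∀ r : Fin (n + 1) → Fin (n + 1) → ℝ, (∀ a b, r a b = r b a) →
      ∑ j : Fin n, ∑ i : Fin n, (B i j + μ * A i j - lam * A i j) * r i.succ j.succ
        = 2 * ∑ j : Fin n, ∑ c, r c j.succ * ∑ i, A i j * N i c := by
    intro r hr
    have h1 := h r hr
    have s1 : ∑ i : Fin n, ∑ j : Fin n, A i j * ∑ c, r c j.succ * N i c
        = ∑ j : Fin n, ∑ c, r c j.succ * ∑ i, A i j * N i c := by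
      simp only [Finset.mul_sum]
      rw [Finset.sum_comm]
      refine Finset.sum_congr rfl fun j _ => ?_
      rw [Finset.sum_comm]
      exact Finset.sum_congr rfl fun c _ => Finset.sum_congr rfl fun i _ => by ring
    have s2 : ∑ i : Fin n, ∑ j : Fin n, A i j * ∑ c, r i.succ c * N j c
        = ∑ j : Fin n, ∑ c, r c j.succ * ∑ i, A i j * N i c := by
      rw [← s1, Finset.sum_comm]
      refine Finset.sum_congr rfl fun j _ => Finset.sum_congr rfl fun i _ => ?_
      rw [hA]
      congr 1
      exact Finset.sum_congr rfl fun c _ => by rw [hr]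
    simp only [mul_sub, Finset.sum_sub_distrib, Finset.sum_add_distrib, mul_add] at h1
    rw [s1, s2] at h1
    rw [Finset.sum_comm]
    simp only [sub_mul, add_mul, Finset.sum_sub_distrib, Finset.sum_add_distrib]
    simp only [Finset.mul_sum] at h1 ⊢
    simp only [mul_assoc, mul_left_comm μ, mul_left_comm lam] at h1 ⊢
    simp only [two_mul, Finset.sum_add_distrib]
    linarith
  constructor
  · intro l
    -- Only symmetric `r` are allowed, so the test matrix is a symmetrised matrix unit. In the
    -- time-space position only the terms `N i 0` see it.
    have h1 := h' (fun a b => (if a = 0 then 1 else 0) * (if b = l.succ then 1 else 0)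
      + (if a = l.succ then 1 else 0) * (if b = 0 then 1 else 0)) (fun a b => by ring)
    simp [Fin.succ_ne_zero] at h1
    exact h1
  · intro k l
    have h1 := h' (fun a b => (if a = k.succ then 1 else 0) * (if b = l.succ then 1 else 0)
      + (if a = l.succ then 1 else 0) * (if b = k.succ then 1 else 0)) (fun a b => by ring)
    simp only [Fin.succ_inj, mul_add, add_mul, Finset.sum_add_distrib, mul_ite, ite_mul, mul_one,
      one_mul, mul_zero, zero_mul] at h1
    simp at h1
    have e : ∑ m, A k m * N m l.succ = ∑ m, A m k * N m l.succ :=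
      Finset.sum_congr rfl fun m _ => by rw [hA]
    rw [e]
    rw [hB l k, hA l k] at h1
    linarith

end Prolongation

end HeatFlux

namespace HeatFlux

open Filter Topology

/-! ### The determining equations -/

section Determining

variable {n : ℕ} {g : (Fin n → ℝ) → Matrix (Fin n) (Fin n) ℝ} {I J : Set ℝ}
  {U : Set (Fin n → ℝ)} {q : ℝ → (Fin n → ℝ) → ℝ → ℝ}

theorem IsMetricOn.eq_zero_of_sum_inv_mul (hg : IsMetricOn g U) {x : Fin n → ℝ} (hx : x ∈ U)
    {v : Fin n → ℝ} (h : ∀ l, ∑ i, (g x)⁻¹ i l * v i = 0) (i : Fin n) : v i = 0 := by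
  have h1 : ∑ l, g x i l * ∑ m, (g x)⁻¹ m l * v m = v i := by
    simp only [Finset.mul_sum]
    rw [Finset.sum_comm]
    simp only [← mul_assoc, ← Finset.sum_mul]
    have : ∀ m, ∑ l, g x i l * (g x)⁻¹ m l = if i = m then 1 else 0 := fun m => by
      rw [← hg.sum_mul_inv hx i m]
      exact Finset.sum_congr rfl fun l _ => by rw [hg.inv_symm_apply hx]
    simp [this]
  rw [← h1]
  simp [h]

theorem IsLieSymmetry.coefficients (hI : IsOpen I) (hU : IsOpen U) (hg : IsMetricOn g U)
    (hq : ContDiffOn ℝ ∞ (fun w : ℝ × (Fin n → ℝ) × ℝ => q w.1 w.2.1 w.2.2) (I ×ˢ (U ×ˢ J)))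
    {X : PointField (Fin (n + 1))} {lam : (Fin (n + 1) → ℝ) → ℝ → (Fin (n + 1) → ℝ) → ℝ}
    (hlam : ∀ z ∈ spaceTime I U, ∀ u ∈ J, ∀ (p : Fin (n + 1) → ℝ)
      (r : Fin (n + 1) → Fin (n + 1) → ℝ), (∀ a b, r a b = r b a) →
      X.prolong₂ (heatEq g q) z u p r = lam z u p * heatEq g q z u p r)
    {t : ℝ} (ht : t ∈ I) {x : Fin n → ℝ} (hx : x ∈ U) {u : ℝ} (hu : u ∈ J)
    (p : Fin (n + 1) → ℝ) :
    (∀ i : Fin n, totalD i.succ (X.ξ 0) (Matrix.vecCons t x) u p = 0) ∧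
    ∀ k l : Fin n, ∑ m : Fin n, X.ξ m.succ (Matrix.vecCons t x) u *
          pd m (fun y => (g y)⁻¹ k l) x
        + (deriv (X.η (Matrix.vecCons t x)) u
          - ∑ c, p c * deriv (X.ξ c (Matrix.vecCons t x)) u) * (g x)⁻¹ k l
        - ∑ m : Fin n, (g x)⁻¹ m l * totalD m.succ (X.ξ k.succ) (Matrix.vecCons t x) u p
        - ∑ m : Fin n, (g x)⁻¹ k m * totalD m.succ (X.ξ l.succ) (Matrix.vecCons t x) u p
      = lam (Matrix.vecCons t x) u p * (g x)⁻¹ k l := by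
  have key := second_order_coefficients (A := fun i j => (g x)⁻¹ i j)
    (B := fun k l => ∑ m : Fin n, X.ξ m.succ (Matrix.vecCons t x) u *
      pd m (fun y => (g y)⁻¹ k l) x)
    (N := fun i c => totalD i.succ (X.ξ c) (Matrix.vecCons t x) u p)
    (μ := deriv (X.η (Matrix.vecCons t x)) u
          - ∑ c, p c * deriv (X.ξ c (Matrix.vecCons t x)) u)
    (lam := lam (Matrix.vecCons t x) u p)
    (hg.inv_symm_apply hx)
    (fun i j => Finset.sum_congr rfl fun m _ => by
      rw [pd_congr_on hU (fun y hy => hg.inv_symm_apply hy i j) hx])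
    (fun r hr => by
      have h1 := hlam _ (vecCons_mem ht hx) u hu p r hr
      -- Subtracting the instance `r = 0` removes everything free of second derivatives; `lam` does
      -- not depend on `r`.
      have h0 := hlam _ (vecCons_mem ht hx) u hu p 0 (fun _ _ => rfl)
      rw [prolong_heatEq hI hU hg hq X ht hx hu] at h1 h0
      simp only [heatEq, tail_vecCons, PointField.η₂_eq, mul_add ((g x)⁻¹ _ _),
        Finset.sum_add_distrib (M := ℝ), Pi.zero_apply, mul_zero, zero_mul, Finset.sum_const_zero,
        sub_zero, add_zero] at h1 h0
      simp only [Finset.sum_add_distrib (M := ℝ)]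
      linarith)
  refine ⟨fun i => ?_, key.2⟩
  exact hg.eq_zero_of_sum_inv_mul hx key.1 i

/-- The second-order coefficients still contain the unknown `lam`. It is eliminated through the
dependence on `u_t`, which the coefficients of the spatial second derivatives do not see once `D_i
ξ^t = 0`. -/
theorem IsLieSymmetry.first_determining (hn : 0 < n) (hI : IsOpen I) (hU : IsOpen U)
    (hJ : IsOpen J) (hg : IsMetricOn g U)
    (hq : ContDiffOn ℝ ∞ (fun w : ℝ × (Fin n → ℝ) × ℝ => q w.1 w.2.1 w.2.2) (I ×ˢ (U ×ˢ J)))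
    {X : PointField (Fin (n + 1))} {lam : (Fin (n + 1) → ℝ) → ℝ → (Fin (n + 1) → ℝ) → ℝ}
    (hlam : ∀ z ∈ spaceTime I U, ∀ u ∈ J, ∀ (p : Fin (n + 1) → ℝ)
      (r : Fin (n + 1) → Fin (n + 1) → ℝ), (∀ a b, r a b = r b a) →
      X.prolong₂ (heatEq g q) z u p r = lam z u p * heatEq g q z u p r)
    {t : ℝ} (ht : t ∈ I) {x : Fin n → ℝ} (hx : x ∈ U) {u : ℝ} (hu : u ∈ J) :
    (∀ i : Fin n, pd i.succ (fun z => X.ξ 0 z u) (Matrix.vecCons t x) = 0) ∧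
    deriv (X.ξ 0 (Matrix.vecCons t x)) u = 0 ∧
    (∀ k : Fin n, deriv (X.ξ k.succ (Matrix.vecCons t x)) u = 0) ∧
    (∀ p, lam (Matrix.vecCons t x) u p = deriv (X.η (Matrix.vecCons t x)) u
      - pd 0 (fun z => X.ξ 0 z u) (Matrix.vecCons t x)) ∧
    ∀ k l : Fin n, ∑ m : Fin n, X.ξ m.succ (Matrix.vecCons t x) u *
          pd m (fun y => (g y)⁻¹ k l) x
        + pd 0 (fun z => X.ξ 0 z u) (Matrix.vecCons t x) * (g x)⁻¹ k l
        - ∑ m : Fin n, (g x)⁻¹ m l * pd m.succ (fun z => X.ξ k.succ z u) (Matrix.vecCons t x)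
        - ∑ m : Fin n, (g x)⁻¹ k m * pd m.succ (fun z => X.ξ l.succ z u) (Matrix.vecCons t x)
      = 0 := by
  have hc := fun {t : ℝ} (ht : t ∈ I) {x : Fin n → ℝ} (hx : x ∈ U) {u : ℝ} (hu : u ∈ J) =>
    IsLieSymmetry.coefficients hI hU hg hq hlam ht hx hu
  have hξi : ∀ t ∈ I, ∀ x ∈ U, ∀ u ∈ J, ∀ i : Fin n,
      pd i.succ (fun z => X.ξ 0 z u) (Matrix.vecCons t x) = 0 := by
    intro t ht x hx u hu i
    simpa [totalD] using (hc ht hx hu 0).1 i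
  have hξu : ∀ t ∈ I, ∀ x ∈ U, ∀ u ∈ J, deriv (X.ξ 0 (Matrix.vecCons t x)) u = 0 := by
    intro t ht x hx u hu
    -- `D_i ξ^t = 0` at a jet with `u_i = 1` isolates the `u`-derivative; some spatial index exists
    -- because `n > 0`.
    have := (hc ht hx hu (fun _ => 1)).1 ⟨0, hn⟩
    unfold totalD at this
    rw [hξi t ht x hx u hu] at this
    simpa using this
  -- In the spatial coefficients `u_t` is multiplied by `D_i ξ^t`, which vanishes.
  have hη₁ : ∀ z ∈ spaceTime I U, ∀ u ∈ J, ∀ (i : Fin n) (p : Fin (n + 1) → ℝ) (s : ℝ),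
      X.η₁ i.succ z u (Function.update p 0 s) = X.η₁ i.succ z u p := by
    intro z hz u hu i p s
    rw [← vecCons_split z]
    have h0 : ∀ p, totalD i.succ (X.ξ 0) (Matrix.vecCons (z 0) (Matrix.vecTail z)) u p = 0 :=
      fun p => (hc hz.1 hz.2 hu p).1 i
    unfold PointField.η₁
    simp only [Fin.sum_univ_succ, h0, mul_zero, zero_add]
    simp [totalD, Function.update_of_ne, Fin.succ_ne_zero]
  have hη₂ : ∀ (i j : Fin n) (p : Fin (n + 1) → ℝ) (s : ℝ),
      X.η₂free i.succ j.succ (Matrix.vecCons t x) u (Function.update p 0 s)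
        = X.η₂free i.succ j.succ (Matrix.vecCons t x) u p := by
    intro i j p s
    unfold PointField.η₂free
    rw [pd_congr_on (isOpen_spaceTime hI hU) (fun z hz => hη₁ z hz u hu i p s)
      (vecCons_mem ht hx), Function.update_of_ne (Fin.succ_ne_zero j)]
    congr 2
    refine EventuallyEq.deriv_eq ?_
    filter_upwards [hJ.mem_nhds hu] with v hv
    exact hη₁ _ (vecCons_mem ht hx) v hv i p s
  have hlam0 : ∀ p, lam (Matrix.vecCons t x) u p = deriv (X.η (Matrix.vecCons t x)) u
      - pd 0 (fun z => X.ξ 0 z u) (Matrix.vecCons t x)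
      - ∑ k : Fin n, p k.succ * deriv (X.ξ k.succ (Matrix.vecCons t x)) u := by
    intro p
    -- Raising `u_t` by one lowers `G` by one and, as `hll` shows, leaves `lam` unchanged. The
    -- resulting change of `X^{[2]} G` at `r = 0`, which comes from `η^{(1)}_t` alone, therefore
    -- gives `lam`.
    set p' := Function.update p 0 (p 0 + 1) with hp'
    have hps : ∀ k : Fin n, p' k.succ = p k.succ := fun k => by
      simp [hp', Function.update_of_ne, Fin.succ_ne_zero]
    have hp0 : p' 0 = p 0 + 1 := by simp [hp']
    have hll : lam (Matrix.vecCons t x) u p' = lam (Matrix.vecCons t x) u p := by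
      obtain ⟨k, l, hkl⟩ := hg.exists_inv_ne_zero hn hx
      refine mul_right_cancel₀ hkl ?_
      rw [← (hc ht hx hu p).2 k l, ← (hc ht hx hu p').2 k l]
      simp only [totalD, hps, Fin.sum_univ_succ (n := n), hξu t ht x hx u hu, mul_zero]
    have h1 := hlam _ (vecCons_mem ht hx) u hu p 0 (fun _ _ => rfl)
    have h2 := hlam _ (vecCons_mem ht hx) u hu p' 0 (fun _ _ => rfl)
    rw [prolong_heatEq hI hU hg hq X ht hx hu] at h1 h2
    rw [hll] at h2
    simp only [heatEq, tail_vecCons, PointField.η₂_eq, Pi.zero_apply, mul_zero, zero_mul,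
      Finset.sum_const_zero, sub_zero, add_zero, hps, hp0] at h1 h2
    simp only [hp', hη₂, hη₁ _ (vecCons_mem ht hx) u hu] at h2
    have e : X.η₁ 0 (Matrix.vecCons t x) u (Function.update p 0 (p 0 + 1))
        = X.η₁ 0 (Matrix.vecCons t x) u p + deriv (X.η (Matrix.vecCons t x)) u
          - pd 0 (fun z => X.ξ 0 z u) (Matrix.vecCons t x)
          - ∑ k : Fin n, p k.succ * deriv (X.ξ k.succ (Matrix.vecCons t x)) u := by
      unfold PointField.η₁ totalD
      rw [← hp']
      simp only [Fin.sum_univ_succ, hps, hp0, hξu t ht x hx u hu, mul_add, Finset.sum_add_distrib,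
        add_mul, one_mul, mul_zero]
      ring
    rw [e] at h2
    linarith
  have hquad : ∀ (p : Fin (n + 1) → ℝ) (k l : Fin n),
      ∑ m : Fin n, X.ξ m.succ (Matrix.vecCons t x) u * pd m (fun y => (g y)⁻¹ k l) x
        + pd 0 (fun z => X.ξ 0 z u) (Matrix.vecCons t x) * (g x)⁻¹ k l
        - ∑ m : Fin n, (g x)⁻¹ m l * totalD m.succ (X.ξ k.succ) (Matrix.vecCons t x) u p
        - ∑ m : Fin n, (g x)⁻¹ k m * totalD m.succ (X.ξ l.succ) (Matrix.vecCons t x) u p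
      = 0 := by
    intro p k l
    have h1 := (hc ht hx hu p).2 k l
    rw [hlam0] at h1
    simp only [Fin.sum_univ_succ (n := n), hξu t ht x hx u hu, mul_zero, zero_add] at h1
    linarith
  have hξk : ∀ k : Fin n, deriv (X.ξ k.succ (Matrix.vecCons t x)) u = 0 := by
    intro k
    have h0 := hquad 0 k k
    -- With `u_m = g_{km}` the contractions `g^{mk} u_m` equal one, so the difference from `p = 0`
    -- is `-2 ξ^k_{,u}`.
    have h1 := hquad (Fin.cons 0 fun m => g x k m) k k
    have e1 := hg.sum_mul_inv hx k k
    have e2 := hg.sum_inv_mul hx k k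
    simp only [totalD, Pi.zero_apply, zero_mul, add_zero, Fin.cons_succ, mul_add,
      Finset.sum_add_distrib, ← mul_assoc, ← Finset.sum_mul] at h0 h1
    have e3 : ∑ m, (g x)⁻¹ m k * g x k m = 1 := by
      rw [← if_pos (c := k = k) (t := (1 : ℝ)) (e := 0) rfl, ← e1]
      exact Finset.sum_congr rfl fun m _ => mul_comm _ _
    have e4 : ∑ m, (g x)⁻¹ k m * g x k m = 1 := by
      rw [← e3]
      exact Finset.sum_congr rfl fun m _ => by rw [hg.inv_symm_apply hx]
    rw [e3, e4] at h1
    linarith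
  refine ⟨hξi t ht x hx u hu, hξu t ht x hx u hu, hξk, fun p => ?_, fun k l => ?_⟩
  · rw [hlam0]
    simp [hξk]
  · simpa [totalD] using hquad 0 k l

end Determining

end HeatFlux

namespace HeatFlux

open Filter Topology

/-! ### Fields whose `t`- and `x`-components do not depend on `u` -/

section Projectable

variable {n : ℕ} {g : (Fin n → ℝ) → Matrix (Fin n) (Fin n) ℝ} {I J : Set ℝ}
  {U : Set (Fin n → ℝ)} {q : ℝ → (Fin n → ℝ) → ℝ → ℝ}

/-- `X` has components `ξ^t = τ(t)` and `ξ^i = ξ^i(t,x)`, and all its components are smooth. -/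
structure IsProjectable (I : Set ℝ) (U : Set (Fin n → ℝ)) (J : Set ℝ)
    (X : PointField (Fin (n + 1))) (τ : ℝ → ℝ) (ξ : ℝ → (Fin n → ℝ) → Fin n → ℝ) : Prop where
  time : ∀ t ∈ I, ∀ x ∈ U, ∀ u ∈ J, X.ξ 0 (Matrix.vecCons t x) u = τ t
  space : ∀ t ∈ I, ∀ x ∈ U, ∀ u ∈ J, ∀ i : Fin n, X.ξ i.succ (Matrix.vecCons t x) u = ξ t x i
  smooth_time : ContDiffOn ℝ ∞ τ I
  smooth_space : ∀ i : Fin n, ContDiffOn ℝ ∞ (fun w : ℝ × (Fin n → ℝ) => ξ w.1 w.2 i) (I ×ˢ U)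
  smooth_η : ContDiffOn ℝ ∞ (fun w : (Fin (n + 1) → ℝ) × ℝ => X.η w.1 w.2) (spaceTime I U ×ˢ J)

theorem totalD_of_split (hI : IsOpen I) (hU : IsOpen U) (hJ : IsOpen J)
    {F : (Fin (n + 1) → ℝ) → ℝ → ℝ} {f : ℝ → (Fin n → ℝ) → ℝ}
    (hf : ContDiffOn ℝ ∞ (fun w : ℝ × (Fin n → ℝ) => f w.1 w.2) (I ×ˢ U))
    (hF : ∀ t ∈ I, ∀ x ∈ U, ∀ u ∈ J, F (Matrix.vecCons t x) u = f t x)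
    {t : ℝ} (ht : t ∈ I) {x : Fin n → ℝ} (hx : x ∈ U) {u : ℝ} (hu : u ∈ J)
    (p : Fin (n + 1) → ℝ) :
    totalD 0 F (Matrix.vecCons t x) u p = deriv (fun s => f s x) t ∧
    ∀ i : Fin n, totalD i.succ F (Matrix.vecCons t x) u p = pd i (f t) x := by
  have h0 : deriv (F (Matrix.vecCons t x)) u = 0 := by
    have : F (Matrix.vecCons t x) =ᶠ[𝓝 u] fun _ => f t x := by
      filter_upwards [hJ.mem_nhds hu] with v hv using hF t ht x hx v hv
    rw [this.deriv_eq, deriv_const]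
  have h1 : ∀ c, pd c (fun z => F z u) (Matrix.vecCons t x)
      = pd c (fun z => f (z 0) (Matrix.vecTail z)) (Matrix.vecCons t x) := fun c =>
    pd_congr_on (isOpen_spaceTime hI hU)
      (fun z hz => by rw [← hF _ hz.1 _ hz.2 u hu, vecCons_split]) (vecCons_mem ht hx) c
  unfold totalD
  refine ⟨?_, fun i => ?_⟩
  · rw [h0, h1, pd_zero_split hf hI hU ht hx]; ring
  · rw [h0, h1, pd_succ_split hf hI hU ht hx]; ring

namespace IsProjectable

variable {X : PointField (Fin (n + 1))} {τ : ℝ → ℝ} {ξ : ℝ → (Fin n → ℝ) → Fin n → ℝ}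
  {t : ℝ} {x : Fin n → ℝ} {u : ℝ}

theorem totalD_time (hX : IsProjectable I U J X τ ξ) (hI : IsOpen I) (hU : IsOpen U)
    (hJ : IsOpen J) (ht : t ∈ I) (hx : x ∈ U) (hu : u ∈ J) (p : Fin (n + 1) → ℝ) :
    totalD 0 (X.ξ 0) (Matrix.vecCons t x) u p = deriv τ t ∧
    ∀ i : Fin n, totalD i.succ (X.ξ 0) (Matrix.vecCons t x) u p = 0 := by
  have h := totalD_of_split (f := fun t _ => τ t) hI hU hJ
    (hX.smooth_time.comp contDiffOn_fst fun _ hw => hw.1) hX.time ht hx hu p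
  refine ⟨h.1, fun i => ?_⟩
  rw [h.2 i, pd_const]

theorem totalD_space (hX : IsProjectable I U J X τ ξ) (hI : IsOpen I) (hU : IsOpen U)
    (hJ : IsOpen J) (ht : t ∈ I) (hx : x ∈ U) (hu : u ∈ J) (p : Fin (n + 1) → ℝ) (k : Fin n) :
    totalD 0 (X.ξ k.succ) (Matrix.vecCons t x) u p = deriv (fun s => ξ s x k) t ∧
    ∀ i : Fin n, totalD i.succ (X.ξ k.succ) (Matrix.vecCons t x) u p
      = pd i (fun y => ξ t y k) x :=
  totalD_of_split (f := fun t x => ξ t x k) hI hU hJ (hX.smooth_space k)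
    (fun t ht x hx u hu => hX.space t ht x hx u hu k) ht hx hu p

theorem η₁_zero (hX : IsProjectable I U J X τ ξ) (hI : IsOpen I) (hU : IsOpen U)
    (hJ : IsOpen J) (ht : t ∈ I) (hx : x ∈ U) (hu : u ∈ J) (p : Fin (n + 1) → ℝ) :
    X.η₁ 0 (Matrix.vecCons t x) u p
      = pd 0 (fun z => X.η z u) (Matrix.vecCons t x) + p 0 * deriv (X.η (Matrix.vecCons t x)) u
        - p 0 * deriv τ t - ∑ k : Fin n, p k.succ * deriv (fun s => ξ s x k) t := by
  unfold PointField.η₁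
  rw [Fin.sum_univ_succ, (hX.totalD_time hI hU hJ ht hx hu p).1]
  simp only [(hX.totalD_space hI hU hJ ht hx hu p _).1]
  unfold totalD
  ring

theorem η₁_succ (hX : IsProjectable I U J X τ ξ) (hI : IsOpen I) (hU : IsOpen U)
    (hJ : IsOpen J) (ht : t ∈ I) (hx : x ∈ U) (hu : u ∈ J) (p : Fin (n + 1) → ℝ) (i : Fin n) :
    X.η₁ i.succ (Matrix.vecCons t x) u p
      = pd i.succ (fun z => X.η z u) (Matrix.vecCons t x)
        + p i.succ * deriv (X.η (Matrix.vecCons t x)) u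
        - ∑ k : Fin n, p k.succ * pd i (fun y => ξ t y k) x := by
  unfold PointField.η₁
  rw [Fin.sum_univ_succ, (hX.totalD_time hI hU hJ ht hx hu p).2]
  simp only [(hX.totalD_space hI hU hJ ht hx hu p _).2]
  unfold totalD
  ring

theorem η₂free_succ (hX : IsProjectable I U J X τ ξ) (hI : IsOpen I) (hU : IsOpen U)
    (hJ : IsOpen J) (ht : t ∈ I) (hx : x ∈ U) (hu : u ∈ J) (p : Fin (n + 1) → ℝ) (i j : Fin n) :
    X.η₂free i.succ j.succ (Matrix.vecCons t x) u p
      = pd j.succ (pd i.succ (fun z => X.η z u)) (Matrix.vecCons t x)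
        + p i.succ * pd j.succ (fun z => deriv (X.η z) u) (Matrix.vecCons t x)
        - ∑ k : Fin n, p k.succ * pd j (pd i (fun y => ξ t y k)) x
        + p j.succ * (deriv (fun v => pd i.succ (fun z => X.η z v) (Matrix.vecCons t x)) u
          + p i.succ * deriv (deriv (X.η (Matrix.vecCons t x))) u) := by
  have hD := isOpen_spaceTime hI hU
  have hz := vecCons_mem ht hx
  unfold PointField.η₂free
  congr 1
  · have e : ∀ z ∈ spaceTime I U, X.η₁ i.succ z u p
        = pd i.succ (fun z => X.η z u) z + p i.succ * deriv (X.η z) u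
          - ∑ k : Fin n, p k.succ * pd i (fun y => ξ (z 0) y k) (Matrix.vecTail z) := by
      intro z hz
      rw [← vecCons_split z]
      exact hX.η₁_succ hI hU hJ hz.1 hz.2 hu p i
    have h1 : ContDiffOn ℝ ∞ (pd i.succ fun z => X.η z u) (spaceTime I U) :=
      contDiffOn_pd (contDiffOn_slice_left hX.smooth_η hu) hD _
    have h2 : ContDiffOn ℝ ∞ (fun z => deriv (X.η z) u) (spaceTime I U) :=
      contDiffOn_slice_left (f := fun z u => deriv (X.η z) u)
        (contDiffOn_du hX.smooth_η hD hJ) hu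
    have h3 : ∀ k : Fin n, ContDiffOn ℝ ∞
        (fun w : ℝ × (Fin n → ℝ) => pd i (fun y => ξ w.1 y k) w.2) (I ×ˢ U) := fun k =>
      contDiffOn_dx (f := fun t y => ξ t y k) (hX.smooth_space k) hI hU i
    have h4 : ∀ k : Fin n, DifferentiableAt ℝ
        (fun z : Fin (n + 1) → ℝ => pd i (fun y => ξ (z 0) y k) (Matrix.vecTail z))
        (Matrix.vecCons t x) := fun k =>
      (contDiffOn_split (f := fun t x => pd i (fun y => ξ t y k) x) (h3 k)).diffAt hD hz
    have h4' : ∀ k : Fin n, DifferentiableAt ℝ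
        (fun z : Fin (n + 1) → ℝ => p k.succ * pd i (fun y => ξ (z 0) y k) (Matrix.vecTail z))
        (Matrix.vecCons t x) := fun k => (h4 k).const_mul _
    have h5 : ∀ k : Fin n, pd j.succ (fun z : Fin (n + 1) → ℝ =>
        pd i (fun y => ξ (z 0) y k) (Matrix.vecTail z)) (Matrix.vecCons t x)
        = pd j (pd i (fun y => ξ t y k)) x := fun k =>
      pd_succ_split (f := fun t x => pd i (fun y => ξ t y k) x) (h3 k) hI hU ht hx j
    have d1 := h1.diffAt hD hz
    have d2 := h2.diffAt hD hz
    rw [pd_congr_on hD e hz, pd_sub (d1.fun_add (d2.const_mul _))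
      (DifferentiableAt.fun_sum fun k _ => h4' k), pd_add d1 (d2.const_mul _), pd_const_mul d2,
      pd_sum fun k _ => h4' k]
    congr 1
    exact Finset.sum_congr rfl fun k _ => by rw [pd_const_mul (h4 k), h5]
  · congr 1
    have e : (fun v => X.η₁ i.succ (Matrix.vecCons t x) v p) =ᶠ[𝓝 u] fun v =>
        pd i.succ (fun z => X.η z v) (Matrix.vecCons t x)
          + p i.succ * deriv (X.η (Matrix.vecCons t x)) v
          - ∑ k : Fin n, p k.succ * pd i (fun y => ξ t y k) x := by
      filter_upwards [hJ.mem_nhds hu] with v hv using hX.η₁_succ hI hU hJ ht hx hv p i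
    have d1 : DifferentiableAt ℝ
        (fun v => pd i.succ (fun z => X.η z v) (Matrix.vecCons t x)) u :=
      (contDiffOn_slice_right (f := fun z v => pd i.succ (fun z' => X.η z' v) z)
        (contDiffOn_pd_left hX.smooth_η hD hJ i.succ) hz).diffAt hJ hu
    have d2 : DifferentiableAt ℝ (deriv (X.η (Matrix.vecCons t x))) u :=
      (contDiffOn_deriv (contDiffOn_slice_right hX.smooth_η hz) hJ).diffAt hJ hu
    rw [e.deriv_eq, deriv_sub_const, deriv_fun_add d1 (d2.const_mul _), deriv_const_mul _ d2]

/-- Sorting of the prolongation condition by powers of the derivatives of `u`. -/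
theorem sort_prolongation {A : Fin n → Fin n → ℝ} {dA ddξ : Fin n → Fin n → Fin n → ℝ}
    {Γ ξ ξt e f η₁ p : Fin n → ℝ} {dΓ dξ η₂ r : Fin n → Fin n → ℝ} {a c w : ℝ}
    (hA : ∀ i j, A i j = A j i)
    (hL : ∀ k l, ∑ m, (ξ m * dA m k l - A m l * dξ m k - A k m * dξ m l) = -c * A k l)
    (hΓ : ∀ k, ∑ m, ξ m * dΓ m k - ∑ m, Γ m * dξ m k + ∑ i, ∑ j, A i j * ddξ j i k
      + c * Γ k = 0) :
    ∑ i, ∑ j, (∑ k, ξ k * dA k i j) * r i j - ∑ i, (∑ k, ξ k * dΓ k i) * p i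
        - ∑ i, Γ i * (η₁ i + p i * a - ∑ k, p k * dξ i k) + ∑ k, p k * ξt k
        + ∑ i, ∑ j, A i j * (η₂ i j + p i * e j - ∑ k, p k * ddξ j i k + p j * (f i + p i * w)
          + (a * r i j - ∑ m, (r m j * dξ i m + r i m * dξ j m)))
        - (a - c) * (∑ i, ∑ j, A i j * r i j - ∑ i, Γ i * p i)
      = ∑ k, p k * (ξt k + ∑ i, A k i * (e i + f i)) + w * ∑ i, ∑ j, A i j * (p i * p j)
        + (∑ i, ∑ j, A i j * η₂ i j - ∑ i, Γ i * η₁ i) := by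
  -- Terms in the second derivatives: the Lie derivative of the inverse metric assembles here and is
  -- a multiple of it by `hL`.
  have R1 : ∑ i, ∑ j, (∑ k, ξ k * dA k i j) * r i j
      - ∑ i, ∑ j, A i j * ∑ m, (r m j * dξ i m + r i m * dξ j m)
      = -c * ∑ i, ∑ j, A i j * r i j := by
    have s1 : ∑ i, ∑ j, A i j * ∑ m, (r m j * dξ i m + r i m * dξ j m)
        = ∑ i, ∑ j, ∑ m, (A m j * dξ m i * r i j + A i m * dξ m j * r i j) := by
      simp only [Finset.sum_add_distrib, mul_add, Finset.mul_sum]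
      rw [sum_swap₁₃ fun i j m => A i j * (r m j * dξ i m),
        sum_swap₂₃ fun i j m => A i j * (r i m * dξ j m)]
      simp only [← Finset.sum_add_distrib]
      exact Finset.sum_congr rfl fun i _ => Finset.sum_congr rfl fun j _ =>
        Finset.sum_congr rfl fun m _ => by ring
    rw [s1]
    simp only [← Finset.sum_sub_distrib, Finset.mul_sum]
    refine Finset.sum_congr rfl fun i _ => Finset.sum_congr rfl fun j _ => ?_
    rw [← mul_assoc, ← hL i j, Finset.sum_mul, Finset.sum_mul, ← Finset.sum_sub_distrib]
    exact Finset.sum_congr rfl fun m _ => by ring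
  -- Terms linear in the first derivatives that involve only the geometry: `hΓ` turns them into a
  -- multiple of `Γ^i u_i`.
  have R2 : ∑ i, (∑ k, ξ k * dΓ k i) * p i - ∑ i, Γ i * ∑ k, p k * dξ i k
      + ∑ i, ∑ j, A i j * ∑ k, p k * ddξ j i k = -c * ∑ i, Γ i * p i := by
    have s1 : ∑ i, Γ i * ∑ k, p k * dξ i k = ∑ k, (∑ i, Γ i * dξ i k) * p k := by
      simp only [Finset.mul_sum, Finset.sum_mul]
      rw [Finset.sum_comm]
      exact Finset.sum_congr rfl fun k _ => Finset.sum_congr rfl fun i _ => by ring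
    have s2 : ∑ i, ∑ j, A i j * ∑ k, p k * ddξ j i k
        = ∑ k, (∑ i, ∑ j, A i j * ddξ j i k) * p k := by
      simp only [Finset.mul_sum, Finset.sum_mul]
      conv_rhs => rw [Finset.sum_comm]
      refine Finset.sum_congr rfl fun i _ => ?_
      rw [Finset.sum_comm]
      exact Finset.sum_congr rfl fun k _ => Finset.sum_congr rfl fun j _ => by ring
    rw [s1, s2, ← Finset.sum_sub_distrib, ← Finset.sum_add_distrib, Finset.mul_sum]
    refine Finset.sum_congr rfl fun k _ => ?_
    linear_combination p k * hΓ k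
  have R3 : ∑ i, ∑ j, A i j * (p i * e j) + ∑ i, ∑ j, A i j * (p j * f i)
      = ∑ k, p k * ∑ i, A k i * (e i + f i) := by
    rw [Finset.sum_comm (f := fun i j => A i j * (p j * f i)), ← Finset.sum_add_distrib]
    refine Finset.sum_congr rfl fun i _ => ?_
    rw [← Finset.sum_add_distrib, Finset.mul_sum]
    refine Finset.sum_congr rfl fun j _ => ?_
    rw [hA j i]
    ring
  have R4 : ∑ i, ∑ j, A i j * (η₂ i j + p i * e j - ∑ k, p k * ddξ j i k + p j * (f i + p i * w)
          + (a * r i j - ∑ m, (r m j * dξ i m + r i m * dξ j m)))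
      = ∑ i, ∑ j, A i j * η₂ i j + ∑ i, ∑ j, A i j * (p i * e j)
        - ∑ i, ∑ j, A i j * ∑ k, p k * ddξ j i k + ∑ i, ∑ j, A i j * (p j * f i)
        + w * ∑ i, ∑ j, A i j * (p i * p j) + a * ∑ i, ∑ j, A i j * r i j
        - ∑ i, ∑ j, A i j * ∑ m, (r m j * dξ i m + r i m * dξ j m) := by
    rw [Finset.mul_sum, Finset.mul_sum]
    simp only [Finset.mul_sum (a := w), Finset.mul_sum (a := a), ← Finset.sum_add_distrib,
      ← Finset.sum_sub_distrib]
    exact Finset.sum_congr rfl fun i _ => Finset.sum_congr rfl fun j _ => by ring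
  have R5 : ∑ i, Γ i * (η₁ i + p i * a - ∑ k, p k * dξ i k)
      = ∑ i, Γ i * η₁ i + a * ∑ i, Γ i * p i - ∑ i, Γ i * ∑ k, p k * dξ i k := by
    rw [Finset.mul_sum, ← Finset.sum_add_distrib, ← Finset.sum_sub_distrib]
    exact Finset.sum_congr rfl fun i _ => by ring
  have R6 : ∑ k, p k * (ξt k + ∑ i, A k i * (e i + f i))
      = ∑ k, p k * ξt k + ∑ k, p k * ∑ i, A k i * (e i + f i) := by
    simp only [mul_add, Finset.sum_add_distrib]
  rw [R4, R5, R6, ← R3]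
  linear_combination R1 - R2

/-- The prolongation condition for a projectable field, sorted by powers of the derivatives. -/
theorem prolong_sub (hX : IsProjectable I U J X τ ξ) (hI : IsOpen I) (hU : IsOpen U)
    (hJ : IsOpen J) (hg : IsMetricOn g U)
    (hq : ContDiffOn ℝ ∞ (fun w : ℝ × (Fin n → ℝ) × ℝ => q w.1 w.2.1 w.2.2) (I ×ˢ (U ×ˢ J)))
    (ht : t ∈ I) (hx : x ∈ U) (hu : u ∈ J) (hξ : IsHomothetic g U (ξ t) (deriv τ t / 2))
    (p : Fin (n + 1) → ℝ) (r : Fin (n + 1) → Fin (n + 1) → ℝ) :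
    X.prolong₂ (heatEq g q) (Matrix.vecCons t x) u p r
        - (deriv (X.η (Matrix.vecCons t x)) u - deriv τ t) * heatEq g q (Matrix.vecCons t x) u p r
      = ∑ k : Fin n, p k.succ * (deriv (fun s => ξ s x k) t
          + ∑ i : Fin n, (g x)⁻¹ k i * (pd i.succ (fun z => deriv (X.η z) u) (Matrix.vecCons t x)
            + deriv (fun v => pd i.succ (fun z => X.η z v) (Matrix.vecCons t x)) u))
        + deriv (deriv (X.η (Matrix.vecCons t x))) u
          * ∑ i : Fin n, ∑ j : Fin n, (g x)⁻¹ i j * (p i.succ * p j.succ)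
        + (∑ i : Fin n, ∑ j : Fin n, (g x)⁻¹ i j *
              pd j.succ (pd i.succ (fun z => X.η z u)) (Matrix.vecCons t x)
          - ∑ i : Fin n, contractedGamma g i x * pd i.succ (fun z => X.η z u) (Matrix.vecCons t x)
          - pd 0 (fun z => X.η z u) (Matrix.vecCons t x)
          - X.η (Matrix.vecCons t x) u * deriv (q t x) u
          + deriv (X.η (Matrix.vecCons t x)) u * q t x u - deriv τ t * q t x u
          - τ t * deriv (fun s => q s x u) t
          - ∑ k : Fin n, ξ t x k * pd k (fun y => q t y u) x) := by
  have hL := (hg.lieMetric_eq_iff hU hx (ξ t) (2 * (deriv τ t / 2))).1 (hξ.2 x hx)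
  have hΓ : ∀ k, ∑ m, ξ t x m * pd m (contractedGamma g k) x
      - ∑ m, contractedGamma g m x * pd m (fun y => ξ t y k) x
      + ∑ i, ∑ j, (g x)⁻¹ i j * pd j (pd i (fun y => ξ t y k)) x
      + deriv τ t * contractedGamma g k x = 0 := by
    intro k
    rw [← hξ.lie_contractedGamma hg hU hx k, mul_div_cancel₀ _ two_ne_zero]
    simp only [pd_comm (hξ.smooth k) hU hx]
  rw [mul_div_cancel₀ _ two_ne_zero] at hL
  have hz := vecCons_mem (I := I) ht hx
  have hξu : ∀ c, deriv (X.ξ c (Matrix.vecCons t x)) u = 0 := by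
    intro c
    refine (EventuallyEq.deriv_eq (f := fun _ => X.ξ c (Matrix.vecCons t x) u) ?_).trans
      (deriv_const _ _)
    filter_upwards [hJ.mem_nhds hu] with v hv
    refine Fin.cases ?_ (fun i => ?_) c
    · rw [hX.time t ht x hx u hu, hX.time t ht x hx v hv]
    · rw [hX.space t ht x hx u hu, hX.space t ht x hx v hv]
  -- `e` and `f` are the mixed derivatives of `η` in `u` and `x^i` taken in the two orders. They are
  -- carried separately here and need not be identified.
  have key := sort_prolongation (A := fun i j => (g x)⁻¹ i j)
    (dA := fun m i j => pd m (fun y => (g y)⁻¹ i j) x)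
    (ddξ := fun j i k => pd j (pd i (fun y => ξ t y k)) x)
    (Γ := fun i => contractedGamma g i x) (ξ := ξ t x) (ξt := fun k => deriv (fun s => ξ s x k) t)
    (e := fun j => pd j.succ (fun z => deriv (X.η z) u) (Matrix.vecCons t x))
    (f := fun i => deriv (fun v => pd i.succ (fun z => X.η z v) (Matrix.vecCons t x)) u)
    (η₁ := fun i => pd i.succ (fun z => X.η z u) (Matrix.vecCons t x))
    (p := fun i => p i.succ) (dΓ := fun m k => pd m (contractedGamma g k) x)
    (dξ := fun i k => pd i (fun y => ξ t y k) x)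
    (η₂ := fun i j => pd j.succ (pd i.succ (fun z => X.η z u)) (Matrix.vecCons t x))
    (r := fun i j => r i.succ j.succ) (a := deriv (X.η (Matrix.vecCons t x)) u)
    (c := deriv τ t) (w := deriv (deriv (X.η (Matrix.vecCons t x))) u)
    (hg.inv_symm_apply hx) hL hΓ
  rw [prolong_heatEq hI hU hg hq X ht hx hu]
  simp only [X.η₂_eq, hX.η₁_zero hI hU hJ ht hx hu, hX.η₁_succ hI hU hJ ht hx hu,
    hX.η₂free_succ hI hU hJ ht hx hu, heatEq, tail_vecCons, Matrix.cons_val_zero, hξu, mul_zero,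
    Finset.sum_const_zero, sub_zero, Fin.sum_univ_succ (n := n),
    (hX.totalD_time hI hU hJ ht hx hu p).2, (hX.totalD_space hI hU hJ ht hx hu p _).2,
    hX.time t ht x hx u hu, hX.space t ht x hx u hu, add_zero, zero_add]
  linear_combination key

end IsProjectable

end Projectable

end HeatFlux

namespace HeatFlux

open Filter Topology

/-! ### Vertical components affine in `u`, and the determining equations for `a` and `b` -/

section Affine

variable {n : ℕ} {g : (Fin n → ℝ) → Matrix (Fin n) (Fin n) ℝ} {I J : Set ℝ}
  {U : Set (Fin n → ℝ)} {q : ℝ → (Fin n → ℝ) → ℝ → ℝ}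

theorem pd_succ_join {F : (Fin (n + 1) → ℝ) → ℝ} (hF : ContDiffOn ℝ ∞ F (spaceTime I U))
    (hI : IsOpen I) (hU : IsOpen U) {t : ℝ} (ht : t ∈ I) {x : Fin n → ℝ} (hx : x ∈ U)
    (i : Fin n) :
    pd i.succ F (Matrix.vecCons t x) = pd i (fun y => F (Matrix.vecCons t y)) x := by
  rw [← pd_succ_split (f := fun t y => F (Matrix.vecCons t y)) (contDiffOn_join hF) hI hU ht hx]
  simp only [vecCons_split]

theorem pd_zero_join {F : (Fin (n + 1) → ℝ) → ℝ} (hF : ContDiffOn ℝ ∞ F (spaceTime I U))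
    (hI : IsOpen I) (hU : IsOpen U) {t : ℝ} (ht : t ∈ I) {x : Fin n → ℝ} (hx : x ∈ U) :
    pd 0 F (Matrix.vecCons t x) = deriv (fun s => F (Matrix.vecCons s x)) t := by
  rw [← pd_zero_split (f := fun t y => F (Matrix.vecCons t y)) (contDiffOn_join hF) hI hU ht hx]
  simp only [vecCons_split]

theorem linear_coefficients {L : Fin n → ℝ} {C : ℝ}
    (h : ∀ p : Fin n → ℝ, ∑ k, p k * L k + C = 0) (k : Fin n) : L k = 0 := by
  have h0 : C = 0 := by simpa using h 0
  simpa [h0, Pi.single_apply] using h (Pi.single k 1)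

theorem quadratic_coefficients {L : Fin n → ℝ} {A : Fin n → Fin n → ℝ} {w C : ℝ}
    (hA : ∀ i j, A i j = A j i)
    (h : ∀ p : Fin n → ℝ, ∑ k, p k * L k + w * ∑ i, ∑ j, A i j * (p i * p j) + C = 0)
    (k l : Fin n) : w * A k l = 0 := by
  have h0 : C = 0 := by simpa using h 0
  subst h0
  -- Averaging the values at `p` and `-p` removes the linear part.
  have hQ : ∀ p : Fin n → ℝ, w * ∑ i, ∑ j, A i j * (p i * p j) = 0 := by
    intro p
    have h1 := h p
    have h2 := h (-p)
    simp only [Pi.neg_apply, neg_mul, mul_neg, neg_neg, Finset.sum_neg_distrib] at h2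
    linarith
  rcases eq_or_ne w 0 with rfl | hw
  · rw [zero_mul]
  have h1 := hQ (Pi.single k 1)
  have h2 := hQ (Pi.single l 1)
  -- Polarisation: the value at the sum of two basis vectors yields the off-diagonal coefficient.
  have h3 := hQ fun i => (Pi.single k 1 : Fin n → ℝ) i + (Pi.single l 1 : Fin n → ℝ) i
  simp [mul_add, Finset.sum_add_distrib, Pi.single_apply, hw] at h1 h2 h3
  rw [h1, h2, hA l k] at h3
  linarith

variable {X : PointField (Fin (n + 1))} {τ : ℝ → ℝ} {ξ : ℝ → (Fin n → ℝ) → Fin n → ℝ}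
  {a b : ℝ → (Fin n → ℝ) → ℝ}

theorem HasComponents.isProjectable (hX : HasComponents I U J X τ ξ a b)
    (hτ : ContDiffOn ℝ ∞ τ I)
    (hξ : ∀ i : Fin n, ContDiffOn ℝ ∞ (fun w : ℝ × (Fin n → ℝ) => ξ w.1 w.2 i) (I ×ˢ U))
    (ha : ContDiffOn ℝ ∞ (fun w : ℝ × (Fin n → ℝ) => a w.1 w.2) (I ×ˢ U))
    (hb : ContDiffOn ℝ ∞ (fun w : ℝ × (Fin n → ℝ) => b w.1 w.2) (I ×ˢ U)) :
    IsProjectable I U J X τ ξ where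
  time t ht x hx u hu := (hX t ht x hx u hu).1
  space t ht x hx u hu := (hX t ht x hx u hu).2.1
  smooth_time := hτ
  smooth_space := hξ
  smooth_η := by
    have h1 : ContDiffOn ℝ ∞ (fun w : (Fin (n + 1) → ℝ) × ℝ =>
        a (w.1 0) (Matrix.vecTail w.1) * w.2 + b (w.1 0) (Matrix.vecTail w.1))
        (spaceTime I U ×ˢ J) :=
      (((contDiffOn_split ha).comp contDiffOn_fst fun _ hw => hw.1).mul contDiffOn_snd).add
        ((contDiffOn_split hb).comp contDiffOn_fst fun _ hw => hw.1)
    refine h1.congr fun w hw => ?_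
    have := (hX _ hw.1.1 _ hw.1.2 _ hw.2).2.2
    rwa [vecCons_split] at this

theorem HasComponents.smooth (hX : HasComponents I U J X τ ξ a b)
    (hτ : ContDiffOn ℝ ∞ τ I)
    (hξ : ∀ i : Fin n, ContDiffOn ℝ ∞ (fun w : ℝ × (Fin n → ℝ) => ξ w.1 w.2 i) (I ×ˢ U))
    (c : Fin (n + 1)) :
    ContDiffOn ℝ ∞ (fun w : (Fin (n + 1) → ℝ) × ℝ => X.ξ c w.1 w.2) (spaceTime I U ×ˢ J) := by
  refine Fin.cases ?_ (fun i => ?_) c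
  · have h1 : ContDiffOn ℝ ∞ (fun w : (Fin (n + 1) → ℝ) × ℝ => τ (w.1 0))
        (spaceTime I U ×ˢ J) :=
      hτ.comp (f := fun w : (Fin (n + 1) → ℝ) × ℝ => w.1 0) (by fun_prop) fun _ hw => hw.1.1
    refine h1.congr fun w hw => ?_
    have := (hX _ hw.1.1 _ hw.1.2 _ hw.2).1
    rwa [vecCons_split] at this
  · have h1 : ContDiffOn ℝ ∞ (fun w : (Fin (n + 1) → ℝ) × ℝ =>
        ξ (w.1 0) (Matrix.vecTail w.1) i) (spaceTime I U ×ˢ J) :=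
      (contDiffOn_split (f := fun t x => ξ t x i) (hξ i)).comp contDiffOn_fst fun _ hw => hw.1
    refine h1.congr fun w hw => ?_
    have := (hX _ hw.1.1 _ hw.1.2 _ hw.2).2.1 i
    rwa [vecCons_split] at this

/-- The prolongation condition for `X = τ ∂_t + ξ^i ∂_i + (a u + b) ∂_u`. -/
theorem HasComponents.prolong_sub (hX : HasComponents I U J X τ ξ a b)
    (hI : IsOpen I) (hU : IsOpen U) (hJ : IsOpen J) (hg : IsMetricOn g U)
    (hq : ContDiffOn ℝ ∞ (fun w : ℝ × (Fin n → ℝ) × ℝ => q w.1 w.2.1 w.2.2) (I ×ˢ (U ×ˢ J)))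
    (hτ : ContDiffOn ℝ ∞ τ I)
    (hξ : ∀ i : Fin n, ContDiffOn ℝ ∞ (fun w : ℝ × (Fin n → ℝ) => ξ w.1 w.2 i) (I ×ˢ U))
    (ha : ContDiffOn ℝ ∞ (fun w : ℝ × (Fin n → ℝ) => a w.1 w.2) (I ×ˢ U))
    (hb : ContDiffOn ℝ ∞ (fun w : ℝ × (Fin n → ℝ) => b w.1 w.2) (I ×ˢ U))
    {t : ℝ} (ht : t ∈ I) {x : Fin n → ℝ} (hx : x ∈ U) {u : ℝ} (hu : u ∈ J)
    (hL : IsHomothetic g U (ξ t) (deriv τ t / 2))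
    (p : Fin (n + 1) → ℝ) (r : Fin (n + 1) → Fin (n + 1) → ℝ) :
    X.prolong₂ (heatEq g q) (Matrix.vecCons t x) u p r
        - (a t x - deriv τ t) * heatEq g q (Matrix.vecCons t x) u p r
      = ∑ k : Fin n, p k.succ * (deriv (fun s => ξ s x k) t + 2 * grad g (a t) x k)
        + ((laplacian g (a t) x - deriv (fun s => a s x) t) * u + heatOp g b t x
          - (a t x * u + b t x) * deriv (q t x) u + a t x * q t x u
          - deriv (fun s => τ s * q s x u) t
          - ∑ k : Fin n, pd k (fun y => q t y u) x * ξ t x k) := by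
  have hP := hX.isProjectable hτ hξ ha hb
  have hD := isOpen_spaceTime hI hU
  have hz := vecCons_mem (I := I) ht hx
  have hat := fun t (ht : t ∈ I) => contDiffOn_slice_right ha ht
  have hbt := fun t (ht : t ∈ I) => contDiffOn_slice_right hb ht
  have hηu : ∀ t ∈ I, ∀ x ∈ U, ∀ u ∈ J, deriv (X.η (Matrix.vecCons t x)) u = a t x := by
    intro t ht x hx u hu
    have e : X.η (Matrix.vecCons t x) =ᶠ[𝓝 u] fun v => a t x * v + b t x := by
      filter_upwards [hJ.mem_nhds hu] with v hv using (hX t ht x hx v hv).2.2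
    rw [e.deriv_eq]
    simp
  have hηuu : deriv (deriv (X.η (Matrix.vecCons t x))) u = 0 := by
    have e : deriv (X.η (Matrix.vecCons t x)) =ᶠ[𝓝 u] fun _ => a t x := by
      filter_upwards [hJ.mem_nhds hu] with v hv using hηu t ht x hx v hv
    rw [e.deriv_eq, deriv_const]
  have hηi : ∀ t ∈ I, ∀ x ∈ U, ∀ u ∈ J, ∀ i : Fin n,
      pd i.succ (fun z => X.η z u) (Matrix.vecCons t x) = pd i (a t) x * u + pd i (b t) x := by
    intro t ht x hx u hu i
    rw [pd_succ_join (contDiffOn_slice_left hP.smooth_η hu) hI hU ht hx,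
      pd_congr_on hU (fun y hy => (hX t ht y hy u hu).2.2) hx,
      pd_add (((hat t ht).diffAt hU hx).mul_const u) ((hbt t ht).diffAt hU hx),
      pd_mul_const ((hat t ht).diffAt hU hx)]
  have hηt : pd 0 (fun z => X.η z u) (Matrix.vecCons t x)
      = deriv (fun s => a s x) t * u + deriv (fun s => b s x) t := by
    rw [pd_zero_join (contDiffOn_slice_left hP.smooth_η hu) hI hU ht hx]
    have e : (fun s => X.η (Matrix.vecCons s x) u) =ᶠ[𝓝 t] fun s => a s x * u + b s x := by
      filter_upwards [hI.mem_nhds ht] with s hs using (hX s hs x hx u hu).2.2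
    have d1 := (contDiffOn_slice_left ha hx).diffAt hI ht
    have d2 := (contDiffOn_slice_left hb hx).diffAt hI ht
    rw [e.deriv_eq, deriv_fun_add (d1.mul_const u) d2, deriv_mul_const d1]
  have hηij : ∀ i j : Fin n, pd j.succ (pd i.succ fun z => X.η z u) (Matrix.vecCons t x)
      = pd j (pd i (a t)) x * u + pd j (pd i (b t)) x := by
    intro i j
    have d1 := (contDiffOn_pd (hat t ht) hU i).diffAt hU hx
    have d2 := (contDiffOn_pd (hbt t ht) hU i).diffAt hU hx
    rw [pd_succ_join (contDiffOn_pd (contDiffOn_slice_left hP.smooth_η hu) hD _) hI hU ht hx,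
      pd_congr_on hU (fun y hy => hηi t ht y hy u hu i) hx,
      pd_add (d1.mul_const u) d2, pd_mul_const d1]
  have hηui : ∀ i : Fin n, pd i.succ (fun z => deriv (X.η z) u) (Matrix.vecCons t x)
      = pd i (a t) x := by
    intro i
    rw [pd_succ_join (contDiffOn_slice_left (f := fun z u => deriv (X.η z) u)
        (contDiffOn_du hP.smooth_η hD hJ) hu) hI hU ht hx,
      pd_congr_on hU (fun y hy => hηu t ht y hy u hu) hx]
  have hηiu : ∀ i : Fin n, deriv (fun v => pd i.succ (fun z => X.η z v) (Matrix.vecCons t x)) u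
      = pd i (a t) x := by
    intro i
    have e : (fun v => pd i.succ (fun z => X.η z v) (Matrix.vecCons t x)) =ᶠ[𝓝 u]
        fun v => pd i (a t) x * v + pd i (b t) x := by
      filter_upwards [hJ.mem_nhds hu] with v hv using hηi t ht x hx v hv i
    rw [e.deriv_eq]
    simp
  have h := hP.prolong_sub hI hU hJ hg hq ht hx hu hL p r
  simp only [hηu t ht x hx u hu, hηuu, hηi t ht x hx u hu, hηt, hηij, hηui, hηiu,
    (hX t ht x hx u hu).2.2, zero_mul, add_zero] at h
  rw [h]
  have dq : DifferentiableAt ℝ (fun s => q s x u) t :=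
    (contDiffOn_slice_left (f := fun t x => q t x u) (contDiffOn_flux hq hu) hx).diffAt hI ht
  rw [deriv_fun_mul (hτ.diffAt hI ht) dq]
  have e1 : ∀ k, ∑ i, (g x)⁻¹ k i * (pd i (a t) x + pd i (a t) x) = 2 * grad g (a t) x k := by
    intro k
    unfold grad
    rw [Finset.mul_sum]
    exact Finset.sum_congr rfl fun i _ => by ring
  have e2 : ∑ k : Fin n, pd k (fun y => q t y u) x * ξ t x k
      = ∑ k : Fin n, ξ t x k * pd k (fun y => q t y u) x :=
    Finset.sum_congr rfl fun k _ => mul_comm _ _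
  have e3 : ∑ i, ∑ j, (g x)⁻¹ i j * (pd j (pd i (a t)) x * u + pd j (pd i (b t)) x)
      = (∑ i, ∑ j, (g x)⁻¹ i j * pd j (pd i (a t)) x) * u
        + ∑ i, ∑ j, (g x)⁻¹ i j * pd j (pd i (b t)) x := by
    simp only [mul_add, Finset.sum_add_distrib, Finset.sum_mul, mul_assoc]
  have e4 : ∑ i, contractedGamma g i x * (pd i (a t) x * u + pd i (b t) x)
      = (∑ i, contractedGamma g i x * pd i (a t) x) * u
        + ∑ i, contractedGamma g i x * pd i (b t) x := by
    simp only [mul_add, Finset.sum_add_distrib, Finset.sum_mul, mul_assoc]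
  simp only [e1]
  rw [e2, e3, e4]
  unfold laplacian heatOp
  ring

/-- Under `hgrad` the terms linear in `u_k` vanish, so `X^{[2]} G - (a - τ_{,t}) G` is free of all
jet variables and equals the constraint expression. -/
theorem HasComponents.isLieSymmetry_iff (hX : HasComponents I U J X τ ξ a b)
    (hI : IsOpen I) (hU : IsOpen U) (hJ : IsOpen J) (hg : IsMetricOn g U)
    (hq : ContDiffOn ℝ ∞ (fun w : ℝ × (Fin n → ℝ) × ℝ => q w.1 w.2.1 w.2.2) (I ×ˢ (U ×ˢ J)))
    (hτ : ContDiffOn ℝ ∞ τ I)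
    (hξ : ∀ i : Fin n, ContDiffOn ℝ ∞ (fun w : ℝ × (Fin n → ℝ) => ξ w.1 w.2 i) (I ×ˢ U))
    (ha : ContDiffOn ℝ ∞ (fun w : ℝ × (Fin n → ℝ) => a w.1 w.2) (I ×ˢ U))
    (hb : ContDiffOn ℝ ∞ (fun w : ℝ × (Fin n → ℝ) => b w.1 w.2) (I ×ˢ U))
    (hL : ∀ t ∈ I, IsHomothetic g U (ξ t) (deriv τ t / 2))
    (hgrad : ∀ t ∈ I, ∀ x ∈ U, ∀ k, deriv (fun s => ξ s x k) t = -2 * grad g (a t) x k) :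
    IsLieSymmetry (spaceTime I U) J (heatEq g q) X ↔ ∀ t ∈ I, ∀ x ∈ U, ∀ u ∈ J,
      (laplacian g (a t) x - deriv (fun s => a s x) t) * u + heatOp g b t x
          - (a t x * u + b t x) * deriv (q t x) u + a t x * q t x u
          - deriv (fun s => τ s * q s x u) t
          - ∑ k : Fin n, pd k (fun y => q t y u) x * ξ t x k = 0 := by
  have hP := hX.isProjectable hτ hξ ha hb
  have key : ∀ t ∈ I, ∀ x ∈ U, ∀ u ∈ J, ∀ p r, X.prolong₂ (heatEq g q) (Matrix.vecCons t x) u p r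
        - (a t x - deriv τ t) * heatEq g q (Matrix.vecCons t x) u p r
      = (laplacian g (a t) x - deriv (fun s => a s x) t) * u + heatOp g b t x
          - (a t x * u + b t x) * deriv (q t x) u + a t x * q t x u
          - deriv (fun s => τ s * q s x u) t
          - ∑ k : Fin n, pd k (fun y => q t y u) x * ξ t x k := by
    intro t ht x hx u hu p r
    rw [hX.prolong_sub hI hU hJ hg hq hτ hξ ha hb ht hx hu (hL t ht)]
    simp [hgrad t ht x hx]
  constructor
  · rintro ⟨-, -, lam, hlam⟩ t ht x hx u hu
    -- At this jet, with `r = 0`, the equation `G = 0` holds, so the constraint follows whatever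
    -- `lam` is.
    set p : Fin (n + 1) → ℝ := Pi.single 0 (-q t x u) with hp
    have h0 : heatEq g q (Matrix.vecCons t x) u p 0 = 0 := by
      simp [heatEq, hp, Fin.succ_ne_zero]
    rw [← key t ht x hx u hu p 0, hlam _ (vecCons_mem ht hx) u hu p 0 (fun _ _ => rfl), h0]
    ring
  · intro h
    refine ⟨hX.smooth hτ hξ, hP.smooth_η,
      fun z _ _ => a (z 0) (Matrix.vecTail z) - deriv τ (z 0), fun z hz u hu p r _ => ?_⟩
    have h1 := key _ hz.1 _ hz.2 u hu p r
    rw [h _ hz.1 _ hz.2 u hu, vecCons_split] at h1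
    linarith

theorem exists_affine (hJ : IsOpen J) (hJ' : IsPreconnected J) {f : ℝ → ℝ}
    (hf : ContDiffOn ℝ ∞ f J) (h : ∀ u ∈ J, deriv (deriv f) u = 0) {u₀ u : ℝ} (hu₀ : u₀ ∈ J)
    (hu : u ∈ J) : f u = deriv f u₀ * u + (f u₀ - deriv f u₀ * u₀) := by
  have h1 : ∀ v ∈ J, deriv f v = deriv f u₀ := fun v hv =>
    const_of_deriv_eq_zero hJ hJ' (contDiffOn_deriv hf hJ) h hv hu₀
  have h2 := const_of_deriv_eq_zero (f := fun v => f v - deriv f u₀ * v) hJ hJ'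
    (hf.sub (contDiffOn_const.mul contDiffOn_id)) (fun v hv => by
      rw [deriv_fun_sub (hf.diffAt hJ hv) (by fun_prop), h1 v hv]
      simp) hu hu₀
  linarith

/-- Here all determining equations except the constraint are collected. Connectedness of `U` and `J`
turns vanishing derivatives into independence of `x` and `u`. -/
theorem IsLieSymmetry.exists_components (hn : 0 < n) (hI : IsOpen I)
    (hU : IsOpen U) (hU' : IsConnected U) (hJ : IsOpen J) (hJ' : IsConnected J)
    (hg : IsMetricOn g U)
    (hq : ContDiffOn ℝ ∞ (fun w : ℝ × (Fin n → ℝ) × ℝ => q w.1 w.2.1 w.2.2) (I ×ˢ (U ×ˢ J)))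
    (hX : IsLieSymmetry (spaceTime I U) J (heatEq g q) X) :
    ∃ (τ : ℝ → ℝ) (ξ : ℝ → (Fin n → ℝ) → Fin n → ℝ) (a b : ℝ → (Fin n → ℝ) → ℝ),
      HasComponents I U J X τ ξ a b ∧ ContDiffOn ℝ ∞ τ I ∧
      (∀ i : Fin n, ContDiffOn ℝ ∞ (fun w : ℝ × (Fin n → ℝ) => ξ w.1 w.2 i) (I ×ˢ U)) ∧
      ContDiffOn ℝ ∞ (fun w : ℝ × (Fin n → ℝ) => a w.1 w.2) (I ×ˢ U) ∧
      ContDiffOn ℝ ∞ (fun w : ℝ × (Fin n → ℝ) => b w.1 w.2) (I ×ˢ U) ∧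
      (∀ t ∈ I, IsHomothetic g U (ξ t) (deriv τ t / 2)) ∧
      ∀ t ∈ I, ∀ x ∈ U, ∀ k, deriv (fun s => ξ s x k) t = -2 * grad g (a t) x k := by
  obtain ⟨hsξ, hsη, lam, hlam⟩ := hX
  obtain ⟨x₀, hx₀⟩ := hU'.nonempty
  obtain ⟨u₀, hu₀⟩ := hJ'.nonempty
  have hD := isOpen_spaceTime hI hU
  have hdet := fun {t : ℝ} (ht : t ∈ I) {x : Fin n → ℝ} (hx : x ∈ U) {u : ℝ} (hu : u ∈ J) =>
    IsLieSymmetry.first_determining hn hI hU hJ hg hq hlam ht hx hu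
  -- The coefficients are defined by freezing `u₀`, and for `τ` also `x₀`; independence of these
  -- choices is proved afterwards.
  set τ : ℝ → ℝ := fun t => X.ξ 0 (Matrix.vecCons t x₀) u₀ with hτ
  set ξ : ℝ → (Fin n → ℝ) → Fin n → ℝ := fun t x i => X.ξ i.succ (Matrix.vecCons t x) u₀ with hξ
  set a : ℝ → (Fin n → ℝ) → ℝ := fun t x => deriv (X.η (Matrix.vecCons t x)) u₀ with ha
  set b : ℝ → (Fin n → ℝ) → ℝ := fun t x => X.η (Matrix.vecCons t x) u₀ - a t x * u₀ with hb
  have hsc := fun (c : Fin (n + 1)) {u : ℝ} (hu : u ∈ J) => contDiffOn_slice_left (hsξ c) hu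
  have hsτ : ContDiffOn ℝ ∞ τ I :=
    contDiffOn_slice_left (f := fun t x => X.ξ 0 (Matrix.vecCons t x) u₀)
      (contDiffOn_join (hsc 0 hu₀)) hx₀
  have hsξ' : ∀ i : Fin n, ContDiffOn ℝ ∞ (fun w : ℝ × (Fin n → ℝ) => ξ w.1 w.2 i) (I ×ˢ U) :=
    fun i => contDiffOn_join (hsc i.succ hu₀)
  have hsa : ContDiffOn ℝ ∞ (fun w : ℝ × (Fin n → ℝ) => a w.1 w.2) (I ×ˢ U) :=
    contDiffOn_join (contDiffOn_slice_left (f := fun z u => deriv (X.η z) u)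
      (contDiffOn_du hsη hD hJ) hu₀)
  have hsb : ContDiffOn ℝ ∞ (fun w : ℝ × (Fin n → ℝ) => b w.1 w.2) (I ×ˢ U) :=
    (contDiffOn_join (contDiffOn_slice_left hsη hu₀)).sub (hsa.mul contDiffOn_const)
  have hu_const : ∀ (c : Fin (n + 1)), ∀ t ∈ I, ∀ x ∈ U, ∀ u ∈ J,
      X.ξ c (Matrix.vecCons t x) u = X.ξ c (Matrix.vecCons t x) u₀ := by
    intro c t ht x hx u hu
    refine const_of_deriv_eq_zero hJ hJ'.isPreconnected
      (contDiffOn_slice_right (hsξ c) (vecCons_mem ht hx)) (fun v hv => ?_) hu hu₀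
    refine Fin.cases ?_ (fun i => ?_) c
    · exact (hdet ht hx hv).2.1
    · exact (hdet ht hx hv).2.2.1 i
  have htime : ∀ t ∈ I, ∀ x ∈ U, ∀ u ∈ J, X.ξ 0 (Matrix.vecCons t x) u = τ t := by
    intro t ht x hx u hu
    rw [hu_const 0 t ht x hx u hu]
    refine const_of_pd_eq_zero (f := fun x => X.ξ 0 (Matrix.vecCons t x) u₀) hU
      hU'.isPreconnected
      (contDiffOn_slice_right (f := fun t x => X.ξ 0 (Matrix.vecCons t x) u₀)
        (contDiffOn_join (hsc 0 hu₀)) ht) (fun y hy i => ?_) hx hx₀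
    rw [← pd_succ_join (F := fun z => X.ξ 0 z u₀) (hsc 0 hu₀) hI hU ht hy i]
    exact (hdet ht hy hu₀).1 i
  have hP : IsProjectable I U J X τ ξ :=
    ⟨htime, fun t ht x hx u hu i => hu_const i.succ t ht x hx u hu, hsτ, hsξ', hsη⟩
  have hτd : ∀ t ∈ I, ∀ x ∈ U, ∀ u ∈ J,
      pd 0 (fun z => X.ξ 0 z u) (Matrix.vecCons t x) = deriv τ t := by
    intro t ht x hx u hu
    rw [pd_zero_join (hsc 0 hu) hI hU ht hx]
    refine EventuallyEq.deriv_eq ?_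
    filter_upwards [hI.mem_nhds ht] with s hs using htime s hs x hx u hu
  have hhom : ∀ t ∈ I, IsHomothetic g U (ξ t) (deriv τ t / 2) := by
    intro t ht
    refine ⟨contDiffOn_pi.2 fun i => contDiffOn_slice_right (f := fun t x => ξ t x i)
      (hsξ' i) ht, fun x hx => ?_⟩
    rw [mul_div_cancel₀ _ two_ne_zero]
    refine (hg.lieMetric_eq_iff hU hx (ξ t) (deriv τ t)).2 fun k l => ?_
    have h1 := (hdet ht hx hu₀).2.2.2.2 k l
    simp only [hτd t ht x hx u₀ hu₀, pd_succ_join (hsc _ hu₀) hI hU ht hx] at h1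
    unfold lieInverse
    simp only [Finset.sum_sub_distrib]
    linarith
  have hpoly : ∀ t ∈ I, ∀ x ∈ U, ∀ u ∈ J, ∀ p : Fin (n + 1) → ℝ,
      X.prolong₂ (heatEq g q) (Matrix.vecCons t x) u p 0
        - (deriv (X.η (Matrix.vecCons t x)) u - deriv τ t)
          * heatEq g q (Matrix.vecCons t x) u p 0 = 0 := by
    intro t ht x hx u hu p
    rw [hlam _ (vecCons_mem ht hx) u hu p 0 (fun _ _ => rfl), (hdet ht hx hu).2.2.2.1 p,
      hτd t ht x hx u hu, sub_self]
  have hηuu : ∀ t ∈ I, ∀ x ∈ U, ∀ u ∈ J, deriv (deriv (X.η (Matrix.vecCons t x))) u = 0 := by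
    intro t ht x hx u hu
    -- With `r = 0` and `u_t = 0` the condition is a polynomial in the spatial derivatives alone.
    -- Its quadratic part is `η_{uu} g^{ij} u_i u_j`, and `g⁻¹` has a nonzero entry.
    have h1 := fun p : Fin n → ℝ => hpoly t ht x hx u hu (Fin.cons 0 p)
    simp only [hP.prolong_sub hI hU hJ hg hq ht hx hu (hhom t ht), Fin.cons_succ] at h1
    obtain ⟨k, l, hkl⟩ := hg.exists_inv_ne_zero hn hx
    have h2 := quadratic_coefficients (hg.inv_symm_apply hx) h1 k l
    exact (mul_eq_zero.1 h2).resolve_right hkl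
  have hC : HasComponents I U J X τ ξ a b := fun t ht x hx u hu =>
    ⟨htime t ht x hx u hu, hP.space t ht x hx u hu,
      exists_affine hJ hJ'.isPreconnected (contDiffOn_slice_right hsη (vecCons_mem ht hx))
        (hηuu t ht x hx) hu₀ hu⟩
  refine ⟨τ, ξ, a, b, hC, hsτ, hsξ', hsa, hsb, hhom, fun t ht x hx k => ?_⟩
  have hηu : deriv (X.η (Matrix.vecCons t x)) u₀ = a t x := rfl
  have h1 := fun p : Fin n → ℝ => hpoly t ht x hx u₀ hu₀ (Fin.cons 0 p)
  simp only [hηu, hC.prolong_sub hI hU hJ hg hq hsτ hsξ' hsa hsb ht hx hu₀ (hhom t ht),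
    Fin.cons_succ] at h1
  have h2 := linear_coefficients h1 k
  linarith

end Affine

end HeatFlux

namespace HeatFlux

open Filter Topology

/-! ### Primitives -/

section Primitive

variable {I : Set ℝ} {T : ℝ → ℝ} {t₀ : ℝ}

theorem hasDerivAt_primitive (hI : IsOpen I) (hI' : IsPreconnected I) (hT : ContDiffOn ℝ ∞ T I)
    (ht₀ : t₀ ∈ I) {t : ℝ} (ht : t ∈ I) :
    HasDerivAt (fun t => ∫ s in t₀..t, T s) (T t) t := by
  have hsub : Set.uIcc t₀ t ⊆ I := hI'.ordConnected.uIcc_subset ht₀ ht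
  exact intervalIntegral.integral_hasDerivAt_right
    ((hT.continuousOn.mono hsub).intervalIntegrable)
    (hT.continuousOn.stronglyMeasurableAtFilter hI t ht)
    (hT.continuousOn.continuousAt (hI.mem_nhds ht))

theorem contDiffOn_primitive (hI : IsOpen I) (hI' : IsPreconnected I) (hT : ContDiffOn ℝ ∞ T I)
    (ht₀ : t₀ ∈ I) : ContDiffOn ℝ ∞ (fun t => ∫ s in t₀..t, T s) I := by
  rw [contDiffOn_infty_iff_deriv_of_isOpen hI]
  exact ⟨fun t ht => (hasDerivAt_primitive hI hI' hT ht₀ ht).differentiableAt.differentiableWithinAt,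
    hT.congr fun t ht => (hasDerivAt_primitive hI hI' hT ht₀ ht).deriv⟩

theorem eq_of_deriv_eq (hI : IsOpen I) (hI' : IsPreconnected I) {f h : ℝ → ℝ}
    (hf : ContDiffOn ℝ ∞ f I) (hh : ContDiffOn ℝ ∞ h I) (hd : ∀ t ∈ I, deriv f t = deriv h t)
    (ht₀ : t₀ ∈ I) (h0 : f t₀ = h t₀) {t : ℝ} (ht : t ∈ I) : f t = h t := by
  have := const_of_deriv_eq_zero (f := fun t => f t - h t) hI hI' (hf.sub hh) (fun s hs => by
    rw [deriv_fun_sub (hf.diffAt hI hs) (hh.diffAt hI hs), hd s hs, sub_self]) ht ht₀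
  simp only [h0, sub_self] at this
  linarith

end Primitive

/-! ### Superpositions -/

section Superposition

variable {n : ℕ} {g : (Fin n → ℝ) → Matrix (Fin n) (Fin n) ℝ} {I J : Set ℝ}
  {U : Set (Fin n → ℝ)} {q : ℝ → (Fin n → ℝ) → ℝ → ℝ} {X : PointField (Fin (n + 1))} {t₀ : ℝ}

/-- A linear combination of potentials of gradient homothetic fields, up to a constant. -/
theorem IsHomothetic.grad_combination (hU : IsOpen U) {N : ℕ}
    {S : Fin N → (Fin n → ℝ) → ℝ} {ψ : Fin N → ℝ} (hS : ∀ A, ContDiffOn ℝ ∞ (S A) U)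
    (hψ : ∀ A, IsHomothetic g U (grad g (S A)) (ψ A)) (c : Fin N → ℝ) (d : ℝ) :
    (∀ x ∈ U, ∀ k, grad g (fun x => ∑ A, c A * S A x + d) x k = ∑ A, c A * grad g (S A) x k) ∧
    IsHomothetic g U (grad g fun x => ∑ A, c A * S A x + d) (∑ A, c A * ψ A) := by
  have h1 : ∀ x ∈ U, ∀ k, grad g (fun x => ∑ A, c A * S A x + d) x k
      = ∑ A, c A * grad g (S A) x k := by
    intro x hx k
    have hd : ∀ A, DifferentiableAt ℝ (S A) x := fun A => (hS A).diffAt hU hx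
    have e : grad g (fun x => ∑ A, c A * S A x + d) x k
        = grad g (fun x => ∑ A, c A * S A x) x k := by
      unfold grad
      refine Finset.sum_congr rfl fun j _ => ?_
      rw [pd_add (DifferentiableAt.fun_sum fun A _ => (hd A).const_mul _)
        (differentiableAt_const d), pd_const, add_zero]
    rw [e, grad_sum (S := fun A x => c A * S A x) fun A => (hd A).const_mul _]
    exact Finset.sum_congr rfl fun A _ => grad_const_mul (hd A) _ _
  exact ⟨h1, (IsHomothetic.sum hU (fun A => (hψ A).const_mul hU (c A)) Finset.univ).congr hU h1⟩

/-- The superposition satisfies the homothetic and gradient conditions for every choice of `T_A` and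
`F`, because homothetic fields form a linear space with additive factors. Only the constraint
remains. -/
theorem formSum_isLieSymmetry_iff (hI : IsOpen I) (hI' : IsConnected I) (hU : IsOpen U)
    (hJ : IsOpen J) (hg : IsMetricOn g U)
    (hq : ContDiffOn ℝ ∞ (fun w : ℝ × (Fin n → ℝ) × ℝ => q w.1 w.2.1 w.2.2) (I ×ˢ (U ×ˢ J)))
    (ht₀ : t₀ ∈ I) {Y : (Fin n → ℝ) → Fin n → ℝ} {ψ₀ c₁ : ℝ} {N : ℕ}
    {S : Fin N → (Fin n → ℝ) → ℝ} {ψ : Fin N → ℝ} {T : Fin N → ℝ → ℝ} {F : ℝ → ℝ}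
    {b : ℝ → (Fin n → ℝ) → ℝ} (hY : IsHomothetic g U Y ψ₀)
    (hS : ∀ A, ContDiffOn ℝ ∞ (S A) U ∧ IsHomothetic g U (grad g (S A)) (ψ A) ∧
      ContDiffOn ℝ ∞ (T A) I)
    (hF : ContDiffOn ℝ ∞ F I)
    (hb : ContDiffOn ℝ ∞ (fun w : ℝ × (Fin n → ℝ) => b w.1 w.2) (I ×ˢ U))
    (hX : FormSum I U J X g t₀ Y ψ₀ c₁ S ψ T F b) :
    IsLieSymmetry (spaceTime I U) J (heatEq g q) X ↔
      ConstraintSum I U J g q t₀ Y ψ₀ c₁ S ψ T F b := by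
  have hST := fun A => (hS A).1
  have hSψ := fun A => (hS A).2.1
  have hT := fun A => (hS A).2.2
  have hP := fun A {t : ℝ} (ht : t ∈ I) =>
    hasDerivAt_primitive hI hI'.isPreconnected (hT A) ht₀ ht
  have hfst : Set.MapsTo (fun w : ℝ × (Fin n → ℝ) => w.1) (I ×ˢ U) I := fun _ hw => hw.1
  have hsnd : Set.MapsTo (fun w : ℝ × (Fin n → ℝ) => w.2) (I ×ˢ U) U := fun _ hw => hw.2
  have hτ : ContDiffOn ℝ ∞
      (fun t => 2 * ψ₀ * t + 2 * ∑ A, ψ A * (∫ s in t₀..t, T A s) + c₁) I :=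
    ((contDiffOn_const.mul contDiffOn_id).add (contDiffOn_const.mul (ContDiffOn.sum fun A _ =>
      contDiffOn_const.mul (contDiffOn_primitive hI hI'.isPreconnected (hT A) ht₀)))).add
        contDiffOn_const
  have hτd : ∀ t ∈ I, deriv (fun t => 2 * ψ₀ * t + 2 * ∑ A, ψ A * (∫ s in t₀..t, T A s) + c₁) t
      = 2 * (ψ₀ + ∑ A, T A t * ψ A) := by
    intro t ht
    have h1 := (((hasDerivAt_id t).const_mul (2 * ψ₀)).add ((HasDerivAt.fun_sum
      (u := Finset.univ) fun A _ => (hP A ht).const_mul (ψ A)).const_mul 2)).add_const c₁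
    refine h1.deriv.trans ?_
    simp only [mul_comm (T _ t), mul_one]
    ring
  have hξ : ∀ k : Fin n, ContDiffOn ℝ ∞ (fun w : ℝ × (Fin n → ℝ) =>
      Y w.2 k + ∑ A, T A w.1 * grad g (S A) w.2 k) (I ×ˢ U) := fun k =>
    ((hY.smooth k).comp contDiffOn_snd hsnd).add (ContDiffOn.sum fun A _ =>
      ((hT A).comp contDiffOn_fst hfst).mul
        ((hg.smooth_grad hU (hST A) k).comp contDiffOn_snd hsnd))
  have ha : ContDiffOn ℝ ∞ (fun w : ℝ × (Fin n → ℝ) =>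
      -(1 / 2) * ∑ A, deriv (T A) w.1 * S A w.2 + F w.1) (I ×ˢ U) :=
    (contDiffOn_const.mul (ContDiffOn.sum fun A _ =>
      ((contDiffOn_deriv (hT A) hI).comp contDiffOn_fst hfst).mul
        ((hST A).comp contDiffOn_snd hsnd))).add (hF.comp contDiffOn_fst hfst)
  have hL : ∀ t ∈ I, IsHomothetic g U (fun x k => Y x k + ∑ A, T A t * grad g (S A) x k)
      (deriv (fun t => 2 * ψ₀ * t + 2 * ∑ A, ψ A * (∫ s in t₀..t, T A s) + c₁) t / 2) := by
    intro t ht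
    rw [hτd t ht, mul_div_cancel_left₀ _ two_ne_zero]
    exact hY.add hU (IsHomothetic.sum hU (fun A => (hSψ A).const_mul hU (T A t)) Finset.univ)
  have hacomb : ∀ t, (fun x => -(1 / 2) * ∑ A, deriv (T A) t * S A x + F t)
      = fun x => ∑ A, (-(1 / 2) * deriv (T A) t) * S A x + F t := by
    intro t
    funext x
    simp only [Finset.mul_sum, mul_assoc]
  have hgrad : ∀ t ∈ I, ∀ x ∈ U, ∀ k,
      deriv (fun s => Y x k + ∑ A, T A s * grad g (S A) x k) t
        = -2 * grad g (fun x => -(1 / 2) * ∑ A, deriv (T A) t * S A x + F t) x k := by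
    intro t ht x hx k
    rw [hacomb, (IsHomothetic.grad_combination hU hST hSψ _ _).1 x hx k]
    have h1 := (HasDerivAt.fun_sum (u := Finset.univ) fun A _ =>
      ((hT A).diffAt hI ht).hasDerivAt.mul_const (grad g (S A) x k)).const_add (Y x k)
    rw [h1.deriv, Finset.mul_sum]
    exact Finset.sum_congr rfl fun A _ => by ring
  rw [HasComponents.isLieSymmetry_iff hX hI hU hJ hg hq hτ hξ ha hb hL hgrad]
  unfold ConstraintSum
  refine forall₂_congr fun t ht => forall₂_congr fun x hx => forall₂_congr fun u _ => ?_
  -- The Laplacian `nψ_A` of each potential is the source of the terms `-½ n ψ_A T_{A,t}`.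
  have e1 : laplacian g (fun x => -(1 / 2) * ∑ A, deriv (T A) t * S A x + F t) x
      = n * ∑ A, (-(1 / 2) * deriv (T A) t) * ψ A := by
    rw [hacomb]
    refine IsHomothetic.laplacian_eq hg hU ?_
      (IsHomothetic.grad_combination hU hST hSψ _ _).2 hx
    exact (ContDiffOn.sum fun A _ => contDiffOn_const.mul (hST A)).add contDiffOn_const
  have e2 : deriv (fun s => -(1 / 2) * ∑ A, deriv (T A) s * S A x + F s) t
      = -(1 / 2) * ∑ A, deriv (deriv (T A)) t * S A x + deriv F t := by
    exact (((HasDerivAt.fun_sum (u := Finset.univ) fun A _ =>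
      (((contDiffOn_deriv (hT A) hI).diffAt hI ht).hasDerivAt.mul_const (S A x))).const_mul
        (-(1 / 2))).add (hF.diffAt hI ht).hasDerivAt).deriv
  have e3 : n * ∑ A, (-(1 / 2) * deriv (T A) t) * ψ A
        - (-(1 / 2) * ∑ A, deriv (deriv (T A)) t * S A x + deriv F t)
      = ∑ A, (-(1 / 2) * n * ψ A * deriv (T A) t + (1 / 2) * deriv (deriv (T A)) t * S A x)
        - deriv F t := by
    rw [← sub_sub, Finset.mul_sum, Finset.mul_sum, ← Finset.sum_sub_distrib]
    congr 1
    exact Finset.sum_congr rfl fun A _ => by ring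
  rw [e1, e2, e3]

/-- The time derivative of a family of homothetic fields is homothetic. -/
theorem isHomothetic_deriv (hI : IsOpen I) (hU : IsOpen U)
    {ξ : ℝ → (Fin n → ℝ) → Fin n → ℝ} {c : ℝ → ℝ}
    (hξ : ∀ i : Fin n, ContDiffOn ℝ ∞ (fun w : ℝ × (Fin n → ℝ) => ξ w.1 w.2 i) (I ×ˢ U))
    (hc : ContDiffOn ℝ ∞ c I) (h : ∀ t ∈ I, IsHomothetic g U (ξ t) (c t)) {t : ℝ} (ht : t ∈ I) :
    IsHomothetic g U (fun x k => deriv (fun s => ξ s x k) t) (deriv c t) := by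
  refine ⟨contDiffOn_pi.2 fun k => contDiffOn_slice_right
    (f := fun t x => deriv (fun s => ξ s x k) t)
    (contDiffOn_dt (f := fun t x => ξ t x k) (hξ k) hI hU) ht, fun x hx i j => ?_⟩
  have e : (fun s => lieMetric g (ξ s) i j x) =ᶠ[𝓝 t] fun s => 2 * c s * g x i j := by
    filter_upwards [hI.mem_nhds ht] with s hs using (h s hs).2 x hx i j
  have h1 : deriv (fun s => 2 * c s * g x i j) t = 2 * deriv c t * g x i j :=
    (((hc.diffAt hI ht).hasDerivAt.const_mul 2).mul_const _).deriv
  rw [← h1, ← e.deriv_eq]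
  -- The homothetic equation is linear in the field, so it may be differentiated in `t` once the
  -- time and space derivatives are exchanged.
  have hd : ∀ k, HasDerivAt (fun s => ξ s x k) (deriv (fun s => ξ s x k) t) t := fun k =>
    ((contDiffOn_slice_left (f := fun s x => ξ s x k) (hξ k) hx).diffAt hI ht).hasDerivAt
  have hd' : ∀ k m, HasDerivAt (fun s => pd m (fun y => ξ s y k) x)
      (pd m (fun y => deriv (fun s => ξ s y k) t) x) t := by
    intro k m
    rw [← deriv_pd_comm (f := fun s y => ξ s y k) (hξ k) hI hU ht hx m]
    exact ((contDiffOn_slice_left (f := fun s x => pd m (fun y => ξ s y k) x)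
      (contDiffOn_dx (f := fun s y => ξ s y k) (hξ k) hI hU m) hx).diffAt hI ht).hasDerivAt
  exact (HasDerivAt.fun_sum (u := Finset.univ) fun k _ =>
    (((hd k).mul_const _).add ((hd' k i).const_mul (g x k j))).add
      ((hd' k j).const_mul (g x i k))).deriv.symm

/-- A family of functions with homothetic gradients is spanned by finitely many of its members. -/
theorem exists_finite_potentials (hI : IsOpen I) (hU : IsOpen U) (hU' : IsConnected U)
    (hg : IsMetricOn g U) {a : ℝ → (Fin n → ℝ) → ℝ} {c : ℝ → ℝ}
    (ha : ContDiffOn ℝ ∞ (fun w : ℝ × (Fin n → ℝ) => a w.1 w.2) (I ×ˢ U))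
    (hc : ContDiffOn ℝ ∞ c I) (h : ∀ t ∈ I, IsHomothetic g U (grad g (a t)) (c t)) :
    ∃ (N : ℕ) (τ : Fin N → ℝ) (α : Fin N → ℝ → ℝ), (∀ A, τ A ∈ I) ∧
      (∀ A, ContDiffOn ℝ ∞ (α A) I) ∧ (∀ t ∈ I, c t = ∑ A, α A t * c (τ A)) ∧
      ∀ t ∈ I, ∀ x ∈ U, a t x = ∑ A, α A t * a (τ A) x := by
  obtain ⟨x₀, hx₀⟩ := hU'.nonempty
  have hat := fun t (ht : t ∈ I) => contDiffOn_slice_right ha ht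
  -- The 1-jet at `x₀` together with the factor determines the potential. The factor is included so
  -- that subtracting the combination leaves factor zero, as `IsHomothetic.eq_zero_of_grad`
  -- requires.
  set ev : ℝ → ℝ × (Fin n → ℝ) × ℝ := fun t => (a t x₀, fun i => pd i (a t) x₀, c t) with hev
  have hevs : ContDiffOn ℝ ∞ ev I := by
    refine (contDiffOn_slice_left ha hx₀).prodMk (ContDiffOn.prodMk (contDiffOn_pi.2 fun i => ?_) hc)
    exact contDiffOn_slice_left (f := fun t x => pd i (a t) x) (contDiffOn_dx ha hI hU i) hx₀
  obtain ⟨N, τ, φ, hτ, hφ⟩ := exists_finite_expansion ev I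
  have h1 : ∀ t ∈ I, a t x₀ = ∑ A, φ A (ev t) * a (τ A) x₀ := by
    intro t ht
    have := congrArg Prod.fst (hφ t ht)
    simpa [hev, Prod.fst_sum] using this
  have h2 : ∀ t ∈ I, ∀ i, pd i (a t) x₀ = ∑ A, φ A (ev t) * pd i (a (τ A)) x₀ := by
    intro t ht i
    have := congrFun (congrArg (fun v => v.2.1) (hφ t ht)) i
    simpa [hev, Prod.fst_sum, Prod.snd_sum] using this
  have h3 : ∀ t ∈ I, c t = ∑ A, φ A (ev t) * c (τ A) := by
    intro t ht
    have := congrArg (fun v => v.2.2) (hφ t ht)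
    simpa [hev, Prod.snd_sum] using this
  refine ⟨N, τ, fun A t => φ A (ev t), hτ, fun A => (φ A).contDiff.comp_contDiffOn hevs, h3,
    fun t ht x hx => ?_⟩
  have hcomb := IsHomothetic.grad_combination hU (fun A => hat _ (hτ A)) (fun A => h _ (hτ A))
    (fun A => φ A (ev t)) 0
  simp only [add_zero] at hcomb
  have hsum : ContDiffOn ℝ ∞ (fun x => ∑ A, φ A (ev t) * a (τ A) x) U :=
    ContDiffOn.sum fun A _ => contDiffOn_const.mul (hat _ (hτ A))
  have hhom : IsHomothetic g U (grad g fun x => a t x - ∑ A, φ A (ev t) * a (τ A) x) 0 := by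
    have h4 := (h t ht).add hU (hcomb.2.const_mul hU (-1))
    rw [h3 t ht, neg_one_mul, add_neg_cancel] at h4
    refine h4.congr hU fun y hy i => ?_
    rw [grad_sub ((hat t ht).diffAt hU hy) (hsum.diffAt hU hy)]
    ring
  have := hhom.eq_zero_of_grad hg hU hU'.isPreconnected ((hat t ht).sub hsum) hx₀
    (by rw [h1 t ht, sub_self]) (fun i => by
      rw [pd_sub ((hat t ht).diffAt hU hx₀) (hsum.diffAt hU hx₀), h2 t ht,
        pd_sum fun A _ => ((hat _ (hτ A)).diffAt hU hx₀).const_mul _]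
      simp only [pd_const_mul ((hat _ (hτ _)).diffAt hU hx₀), sub_self]) hx
  linarith

end Superposition

end HeatFlux

namespace HeatFlux

open Filter Topology

/-! ### The form of the Lie point symmetries -/

section Form

variable {n : ℕ} {g : (Fin n → ℝ) → Matrix (Fin n) (Fin n) ℝ} {I J : Set ℝ}
  {U : Set (Fin n → ℝ)} {q : ℝ → (Fin n → ℝ) → ℝ → ℝ} {X : PointField (Fin (n + 1))} {t₀ : ℝ}

/-- The expansion of `a` in finitely many potentials is integrated in time: once for `ξ`, since
`ξ_{,t} = -2 ∇a`, and twice for `τ`, since the factor of `a(t,·)` is `-τ_{,tt}/4`. -/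
theorem IsLieSymmetry.exists_formSum (hn : 0 < n) (hI : IsOpen I) (hI' : IsConnected I)
    (hU : IsOpen U) (hU' : IsConnected U) (hJ : IsOpen J) (hJ' : IsConnected J)
    (hg : IsMetricOn g U)
    (hq : ContDiffOn ℝ ∞ (fun w : ℝ × (Fin n → ℝ) × ℝ => q w.1 w.2.1 w.2.2) (I ×ˢ (U ×ˢ J)))
    (ht₀ : t₀ ∈ I) (hX : IsLieSymmetry (spaceTime I U) J (heatEq g q) X) :
    ∃ (Y : (Fin n → ℝ) → Fin n → ℝ) (ψ₀ c₁ : ℝ) (N : ℕ) (S : Fin N → (Fin n → ℝ) → ℝ)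
      (ψ : Fin N → ℝ) (T : Fin N → ℝ → ℝ) (F : ℝ → ℝ) (b : ℝ → (Fin n → ℝ) → ℝ),
      IsHomothetic g U Y ψ₀ ∧
      (∀ A, ContDiffOn ℝ ∞ (S A) U ∧ IsHomothetic g U (grad g (S A)) (ψ A) ∧
        ContDiffOn ℝ ∞ (T A) I) ∧
      ContDiffOn ℝ ∞ F I ∧
      ContDiffOn ℝ ∞ (fun w : ℝ × (Fin n → ℝ) => b w.1 w.2) (I ×ˢ U) ∧
      FormSum I U J X g t₀ Y ψ₀ c₁ S ψ T F b := by
  obtain ⟨τ, ξ, a, b, hC, hτ, hξ, ha, hb, hhom, hgrad⟩ :=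
    hX.exists_components hn hI hU hU' hJ hJ' hg hq
  have hIp := hI'.isPreconnected
  have hτ' := contDiffOn_deriv hτ hI
  have hgr : ∀ t ∈ I, IsHomothetic g U (grad g (a t)) (-(1 / 4) * deriv (deriv τ) t) := by
    intro t ht
    -- `ξ_{,t}` has factor `τ_{,tt}/2`, and `∇a = -½ ξ_{,t}`.
    have h1 := (isHomothetic_deriv (c := fun t => deriv τ t / 2) hI hU hξ (hτ'.div_const 2) hhom
      ht).const_mul hU (-(1 / 2))
    rw [deriv_div_const] at h1
    rw [show -(1 / 4) * deriv (deriv τ) t = -(1 / 2) * (deriv (deriv τ) t / 2) by ring]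
    refine h1.congr hU fun y hy i => ?_
    rw [hgrad t ht y hy i]
    ring
  obtain ⟨N, s, α, hs, hα, hc, hexp⟩ := exists_finite_potentials hI hU hU' hg ha
    (contDiffOn_const.mul (contDiffOn_deriv hτ' hI)) hgr
  have hat := fun t (ht : t ∈ I) => contDiffOn_slice_right ha ht
  have hαP := fun A {t : ℝ} (ht : t ∈ I) => hasDerivAt_primitive hI hIp (hα A) ht₀ ht
  have hTd : ∀ A, ∀ t ∈ I, HasDerivAt (fun t => -2 * ∫ s in t₀..t, α A s) (-2 * α A t) t :=
    fun A t ht => (hαP A ht).const_mul _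
  have hT : ∀ A, ContDiffOn ℝ ∞ (fun t => -2 * ∫ s in t₀..t, α A s) I := fun A =>
    contDiffOn_const.mul (contDiffOn_primitive hI hIp (hα A) ht₀)
  -- The potentials are the values `a(s_A,·)`, and `T_A = -2 ∫ α_A` vanishes at `t₀`, so `Y` is `ξ`
  -- at that time. The expansion reproduces `a` exactly, including additive constants, so `F = 0`
  -- suffices.
  refine ⟨ξ t₀, deriv τ t₀ / 2, τ t₀ - deriv τ t₀ * t₀, N, fun A => a (s A),
    fun A => -(1 / 4) * deriv (deriv τ) (s A), fun A t => -2 * ∫ s in t₀..t, α A s, fun _ => 0, b,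
    hhom t₀ ht₀, fun A => ⟨hat _ (hs A), hgr _ (hs A), hT A⟩, contDiffOn_const, hb, ?_⟩
  have hcomb := fun t => IsHomothetic.grad_combination hU (fun A => hat _ (hs A))
    (fun A => hgr _ (hs A)) (fun A => α A t) 0
  simp only [add_zero] at hcomb
  have hTP := fun A {t : ℝ} (ht : t ∈ I) => hasDerivAt_primitive hI hIp (hT A) ht₀ ht
  -- First integration of `τ_{,tt} = -4 ∑ α_A ψ_A`; the second one gives the time component below.
  have hτform : ∀ t ∈ I, deriv τ t = 2 * (deriv τ t₀ / 2)
      + 2 * ∑ A, -(1 / 4) * deriv (deriv τ) (s A) * (-2 * ∫ s in t₀..t, α A s) := by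
    intro t ht
    refine eq_of_deriv_eq hI hIp hτ' (contDiffOn_const.add (contDiffOn_const.mul
      (ContDiffOn.sum fun A _ => contDiffOn_const.mul (hT A)))) (fun t ht => ?_) ht₀ (by simp; ring)
      ht
    have h1 := ((HasDerivAt.fun_sum (u := Finset.univ) fun A _ =>
      (hTd A t ht).const_mul (-(1 / 4) * deriv (deriv τ) (s A))).const_mul 2).const_add
        (2 * (deriv τ t₀ / 2))
    rw [h1.deriv]
    have h2 : deriv (deriv τ) t = -4 * (-(1 / 4) * deriv (deriv τ) t) := by ring
    rw [h2, hc t ht, Finset.mul_sum, Finset.mul_sum]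
    exact Finset.sum_congr rfl fun A _ => by ring
  intro t ht x hx u hu
  obtain ⟨h0, h1, h2⟩ := hC t ht x hx u hu
  refine ⟨h0.trans ?_, fun i => (h1 i).trans ?_, h2.trans ?_⟩
  · refine eq_of_deriv_eq (h := fun t => 2 * (deriv τ t₀ / 2) * t
      + 2 * ∑ A, -(1 / 4) * deriv (deriv τ) (s A) * (∫ s in t₀..t, -2 * ∫ r in t₀..s, α A r)
      + (τ t₀ - deriv τ t₀ * t₀)) hI hIp hτ ?_ (fun t ht => ?_) ht₀ (by simp; ring) ht
    · exact ((contDiffOn_const.mul contDiffOn_id).add (contDiffOn_const.mul (ContDiffOn.sum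
        fun A _ => contDiffOn_const.mul (contDiffOn_primitive hI hIp (hT A) ht₀)))).add
          contDiffOn_const
    · have h3 := (((hasDerivAt_id t).const_mul (2 * (deriv τ t₀ / 2))).add ((HasDerivAt.fun_sum
        (u := Finset.univ) fun A _ => (hTP A ht).const_mul
          (-(1 / 4) * deriv (deriv τ) (s A))).const_mul 2)).add_const (τ t₀ - deriv τ t₀ * t₀)
      refine Eq.trans ?_ h3.deriv.symm
      rw [hτform t ht, mul_one]
  · refine eq_of_deriv_eq (f := fun t => ξ t x i) (h := fun t => ξ t₀ x i
      + ∑ A, (-2 * ∫ s in t₀..t, α A s) * grad g (a (s A)) x i) hI hIp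
      (contDiffOn_slice_left (f := fun t x => ξ t x i) (hξ i) hx)
      (contDiffOn_const.add (ContDiffOn.sum fun A _ => (hT A).mul contDiffOn_const))
      (fun t ht => ?_) ht₀ (by simp) ht
    have h3 := (HasDerivAt.fun_sum (u := Finset.univ) fun A _ =>
      (hTd A t ht).mul_const (grad g (a (s A)) x i)).const_add (ξ t₀ x i)
    rw [h3.deriv, hgrad t ht x hx, grad_congr hU (hexp t ht) hx, (hcomb t).1 x hx,
      Finset.mul_sum]
    exact Finset.sum_congr rfl fun A _ => by ring
  · rw [hexp t ht x hx]
    dsimp only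
    rw [add_zero, Finset.mul_sum]
    congr 2
    refine Finset.sum_congr rfl fun A _ => ?_
    rw [(hTd A t ht).deriv]
    ring

theorem const_of_grad_eq_zero (hU : IsOpen U) (hU' : IsPreconnected U) (hg : IsMetricOn g U)
    {f : (Fin n → ℝ) → ℝ} (hf : ContDiffOn ℝ ∞ f U) (h : ∀ x ∈ U, ∀ k, grad g f x k = 0)
    {x y : Fin n → ℝ} (hx : x ∈ U) (hy : y ∈ U) : f x = f y :=
  const_of_pd_eq_zero hU hU' hf (fun z hz i => by
    rw [← hg.sum_mul_grad hz]
    simp [h z hz]) hx hy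

/-- The equation `T_{,t} Y = -2 ∇a` forces `T_{,t} = 0`, since `Y` is not a gradient. Then `∇a = 0`,
so `a` depends on `t` alone. -/
theorem IsLieSymmetry.exists_formA (hn : 0 < n) (hI : IsOpen I) (hI' : IsConnected I)
    (hU : IsOpen U) (hU' : IsConnected U) (hJ : IsOpen J) (hJ' : IsConnected J)
    (hg : IsMetricOn g U)
    (hq : ContDiffOn ℝ ∞ (fun w : ℝ × (Fin n → ℝ) × ℝ => q w.1 w.2.1 w.2.2) (I ×ˢ (U ×ˢ J)))
    {Y : (Fin n → ℝ) → Fin n → ℝ} {ψ : ℝ} (hY : IsHomothetic g U Y ψ)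
    (hYg : ¬ IsGradient g U Y) (hX : IsLieSymmetry (spaceTime I U) J (heatEq g q) X)
    {T : ℝ → ℝ} (hT : ∀ t ∈ I, ∀ x ∈ U, ∀ u ∈ J, ∀ i : Fin n,
      X.ξ i.succ (Matrix.vecCons t x) u = T t * Y x i) :
    ∃ (c₁ c₂ : ℝ) (a : ℝ → ℝ) (b : ℝ → (Fin n → ℝ) → ℝ), ContDiffOn ℝ ∞ a I ∧
      ContDiffOn ℝ ∞ (fun w : ℝ × (Fin n → ℝ) => b w.1 w.2) (I ×ˢ U) ∧
      FormA I U J X Y ψ c₁ c₂ a b := by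
  obtain ⟨τ, ξ, a, b, hC, hτ, hξ, ha, hb, hhom, hgrad⟩ :=
    hX.exists_components hn hI hU hU' hJ hJ' hg hq
  have hIp := hI'.isPreconnected
  obtain ⟨t₀, ht₀⟩ := hI'.nonempty
  obtain ⟨x₀, hx₀⟩ := hU'.nonempty
  obtain ⟨u₀, hu₀⟩ := hJ'.nonempty
  have hat := fun t (ht : t ∈ I) => contDiffOn_slice_right ha ht
  have hξT : ∀ t ∈ I, ∀ x ∈ U, ∀ i, ξ t x i = T t * Y x i := fun t ht x hx i =>
    ((hC t ht x hx u₀ hu₀).2.1 i).symm.trans (hT t ht x hx u₀ hu₀ i)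
  -- The zero field is a gradient, so `Y` has a nonzero component somewhere; dividing by it shows
  -- that `T` is smooth.
  obtain ⟨x₁, hx₁, i₁, hY₁⟩ : ∃ x ∈ U, ∃ i, Y x i ≠ 0 := by
    by_contra! h
    refine hYg ⟨fun _ => 0, contDiffOn_const, fun x hx i => ?_⟩
    simp [h x hx i, grad, pd_const]
  have hTs : ContDiffOn ℝ ∞ T I := by
    refine ((contDiffOn_slice_left (f := fun t x => ξ t x i₁) (hξ i₁) hx₁).div_const
      (Y x₁ i₁)).congr fun t ht => ?_
    rw [hξT t ht x₁ hx₁ i₁, mul_div_cancel_right₀ _ hY₁]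
  have hgT : ∀ t ∈ I, ∀ x ∈ U, ∀ k, deriv T t * Y x k = -2 * grad g (a t) x k := by
    intro t ht x hx k
    rw [← hgrad t ht x hx k]
    have e : (fun s => ξ s x k) =ᶠ[𝓝 t] fun s => T s * Y x k := by
      filter_upwards [hI.mem_nhds ht] with s hs using hξT s hs x hx k
    rw [e.deriv_eq, deriv_mul_const (hTs.diffAt hI ht)]
  have hT0 : ∀ t ∈ I, deriv T t = 0 := by
    intro t ht
    by_contra hne
    -- If `T_{,t} ≠ 0` at a single time, this is a potential of `Y`.
    refine hYg ⟨fun x => (-2 / deriv T t) * a t x, contDiffOn_const.mul (hat t ht),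
      fun x hx i => ?_⟩
    rw [grad_const_mul ((hat t ht).diffAt hU hx), div_mul_eq_mul_div, ← hgT t ht x hx i,
      mul_div_cancel_left₀ _ hne]
  have hTc : ∀ t ∈ I, T t = T t₀ := fun t ht => const_of_deriv_eq_zero hI hIp hTs hT0 ht ht₀
  have hac : ∀ t ∈ I, ∀ x ∈ U, a t x = a t x₀ := by
    intro t ht x hx
    refine const_of_grad_eq_zero hU hU'.isPreconnected hg (hat t ht) (fun y hy k => ?_) hx hx₀
    have := hgT t ht y hy k
    rw [hT0 t ht, zero_mul] at this
    linarith
  have hτd : ∀ t ∈ I, deriv τ t = 2 * T t₀ * ψ := by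
    intro t ht
    have h1 := (hY.const_mul hU (T t₀)).congr hU (Z := ξ t) fun y hy i => by
      rw [hξT t ht y hy i, hTc t ht]
    have := (hhom t ht).factor_unique hg hn hx₀ h1
    linarith
  refine ⟨τ t₀ - 2 * T t₀ * ψ * t₀, T t₀, fun t => a t x₀, b, contDiffOn_slice_left ha hx₀, hb,
    fun t ht x hx u hu => ?_⟩
  obtain ⟨h0, h1, h2⟩ := hC t ht x hx u hu
  refine ⟨h0.trans ?_, fun i => (h1 i).trans ?_, h2.trans ?_⟩
  · refine eq_of_deriv_eq (h := fun t => 2 * T t₀ * ψ * t + (τ t₀ - 2 * T t₀ * ψ * t₀)) hI hIp hτ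
      ((contDiffOn_const.mul contDiffOn_id).add contDiffOn_const) (fun t ht => ?_) ht₀ (by ring) ht
    rw [hτd t ht]
    simp
  · rw [hξT t ht x hx i, hTc t ht]
  · rw [hac t ht x hx]

/-- `T_{,t} ∇S = -2 ∇a` says that `a + ½ T_{,t} S` has zero gradient; its value, read off at `x₀`,
is `F(t)`. Uniqueness of the homothetic factor gives `τ_{,t} = 2ψT`. -/
theorem IsLieSymmetry.exists_formB (hn : 0 < n) (hI : IsOpen I) (hI' : IsConnected I)
    (hU : IsOpen U) (hU' : IsConnected U) (hJ : IsOpen J) (hJ' : IsConnected J)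
    (hg : IsMetricOn g U)
    (hq : ContDiffOn ℝ ∞ (fun w : ℝ × (Fin n → ℝ) × ℝ => q w.1 w.2.1 w.2.2) (I ×ˢ (U ×ˢ J)))
    (ht₀ : t₀ ∈ I) {S : (Fin n → ℝ) → ℝ} {ψ : ℝ} (hS : ContDiffOn ℝ ∞ S U)
    (hY : IsHomothetic g U (grad g S) ψ)
    (hX : IsLieSymmetry (spaceTime I U) J (heatEq g q) X)
    {T : ℝ → ℝ} (hTs : ContDiffOn ℝ ∞ T I) (hT : ∀ t ∈ I, ∀ x ∈ U, ∀ u ∈ J, ∀ i : Fin n,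
      X.ξ i.succ (Matrix.vecCons t x) u = T t * grad g S x i) :
    ∃ (c₁ : ℝ) (F : ℝ → ℝ) (b : ℝ → (Fin n → ℝ) → ℝ), ContDiffOn ℝ ∞ F I ∧
      ContDiffOn ℝ ∞ (fun w : ℝ × (Fin n → ℝ) => b w.1 w.2) (I ×ˢ U) ∧
      FormB I U J X g t₀ S ψ c₁ T F b := by
  obtain ⟨τ, ξ, a, b, hC, hτ, hξ, ha, hb, hhom, hgrad⟩ :=
    hX.exists_components hn hI hU hU' hJ hJ' hg hq
  have hIp := hI'.isPreconnected
  obtain ⟨x₀, hx₀⟩ := hU'.nonempty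
  obtain ⟨u₀, hu₀⟩ := hJ'.nonempty
  have hat := fun t (ht : t ∈ I) => contDiffOn_slice_right ha ht
  have hξT : ∀ t ∈ I, ∀ x ∈ U, ∀ i, ξ t x i = T t * grad g S x i := fun t ht x hx i =>
    ((hC t ht x hx u₀ hu₀).2.1 i).symm.trans (hT t ht x hx u₀ hu₀ i)
  have hgT : ∀ t ∈ I, ∀ x ∈ U, ∀ k, deriv T t * grad g S x k = -2 * grad g (a t) x k := by
    intro t ht x hx k
    rw [← hgrad t ht x hx k]
    have e : (fun s => ξ s x k) =ᶠ[𝓝 t] fun s => T s * grad g S x k := by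
      filter_upwards [hI.mem_nhds ht] with s hs using hξT s hs x hx k
    rw [e.deriv_eq, deriv_mul_const (hTs.diffAt hI ht)]
  have hac : ∀ t ∈ I, ∀ x ∈ U, a t x - -(1 / 2) * deriv T t * S x
      = a t x₀ - -(1 / 2) * deriv T t * S x₀ := by
    intro t ht x hx
    have hs : ContDiffOn ℝ ∞ (fun x => -(1 / 2) * deriv T t * S x) U := contDiffOn_const.mul hS
    refine const_of_grad_eq_zero (f := fun x => a t x - -(1 / 2) * deriv T t * S x) hU
      hU'.isPreconnected hg ((hat t ht).sub hs) (fun y hy k => ?_) hx hx₀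
    rw [grad_sub ((hat t ht).diffAt hU hy) (hs.diffAt hU hy), grad_const_mul (hS.diffAt hU hy)]
    linear_combination (1 / 2) * hgT t ht y hy k
  have hτd : ∀ t ∈ I, deriv τ t = 2 * ψ * T t := by
    intro t ht
    have h1 := (hY.const_mul hU (T t)).congr hU (Z := ξ t) (hξT t ht)
    have := (hhom t ht).factor_unique hg hn hx₀ h1
    linarith
  refine ⟨τ t₀, fun t => a t x₀ - -(1 / 2) * deriv T t * S x₀, b,
    (contDiffOn_slice_left ha hx₀).sub
      ((contDiffOn_const.mul (contDiffOn_deriv hTs hI)).mul contDiffOn_const), hb,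
    fun t ht x hx u hu => ?_⟩
  obtain ⟨h0, h1, h2⟩ := hC t ht x hx u hu
  refine ⟨h0.trans ?_, fun i => (h1 i).trans (hξT t ht x hx i), h2.trans ?_⟩
  · refine eq_of_deriv_eq (h := fun t => 2 * ψ * (∫ s in t₀..t, T s) + τ t₀) hI hIp hτ
      ((contDiffOn_const.mul (contDiffOn_primitive hI hIp hTs ht₀)).add contDiffOn_const)
      (fun t ht => ?_) ht₀ (by simp) ht
    rw [hτd t ht, (((hasDerivAt_primitive hI hIp hTs ht₀ ht).const_mul (2 * ψ)).add_const
      (τ t₀)).deriv]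
  · dsimp only
    rw [← hac t ht x hx]
    ring

theorem formA_isLieSymmetry_iff (hI : IsOpen I) (hI' : IsConnected I) (hU : IsOpen U)
    (hJ : IsOpen J) (hg : IsMetricOn g U)
    (hq : ContDiffOn ℝ ∞ (fun w : ℝ × (Fin n → ℝ) × ℝ => q w.1 w.2.1 w.2.2) (I ×ˢ (U ×ˢ J)))
    (ht₀ : t₀ ∈ I) {Y : (Fin n → ℝ) → Fin n → ℝ} {ψ c₁ c₂ : ℝ} {a : ℝ → ℝ}
    {b : ℝ → (Fin n → ℝ) → ℝ} (hY : IsHomothetic g U Y ψ) (ha : ContDiffOn ℝ ∞ a I)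
    (hb : ContDiffOn ℝ ∞ (fun w : ℝ × (Fin n → ℝ) => b w.1 w.2) (I ×ˢ U))
    (hX : FormA I U J X Y ψ c₁ c₂ a b) :
    IsLieSymmetry (spaceTime I U) J (heatEq g q) X ↔ ConstraintA I U J g q Y ψ c₁ c₂ a b := by
  -- The superposition without gradient terms: `c₂ Y` has factor `c₂ ψ`, and `a` plays the role of
  -- `F`.
  have hX' : FormSum I U J X g t₀ (fun x i => c₂ * Y x i) (c₂ * ψ) c₁
      (fun A : Fin 0 => A.elim0) (fun A => A.elim0) (fun A => A.elim0) a b := by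
    intro t ht x hx u hu
    obtain ⟨h0, h1, h2⟩ := hX t ht x hx u hu
    refine ⟨h0.trans ?_, fun i => (h1 i).trans (by simp), h2.trans (by simp)⟩
    dsimp only
    rw [Finset.univ_eq_empty, Finset.sum_empty]
    ring
  rw [formSum_isLieSymmetry_iff hI hI' hU hJ hg hq ht₀ (hY.const_mul hU c₂)
    (fun A => A.elim0) ha hb hX']
  unfold ConstraintSum ConstraintA
  refine forall₂_congr fun t _ => forall₂_congr fun x _ => forall₂_congr fun u _ => ?_
  have e1 : (fun s => 2 * ψ * c₂ * q s x u * s + c₁ * q s x u)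
      = fun s => (2 * (c₂ * ψ) * s + c₁) * q s x u := by
    funext s; ring
  have e2 : ∑ i, pd i (fun y => q t y u) x * (c₂ * Y x i)
      = c₂ * ∑ i, pd i (fun y => q t y u) x * Y x i := by
    rw [Finset.mul_sum]
    exact Finset.sum_congr rfl fun i _ => by ring
  simp only [Finset.univ_eq_empty, Finset.sum_empty, mul_zero, add_zero, zero_add, zero_sub, e1, e2]

theorem formB_isLieSymmetry_iff (hI : IsOpen I) (hI' : IsConnected I) (hU : IsOpen U)
    (hJ : IsOpen J) (hg : IsMetricOn g U)
    (hq : ContDiffOn ℝ ∞ (fun w : ℝ × (Fin n → ℝ) × ℝ => q w.1 w.2.1 w.2.2) (I ×ˢ (U ×ˢ J)))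
    (ht₀ : t₀ ∈ I) {S : (Fin n → ℝ) → ℝ} {ψ c₁ : ℝ} {T F : ℝ → ℝ}
    {b : ℝ → (Fin n → ℝ) → ℝ} (hS : ContDiffOn ℝ ∞ S U) (hY : IsHomothetic g U (grad g S) ψ)
    (hT : ContDiffOn ℝ ∞ T I) (hF : ContDiffOn ℝ ∞ F I)
    (hb : ContDiffOn ℝ ∞ (fun w : ℝ × (Fin n → ℝ) => b w.1 w.2) (I ×ˢ U))
    (hX : FormB I U J X g t₀ S ψ c₁ T F b) :
    IsLieSymmetry (spaceTime I U) J (heatEq g q) X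
      ↔ ConstraintB I U J g q t₀ S ψ c₁ T F b := by
  -- The superposition with `Y = 0` and a single gradient term.
  have hX' : FormSum I U J X g t₀ (fun _ _ => 0) 0 c₁
      (fun _ : Fin 1 => S) (fun _ => ψ) (fun _ => T) F b := by
    intro t ht x hx u hu
    obtain ⟨h0, h1, h2⟩ := hX t ht x hx u hu
    refine ⟨h0.trans ?_, fun i => (h1 i).trans (by simp), h2.trans ?_⟩
    · dsimp only
      rw [Finset.univ_unique, Finset.sum_singleton]
      ring
    · dsimp only
      rw [Finset.univ_unique, Finset.sum_singleton]
      ring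
  rw [formSum_isLieSymmetry_iff hI hI' hU hJ hg hq ht₀ isHomothetic_zero
    (fun _ => ⟨hS, hY, hT⟩) hF hb hX']
  unfold ConstraintSum ConstraintB
  refine forall₂_congr fun t _ => forall₂_congr fun x _ => forall₂_congr fun u _ => ?_
  have e1 : (fun s => 2 * ψ * q s x u * (∫ s' in t₀..s, T s') + c₁ * q s x u)
      = fun s => (2 * (ψ * ∫ s' in t₀..s, T s') + c₁) * q s x u := by
    funext s; ring
  have e2 : ∑ i, pd i (fun y => q t y u) x * (T t * grad g S x i)
      = T t * ∑ i, pd i (fun y => q t y u) x * grad g S x i := by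
    rw [Finset.mul_sum]
    exact Finset.sum_congr rfl fun i _ => by ring
  simp only [Finset.univ_unique, Finset.sum_singleton, mul_zero, zero_mul, zero_add, e1, e2]
  simp only [← mul_assoc]

end Form

end HeatFlux

theorem mainTheorem2 (n : ℕ) (hn : 0 < n)
    (I J : Set ℝ) (hI : IsOpen I) (hI' : IsConnected I) (hJ : IsOpen J) (hJ' : IsConnected J)
    (U : Set (Fin n → ℝ)) (hU : IsOpen U) (hU' : IsConnected U)
    (g : (Fin n → ℝ) → Matrix (Fin n) (Fin n) ℝ) (hg : HeatFlux.IsMetricOn g U)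
    (q : ℝ → (Fin n → ℝ) → ℝ → ℝ)
    (hq : ContDiffOn ℝ ∞ (fun w : ℝ × (Fin n → ℝ) × ℝ => q w.1 w.2.1 w.2.2) (I ×ˢ (U ×ˢ J)))
    (t₀ : ℝ) (ht₀ : t₀ ∈ I) :
    -- the Lie point symmetries are built from the homothetic algebra of `g`
    ((∀ X : HeatFlux.PointField (Fin (n + 1)),
        HeatFlux.IsLieSymmetry (HeatFlux.spaceTime I U) J (HeatFlux.heatEq g q) X →
        ∃ (Y : (Fin n → ℝ) → Fin n → ℝ) (ψ₀ c₁ : ℝ) (N : ℕ) (S : Fin N → (Fin n → ℝ) → ℝ)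
          (ψ : Fin N → ℝ) (T : Fin N → ℝ → ℝ) (F : ℝ → ℝ) (b : ℝ → (Fin n → ℝ) → ℝ),
          HeatFlux.IsHomothetic g U Y ψ₀ ∧
          (∀ A, ContDiffOn ℝ ∞ (S A) U ∧
            HeatFlux.IsHomothetic g U (HeatFlux.grad g (S A)) (ψ A) ∧ ContDiffOn ℝ ∞ (T A) I) ∧
          ContDiffOn ℝ ∞ F I ∧
          ContDiffOn ℝ ∞ (fun w : ℝ × (Fin n → ℝ) => b w.1 w.2) (I ×ˢ U) ∧
          HeatFlux.FormSum I U J X g t₀ Y ψ₀ c₁ S ψ T F b) ∧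
      (∀ (Y : (Fin n → ℝ) → Fin n → ℝ) (ψ₀ c₁ : ℝ) (N : ℕ) (S : Fin N → (Fin n → ℝ) → ℝ)
          (ψ : Fin N → ℝ) (T : Fin N → ℝ → ℝ) (F : ℝ → ℝ) (b : ℝ → (Fin n → ℝ) → ℝ),
          HeatFlux.IsHomothetic g U Y ψ₀ →
          (∀ A, ContDiffOn ℝ ∞ (S A) U ∧
            HeatFlux.IsHomothetic g U (HeatFlux.grad g (S A)) (ψ A) ∧ ContDiffOn ℝ ∞ (T A) I) →
          ContDiffOn ℝ ∞ F I →
          ContDiffOn ℝ ∞ (fun w : ℝ × (Fin n → ℝ) => b w.1 w.2) (I ×ˢ U) →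
          ∀ X : HeatFlux.PointField (Fin (n + 1)),
            HeatFlux.FormSum I U J X g t₀ Y ψ₀ c₁ S ψ T F b →
            (HeatFlux.IsLieSymmetry (HeatFlux.spaceTime I U) J (HeatFlux.heatEq g q) X ↔
              HeatFlux.ConstraintSum I U J g q t₀ Y ψ₀ c₁ S ψ T F b))) ∧
    -- case a: `Y` is a nongradient HV/KV
    (∀ (Y : (Fin n → ℝ) → Fin n → ℝ) (ψ : ℝ),
      HeatFlux.IsHomothetic g U Y ψ → ¬ HeatFlux.IsGradient g U Y →
      (∀ X : HeatFlux.PointField (Fin (n + 1)),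
        HeatFlux.IsLieSymmetry (HeatFlux.spaceTime I U) J (HeatFlux.heatEq g q) X →
        (∃ T : ℝ → ℝ, ∀ t ∈ I, ∀ x ∈ U, ∀ u ∈ J, ∀ i : Fin n,
          X.ξ i.succ (Matrix.vecCons t x) u = T t * Y x i) →
        ∃ (c₁ c₂ : ℝ) (a : ℝ → ℝ) (b : ℝ → (Fin n → ℝ) → ℝ),
          ContDiffOn ℝ ∞ a I ∧
          ContDiffOn ℝ ∞ (fun w : ℝ × (Fin n → ℝ) => b w.1 w.2) (I ×ˢ U) ∧
          HeatFlux.FormA I U J X Y ψ c₁ c₂ a b) ∧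
      (∀ (c₁ c₂ : ℝ) (a : ℝ → ℝ) (b : ℝ → (Fin n → ℝ) → ℝ),
        ContDiffOn ℝ ∞ a I →
        ContDiffOn ℝ ∞ (fun w : ℝ × (Fin n → ℝ) => b w.1 w.2) (I ×ˢ U) →
        ∀ X : HeatFlux.PointField (Fin (n + 1)), HeatFlux.FormA I U J X Y ψ c₁ c₂ a b →
          (HeatFlux.IsLieSymmetry (HeatFlux.spaceTime I U) J (HeatFlux.heatEq g q) X ↔
            HeatFlux.ConstraintA I U J g q Y ψ c₁ c₂ a b))) ∧
    -- case b: `Y = ∇S` is a gradient HV/KV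
    (∀ (S : (Fin n → ℝ) → ℝ) (ψ : ℝ), ContDiffOn ℝ ∞ S U →
      HeatFlux.IsHomothetic g U (HeatFlux.grad g S) ψ →
      (∀ X : HeatFlux.PointField (Fin (n + 1)),
        HeatFlux.IsLieSymmetry (HeatFlux.spaceTime I U) J (HeatFlux.heatEq g q) X →
        ∀ T : ℝ → ℝ, ContDiffOn ℝ ∞ T I →
        (∀ t ∈ I, ∀ x ∈ U, ∀ u ∈ J, ∀ i : Fin n,
          X.ξ i.succ (Matrix.vecCons t x) u = T t * HeatFlux.grad g S x i) →
        ∃ (c₁ : ℝ) (F : ℝ → ℝ) (b : ℝ → (Fin n → ℝ) → ℝ),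
          ContDiffOn ℝ ∞ F I ∧
          ContDiffOn ℝ ∞ (fun w : ℝ × (Fin n → ℝ) => b w.1 w.2) (I ×ˢ U) ∧
          HeatFlux.FormB I U J X g t₀ S ψ c₁ T F b) ∧
      (∀ (c₁ : ℝ) (T F : ℝ → ℝ) (b : ℝ → (Fin n → ℝ) → ℝ),
        ContDiffOn ℝ ∞ T I → ContDiffOn ℝ ∞ F I →
        ContDiffOn ℝ ∞ (fun w : ℝ × (Fin n → ℝ) => b w.1 w.2) (I ×ˢ U) →
        ∀ X : HeatFlux.PointField (Fin (n + 1)), HeatFlux.FormB I U J X g t₀ S ψ c₁ T F b →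
          (HeatFlux.IsLieSymmetry (HeatFlux.spaceTime I U) J (HeatFlux.heatEq g q) X ↔
            HeatFlux.ConstraintB I U J g q t₀ S ψ c₁ T F b))) := by
  refine ⟨⟨fun X hX => hX.exists_formSum hn hI hI' hU hU' hJ hJ' hg hq ht₀,
      fun Y ψ₀ c₁ N S ψ T F b hY hS hF hb X hX =>
        HeatFlux.formSum_isLieSymmetry_iff hI hI' hU hJ hg hq ht₀ hY hS hF hb hX⟩,
    fun Y ψ hY hYg =>
      ⟨fun X hX ⟨T, hT⟩ => hX.exists_formA hn hI hI' hU hU' hJ hJ' hg hq hY hYg hT,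
        fun c₁ c₂ a b ha hb X hX =>
          HeatFlux.formA_isLieSymmetry_iff hI hI' hU hJ hg hq ht₀ hY ha hb hX⟩,
    fun S ψ hS hY =>
      ⟨fun X hX T hTs hT => hX.exists_formB hn hI hI' hU hU' hJ hJ' hg hq ht₀ hS hY hTs hT,
        fun c₁ T F b hT hF hb X hX =>
          HeatFlux.formB_isLieSymmetry_iff hI hI' hU hJ hg hq ht₀ hS hY hT hF hb hX⟩⟩
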